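/- Let $\Lambda\subset\mathbb C$ be a lattice, let $\wp$ and $\sigma$ be its Weierstrass functions, $\zeta=\sigma'/\sigma$, and let $\wp(x)=x^{-2}+\sum_{n\ge 0}a_nx^n$ be the Laurent expansion at $x=0$. For $k\notin\Lambda$, $x\in\mathbb C\setminus\Lambda$ and $t=(t_2,t_3,\dots)$ put $$\Phi(x;k)=\frac{\sigma(x+k)}{\sigma(x)}e^{-\zeta(k)x},\qquad \Psi(x,t;k)=\Phi(x;k)\exp\Big[\sum_{j\ge0}\Big(\frac{\wp^{(j)}(k)}{(j+1)!}-\frac{a_j}{j+1}\Big)t_{j+2}\Big].$$ Let $\mathcal A$ be the ring of holomorphic functions on $\mathbb C\setminus\Lambda$ and $\mathcal E$ the ring of formal pseudo-differential operators $\sum_{n\le N}p_n\partial_x^n$, $p_n\in\mathcal A$, with the generalized Leibniz product; $(P)_{\ge0}$ and $(P)_{<0}$ denote the parts of $P\in\mathcal E$ of non-negative and of negative order. It acts on formal series $(\sum_{j\le N}f_j\lambda^j)e^{\xi}$, $f_j\in\mathcal A$, where $\xi(x,t;\lambda)=\lambda x+\sum_{j\ge2}\lambda^jt_j$, through $\partial_x(f\lambda^je^\xi)=(f'\lambda^j+f\lambda^{j+1})e^\xi$;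 on these $\partial_{t_n}\big((\sum_j f_j\lambda^j)e^\xi\big)=\big(\sum_j(\partial_{t_n}f_j)\lambda^j+\sum_jf_j\lambda^{j+n}\big)e^\xi$ if the $f_j$ depend on $t$. Let $v_{0,n}(x)$ and $c_n(t)$ be the coefficients of the expansions at $\lambda=\infty$ $$\frac{\sigma(x-\lambda^{-1})}{\sigma(x)}e^{(\zeta(\lambda^{-1})-\lambda)x}=1+\sum_{n\ge1}v_{0,n}(x)\lambda^{-n},\qquad \exp\Big[\sum_{j\ge0}\omega_{j+2}(\lambda)t_{j+2}\Big]=1+\sum_{n\ge1}c_n(t)\lambda^{-n},$$ $$\omega_{j+2}(\lambda)=\sum_{m\ge1}\frac{(-1)^m(m+j)!}{m!\,(j+1)!}a_{m+j}\lambda^{-m},$$ and put $V_0=1+\sum_{n\ge1}v_{0,n}(x)\partial_x^{-n}$, $C(t)=1+\sum_{n\ge1}c_n(t)\partial_x^{-n}$, $L_0=V_0\partial_xV_0^{-1}$. Let $T$ be the set of all $t$ for which $\sum_j|t_j|r^j<\infty$ for every $r>0$; for $t\in T$ the series $\xi$ converges for all $\lambda$. Then every $v_{0,n}$ is holomorphic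 on $\mathbb C\setminus\Lambda$, $V_0$ is invertible in $\mathcal E$, $L_0=\partial_x+u_2\partial_x^{-1}+u_3\partial_x^{-2}+\cdots$, and for $t\in T$ and $k\notin\Lambda$ the series defining $\Psi(x,t;k)$ converges. Moreover: (1) For every $k\notin\Lambda$ and every $t$ for which the series defining $\Psi(x,t;k)$ converges absolutely, $\Psi(x,t;k)$ is holomorphic in $x\in\mathbb C\setminus\Lambda$ and $\partial_{t_n}\Psi=(L_0^n)_{\ge0}\Psi$ for all $n\ge1$, where $t_1=x$. That is, $\Psi$ is an eigenfunction of $L_0$. (2) Let $t\in T$. If $\lambda\ne0$ and $|\lambda^{-1}|<|l|$ for all $l\in\Lambda\setminus\{0\}$, then $\Psi(x,t;-\lambda^{-1})=V_0C(t)e^{\xi(x,t;\lambda)}$, where the right-hand side, of the form $(1+\sum_{n\ge1}v_n(x,t)\lambda^{-n})e^{\xi}$, converges. The formal series $\psi=V_0C(t)e^\xi$ is a wave function of $L_0$ with eigenvalue $\lambda=-k^{-1}$: $L_0\psi=\lambda\psi$ and $\partial_{t_n}\psi=(L_0^n)_{\ge0}\psi$ for all $n\ge1$. (3) Consequently $V=V_0C(t)$,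 $t\in T$, is a wave operator for $L_0$: it has the form $1+\sum_{n\ge1}v_n\partial_x^{-n}$, is invertible, $\psi=Ve^\xi$, $L_0=V\partial_xV^{-1}$, and $\partial_{t_n}V=(L_0^n)_{\ge0}V-V\partial_x^n=-(V\partial_x^nV^{-1})_{<0}V$ for all $n\ge2$. -/

import Mathlib

noncomputable section

/-! ### Formal pseudo-differential operators over a commutative differential ring -/

/-- Coefficients of the generalized Leibniz rule
`(∑ₙ pₙ ∂ⁿ) (∑ₘ qₘ ∂ᵐ) = ∑ₙₘ ∑_{r ≥ 0} (n choose r) pₙ ∂ʳ(qₘ) ∂^{n+m-r}`: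
the coefficient of `∂ᵏ`, where `m = k - n + r`. -/
def leibnizCoeff {A : Type*} [CommRing A] [Differential A] (p q : ℤ → A) (k : ℤ) : A :=
  ∑ᶠ nr : ℤ × ℕ, Ring.choose nr.1 nr.2 •
    (p nr.1 * (⇑(Differential.deriv (R := A)))^[nr.2] (q (k - nr.1 + nr.2)))

theorem leibniz_term_eq_zero {A : Type*} [CommRing A] [Differential A] {p q : ℤ → A} {N M : ℤ}
    (hp : ∀ n, N < n → p n = 0) (hq : ∀ n, M < n → q n = 0) (k : ℤ) (nr : ℤ × ℕ)
    (h : N < nr.1 ∨ M < k - nr.1 + nr.2) :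
    Ring.choose nr.1 nr.2 •
      (p nr.1 * (⇑(Differential.deriv (R := A)))^[nr.2] (q (k - nr.1 + nr.2))) = 0 := by
  rcases h with h | h
  · simp [hp _ h]
  · rw [hq _ h, Function.iterate_fixed (map_zero _)]
    simp

/-- For operators of finite order the sum in `leibnizCoeff` has only finitely many nonzero
terms. -/
theorem leibniz_support_finite {A : Type*} [CommRing A] [Differential A] {p q : ℤ → A} {N M : ℤ}
    (hp : ∀ n, N < n → p n = 0) (hq : ∀ n, M < n → q n = 0) (k : ℤ) :
    (Function.support fun nr : ℤ × ℕ => Ring.choose nr.1 nr.2 •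
      (p nr.1 * (⇑(Differential.deriv (R := A)))^[nr.2] (q (k - nr.1 + nr.2)))).Finite := by
  refine ((Set.finite_Icc (k - M) N).prod (Set.finite_Iic (M - k + N).toNat)).subset ?_
  intro nr h
  by_contra hc
  apply h
  apply leibniz_term_eq_zero hp hq
  by_contra h'
  push Not at h'
  apply hc
  simp only [Set.mem_prod, Set.mem_Icc, Set.mem_Iic]
  omega

theorem leibnizCoeff_bdd {A : Type*} [CommRing A] [Differential A] {p q : ℤ → A}
    (hp : ∃ N : ℤ, ∀ n, N < n → p n = 0) (hq : ∃ M : ℤ, ∀ n, M < n → q n = 0) :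
    ∃ K : ℤ, ∀ k, K < k → leibnizCoeff p q k = 0 := by
  obtain ⟨N, hN⟩ := hp
  obtain ⟨M, hM⟩ := hq
  refine ⟨N + M, fun k hk => ?_⟩
  apply finsum_eq_zero_of_forall_eq_zero
  intro nr
  apply leibniz_term_eq_zero hN hM
  omega

/-- A formal pseudo-differential operator `∑_{-∞ < n ≪ +∞} aₙ ∂ⁿ` with coefficients in `A`. -/
@[ext]
structure PseudoDiffOp (A : Type*) [CommRing A] where
  coeff : ℤ → A
  bdd : ∃ N : ℤ, ∀ n, N < n → coeff n = 0

/-- An element `(∑_{-∞ < j ≪ +∞} aⱼ λʲ) e^ξ` of the module of formal Baker-Akhiezer functions. -/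
@[ext]
structure FormalWave (A : Type*) [CommRing A] where
  coeff : ℤ → A
  bdd : ∃ N : ℤ, ∀ n, N < n → coeff n = 0

namespace PseudoDiffOp

/-- The operator `∂ᵏ`. -/
def D {A : Type*} [CommRing A] (k : ℤ) : PseudoDiffOp A where
  coeff n := if n = k then 1 else 0
  bdd := ⟨k, fun n hn => if_neg (by omega)⟩

/-- The operator `1 + w₁ ∂⁻¹ + w₂ ∂⁻² + ⋯` (the value `w 0` is not used). -/
def monic {A : Type*} [CommRing A] (w : ℕ → A) : PseudoDiffOp A where
  coeff n := if n = 0 then 1 else if n < 0 then w (-n).toNat else 0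
  bdd := ⟨0, fun n hn => by rw [if_neg (by omega), if_neg (by omega)]⟩

instance {A : Type*} [CommRing A] : One (PseudoDiffOp A) := ⟨D 0⟩

instance {A : Type*} [CommRing A] : Neg (PseudoDiffOp A) :=
  ⟨fun P => ⟨fun n => -P.coeff n, by
    obtain ⟨N, hN⟩ := P.bdd
    exact ⟨N, fun n hn => by rw [hN n hn, neg_zero]⟩⟩⟩

instance {A : Type*} [CommRing A] : Sub (PseudoDiffOp A) :=
  ⟨fun P Q => ⟨fun n => P.coeff n - Q.coeff n, by
    obtain ⟨N, hN⟩ := P.bdd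
    obtain ⟨M, hM⟩ := Q.bdd
    exact ⟨max N M, fun n hn => by
      rw [hN n (lt_of_le_of_lt (le_max_left _ _) hn),
        hM n (lt_of_le_of_lt (le_max_right _ _) hn), sub_zero]⟩⟩⟩

instance {A : Type*} [CommRing A] [Differential A] : Mul (PseudoDiffOp A) :=
  ⟨fun P Q => ⟨leibnizCoeff P.coeff Q.coeff, leibnizCoeff_bdd P.bdd Q.bdd⟩⟩

instance {A : Type*} [CommRing A] [Differential A] : Pow (PseudoDiffOp A) ℕ :=
  ⟨fun P n => npowRec n P⟩

/-- `Q` is a two-sided inverse of `P`. -/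
def IsInverse {A : Type*} [CommRing A] [Differential A] (P Q : PseudoDiffOp A) : Prop :=
  P * Q = 1 ∧ Q * P = 1

open Classical in
/-- The two-sided inverse of an invertible operator (and `1` if there is none). -/
instance {A : Type*} [CommRing A] [Differential A] : Inv (PseudoDiffOp A) :=
  ⟨fun P => if h : ∃ Q, IsInverse P Q then h.choose else 1⟩

/-- The projection `(P)_{≥ 0}` to differential operators. -/
def nonneg {A : Type*} [CommRing A] (P : PseudoDiffOp A) : PseudoDiffOp A where
  coeff n := if 0 ≤ n then P.coeff n else 0
  bdd := by
    obtain ⟨N, hN⟩ := P.bdd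
    exact ⟨N, fun n hn => by rw [hN n hn, ite_self]⟩

/-- The projection `(P)_{< 0}` to operators of negative order. -/
def negPart {A : Type*} [CommRing A] (P : PseudoDiffOp A) : PseudoDiffOp A where
  coeff n := if n < 0 then P.coeff n else 0
  bdd := by
    obtain ⟨N, hN⟩ := P.bdd
    exact ⟨N, fun n hn => by rw [hN n hn, ite_self]⟩

/-- `P` has the form `1 + w₁ ∂⁻¹ + w₂ ∂⁻² + ⋯`. -/
def IsMonicOrderZero {A : Type*} [CommRing A] (P : PseudoDiffOp A) : Prop :=
  P.coeff 0 = 1 ∧ ∀ n, 0 < n → P.coeff n = 0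

/-- `P` has the form `∂ + u₂ ∂⁻¹ + u₃ ∂⁻² + ⋯`. -/
def IsLaxForm {A : Type*} [CommRing A] (P : PseudoDiffOp A) : Prop :=
  P.coeff 1 = 1 ∧ P.coeff 0 = 0 ∧ ∀ n, 1 < n → P.coeff n = 0

end PseudoDiffOp

namespace FormalWave

/-- The element `e^ξ`. -/
def expXi {A : Type*} [CommRing A] : FormalWave A where
  coeff n := if n = 0 then 1 else 0
  bdd := ⟨0, fun n hn => if_neg (by omega)⟩

/-- Multiplication by the spectral parameter `λ`. -/
def mulLambda {A : Type*} [CommRing A] (F : FormalWave A) : FormalWave A where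
  coeff n := F.coeff (n - 1)
  bdd := by
    obtain ⟨N, hN⟩ := F.bdd
    exact ⟨N + 1, fun n hn => hN _ (by omega)⟩

/-- The action of pseudo-differential operators determined by
`∂ (a λʲ e^ξ) = (∂(a) λʲ + a λʲ⁺¹) e^ξ`, that is
`p ∂ⁿ (a λʲ e^ξ) = ∑_{r ≥ 0} (n choose r) p ∂ʳ(a) λ^{j+n-r} e^ξ`. -/
instance {A : Type*} [CommRing A] [Differential A] : SMul (PseudoDiffOp A) (FormalWave A) :=
  ⟨fun P F => ⟨leibnizCoeff P.coeff F.coeff, leibnizCoeff_bdd P.bdd F.bdd⟩⟩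

end FormalWave

/-! ### The differential ring of holomorphic functions on an open subset of `ℂ` -/

/-- Holomorphic functions on `U`. -/
def HolFun (U : TopologicalSpace.Opens ℂ) : Subalgebra ℂ (U → ℂ) where
  carrier := {f | ∃ g : ℂ → ℂ, DifferentiableOn ℂ g U ∧ ∀ x : U, f x = g x}
  mul_mem' := by
    rintro f f' ⟨g, hg, h⟩ ⟨g', hg', h'⟩
    exact ⟨g * g', hg.mul hg', fun x => by simp [h, h']⟩
  add_mem' := by
    rintro f f' ⟨g, hg, h⟩ ⟨g', hg', h'⟩
    exact ⟨g + g', hg.add hg', fun x => by simp [h, h']⟩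
  algebraMap_mem' c := ⟨fun _ => c, differentiableOn_const c, fun _ => rfl⟩

namespace HolFun

variable {U : TopologicalSpace.Opens ℂ}

open Classical in
/-- Extension by zero to `ℂ`. -/
def ext0 (f : U → ℂ) (x : ℂ) : ℂ := if h : x ∈ U then f ⟨x, h⟩ else 0

theorem ext0_coe (f : U → ℂ) (x : U) : ext0 f x = f x := by
  simp [ext0]

theorem differentiableOn_ext0 (f : HolFun U) : DifferentiableOn ℂ (ext0 f.1) U := by
  obtain ⟨g, hg, h⟩ := f.2
  refine hg.congr fun x hx => ?_
  exact (ext0_coe f.1 ⟨x, hx⟩).trans (h ⟨x, hx⟩)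

theorem differentiableAt_ext0 (f : HolFun U) (x : U) :
    DifferentiableAt ℂ (ext0 f.1) x :=
  (differentiableOn_ext0 f).differentiableAt (U.isOpen.mem_nhds x.2)

/-- The complex derivative, as a derivation of the ring of holomorphic functions. -/
instance : Differential (HolFun U) where
  deriv := Derivation.mk'
    { toFun := fun f => ⟨fun x => deriv (ext0 f.1) x,
        deriv (ext0 f.1), (differentiableOn_ext0 f).deriv U.isOpen, fun _ => rfl⟩
      map_add' := fun f g => by
        apply Subtype.ext
        funext x
        have h : ext0 (f + g).1 = ext0 f.1 + ext0 g.1 := by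
          funext y
          by_cases hy : y ∈ U <;> simp [ext0, hy]
        change deriv (ext0 (f + g).1) x = deriv (ext0 f.1) x + deriv (ext0 g.1) x
        rw [h]
        exact deriv_add (differentiableAt_ext0 f x) (differentiableAt_ext0 g x)
      map_smul' := fun n f => by
        apply Subtype.ext
        funext x
        have h : ext0 (n • f).1 = fun y => (n : ℂ) * ext0 f.1 y := by
          funext y
          by_cases hy : y ∈ U <;> simp [ext0, hy]
        change deriv (ext0 (n • f).1) x = n • deriv (ext0 f.1) x
        rw [h, deriv_const_mul _ (differentiableAt_ext0 f x), zsmul_eq_mul] }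
    (fun f g => by
      apply Subtype.ext
      funext x
      have h : ext0 (f * g).1 = ext0 f.1 * ext0 g.1 := by
        funext y
        by_cases hy : y ∈ U <;> simp [ext0, hy]
      change deriv (ext0 (f * g).1) x
        = f.1 x * deriv (ext0 g.1) x + g.1 x * deriv (ext0 f.1) x
      rw [h, deriv_mul (differentiableAt_ext0 f x) (differentiableAt_ext0 g x),
        ext0_coe, ext0_coe]
      ring)

theorem deriv_apply (f : HolFun U) (x : U) :
    (Differential.deriv f).1 x = deriv (ext0 f.1) x := rfl

open Classical in
/-- The element of `HolFun U` given by a function that is holomorphic on `U`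
(and `0` if the function is not holomorphic on `U`). -/
def ofFun (U : TopologicalSpace.Opens ℂ) (g : ℂ → ℂ) : HolFun U :=
  if h : DifferentiableOn ℂ g U then ⟨fun x => g x, g, h, fun _ => rfl⟩ else 0

end HolFun

/-- The differential operator `(P)_{≥ 0} = ∑_{i ≥ 0} bᵢ(x) ∂ⁱ` applied to a function `f`, at the
point `x`. Only finitely many `bᵢ` are nonzero. -/
def PseudoDiffOp.applyNonneg {U : TopologicalSpace.Opens ℂ} (P : PseudoDiffOp (HolFun U))
    (f : ℂ → ℂ) (x : U) : ℂ :=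
  ∑ᶠ i : ℕ, (P.nonneg.coeff (i : ℤ)).1 x * iteratedDeriv i f x

namespace PeriodPair

/-! ### Weierstrass functions and the Lamé function -/

/-- The Weierstrass `σ`-function. -/
def sigma (L : PeriodPair) (z : ℂ) : ℂ :=
  z * ∏' l : {l : L.lattice // l ≠ 0},
    (1 - z / (l : ℂ)) * Complex.exp (z / (l : ℂ) + z ^ 2 / (2 * (l : ℂ) ^ 2))

/-- The Weierstrass `ζ`-function `σ' / σ`. -/
def zeta (L : PeriodPair) (z : ℂ) : ℂ := deriv L.sigma z / L.sigma z

/-- The coefficients of the Laurent expansion `℘(x) = x⁻² + ∑ₙ aₙ xⁿ` at `x = 0`;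
`weierstrassPExcept 0` is `℘(x) - x⁻²`. -/
def laurentCoeff (L : PeriodPair) (n : ℕ) : ℂ :=
  iteratedDeriv n (L.weierstrassPExcept 0) 0 / (n.factorial : ℂ)

/-- The Lamé function `Φ(x; k)`. -/
def lamePhi (L : PeriodPair) (x k : ℂ) : ℂ :=
  L.sigma (x + k) / L.sigma x * Complex.exp (-L.zeta k * x)

/-- The coefficient `℘⁽ʲ⁾(k) / (j+1)! - aⱼ / (j+1)` of `t_{j+2}`. -/
def timeCoeff (L : PeriodPair) (k : ℂ) (j : ℕ) : ℂ :=
  iteratedDeriv j L.weierstrassP k / ((j + 1).factorial : ℂ) - L.laurentCoeff j / ((j : ℂ) + 1)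

/-- The function `Ψ(x, t; k)`. Here and below `t j` stands for the time variable `t_{j+2}`. -/
def wavePsi (L : PeriodPair) (x : ℂ) (t : ℕ → ℂ) (k : ℂ) : ℂ :=
  L.lamePhi x k * Complex.exp (∑' j : ℕ, L.timeCoeff k j * t j)

/-- The complement of the lattice, in which `x` varies. -/
def domain (L : PeriodPair) : TopologicalSpace.Opens ℂ :=
  ⟨(L.lattice : Set ℂ)ᶜ, L.isClosed_lattice.isOpen_compl⟩

/-- The function `z ↦ v̂₀(x; 1/z) = σ(x - z) / σ(x) · exp((ζ(z) - 1/z) x)`, where `z = 1/λ`.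
It is regular at `z = 0` with value `1`, which is also its value there in Lean,
as `ζ 0 = 0` and `1 / 0 = 0` by convention. -/
def vHat0 (L : PeriodPair) (x z : ℂ) : ℂ :=
  L.sigma (x - z) / L.sigma x * Complex.exp ((L.zeta z - 1 / z) * x)

/-- The coefficient `v_{0,n}(x)` of `λ⁻ⁿ` in `v̂₀(x; λ)`. -/
def v0 (L : PeriodPair) (n : ℕ) (x : ℂ) : ℂ :=
  iteratedDeriv n (L.vHat0 x) 0 / (n.factorial : ℂ)

/-- `V₀ = 1 + ∑_{n ≥ 1} v_{0,n}(x) ∂⁻ⁿ`. -/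
def opV0 (L : PeriodPair) : PseudoDiffOp (HolFun L.domain) :=
  PseudoDiffOp.monic fun n => HolFun.ofFun L.domain (L.v0 n)

/-- `L₀ = V₀ ∂ V₀⁻¹`. -/
def opL0 (L : PeriodPair) : PseudoDiffOp (HolFun L.domain) :=
  L.opV0 * PseudoDiffOp.D 1 * L.opV0⁻¹

/-- `ω_{j+2}(λ) = ∑_{m ≥ 1} (-1)ᵐ (m+j)! / (m! (j+1)!) a_{m+j} λ⁻ᵐ` as a function of `z = 1/λ`. -/
def omega (L : PeriodPair) (j : ℕ) (z : ℂ) : ℂ :=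
  ∑' i : ℕ, (-1) ^ (i + 1) * ((i + 1 + j).factorial : ℂ) /
    (((i + 1).factorial : ℂ) * ((j + 1).factorial : ℂ)) * L.laurentCoeff (i + 1 + j) * z ^ (i + 1)

/-- The coefficient `cₙ(t)` of `λ⁻ⁿ` in `exp (∑ⱼ ω_{j+2}(λ) t_{j+2})`. -/
def cCoeff (L : PeriodPair) (t : ℕ → ℂ) (n : ℕ) : ℂ :=
  iteratedDeriv n (fun z => Complex.exp (∑' j : ℕ, L.omega j z * t j)) 0 / (n.factorial : ℂ)

/-- `C(t; ∂) = 1 + c₁(t) ∂⁻¹ + c₂(t) ∂⁻² + ⋯`. -/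
def opC (L : PeriodPair) (t : ℕ → ℂ) : PseudoDiffOp (HolFun L.domain) :=
  PseudoDiffOp.monic fun n => algebraMap ℂ (HolFun L.domain) (L.cCoeff t n)

end PeriodPair

/-! ### Wave functions and wave operators -/

/-- The sequences of times `t = (t₂, t₃, …)` for which `ξ(x, t; λ)` converges (absolutely) for
every `λ`. Every finitely supported sequence is of this kind. -/
def entireTimes : Set (ℕ → ℂ) := {t | ∀ r : ℝ, Summable fun j => ‖t j‖ * r ^ j}

/-- `ξ(x, t; λ) = λ x + ∑_{j ≥ 2} λʲ tⱼ`. -/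
def xiPhase (x : ℂ) (t : ℕ → ℂ) (lam : ℂ) : ℂ :=
  lam * x + ∑' j : ℕ, lam ^ (j + 2) * t j

/-- `∂P / ∂t_{j+2} = Q` at `t`, coefficientwise, for an operator `P` depending on `t`. -/
def HasOpTimeDerivAt {U : TopologicalSpace.Opens ℂ} (P : (ℕ → ℂ) → PseudoDiffOp (HolFun U))
    (Q : PseudoDiffOp (HolFun U)) (j : ℕ) (t : ℕ → ℂ) : Prop :=
  ∀ (m : ℤ) (x : U),
    HasDerivAt (fun s : ℂ => ((P (t + Pi.single j s)).coeff m).1 x) ((Q.coeff m).1 x) 0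

/-- `∂F / ∂t_{j+2} = G` at `t` for formal Baker-Akhiezer functions, where
`∂((∑ₘ aₘ λᵐ) e^ξ) / ∂tₙ = (∑ₘ (∂aₘ/∂tₙ) λᵐ + ∑ₘ aₘ λ^{m+n}) e^ξ`. -/
def HasWaveTimeDerivAt {U : TopologicalSpace.Opens ℂ} (F : (ℕ → ℂ) → FormalWave (HolFun U))
    (G : FormalWave (HolFun U)) (j : ℕ) (t : ℕ → ℂ) : Prop :=
  ∀ (m : ℤ) (x : U), ∃ a' : ℂ,
    HasDerivAt (fun s : ℂ => ((F (t + Pi.single j s)).coeff m).1 x) a' 0 ∧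
      (G.coeff m).1 x = a' + ((F t).coeff (m - ((j : ℤ) + 2))).1 x

/-- `ψ = (1 + ∑_{j ≥ 1} wⱼ λ⁻ʲ) e^ξ` is a wave function of the (time-independent) operator `Lax`:
it has this form, `Lax ψ = λ ψ`, and `∂ψ/∂tₙ = (Laxⁿ)_{≥ 0} ψ` for all `n ≥ 1`,
where `t₁ = x`. -/
structure IsWaveFunction {U : TopologicalSpace.Opens ℂ} (Lax : PseudoDiffOp (HolFun U))
    (ψ : (ℕ → ℂ) → FormalWave (HolFun U)) : Prop where
  coeff_zero : ∀ t ∈ entireTimes, (ψ t).coeff 0 = 1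
  coeff_pos : ∀ t ∈ entireTimes, ∀ n, 0 < n → (ψ t).coeff n = 0
  eigen : ∀ t ∈ entireTimes, Lax • ψ t = (ψ t).mulLambda
  deriv_x : ∀ t ∈ entireTimes,
    (PseudoDiffOp.D 1 : PseudoDiffOp (HolFun U)) • ψ t = (Lax ^ 1).nonneg • ψ t
  deriv_t : ∀ t ∈ entireTimes, ∀ j : ℕ,
    HasWaveTimeDerivAt ψ ((Lax ^ (j + 2)).nonneg • ψ t) j t

/-- `W = 1 + ∑_{j ≥ 1} wⱼ ∂⁻ʲ` is a wave operator of `Lax` with wave function `ψ`: `ψ = W e^ξ`,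
`Lax = W ∂ W⁻¹`, and the Sato-Wilson equation
`∂W/∂tₙ = Bₙ W - W ∂ⁿ = -(W ∂ⁿ W⁻¹)_{< 0} W`, `Bₙ = (Laxⁿ)_{≥ 0}`, holds for all `n ≥ 2`. -/
structure IsWaveOperator {U : TopologicalSpace.Opens ℂ} (Lax : PseudoDiffOp (HolFun U))
    (ψ : (ℕ → ℂ) → FormalWave (HolFun U)) (W : (ℕ → ℂ) → PseudoDiffOp (HolFun U)) : Prop where
  monic : ∀ t ∈ entireTimes, (W t).IsMonicOrderZero
  wave : ∀ t ∈ entireTimes, ψ t = W t • FormalWave.expXi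
  inverse : ∀ t ∈ entireTimes, PseudoDiffOp.IsInverse (W t) (W t)⁻¹
  dressing : ∀ t ∈ entireTimes, Lax = W t * PseudoDiffOp.D 1 * (W t)⁻¹
  sato_wilson : ∀ t ∈ entireTimes, ∀ j : ℕ, HasOpTimeDerivAt W
    ((Lax ^ (j + 2)).nonneg * W t - W t * PseudoDiffOp.D ((j : ℤ) + 2)) j t
  sato_wilson_neg : ∀ t ∈ entireTimes, ∀ j : ℕ, HasOpTimeDerivAt W
    (-((W t * PseudoDiffOp.D ((j : ℤ) + 2) * (W t)⁻¹).negPart * W t)) j t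

/-- The formal Baker-Akhiezer function `V₀ C e^ξ`. -/
def PeriodPair.formalPsi (L : PeriodPair) (t : ℕ → ℂ) : FormalWave (HolFun L.domain) :=
  L.opV0 • (L.opC t • FormalWave.expXi)

end

/-!
Let `n = j + 2` and `B = (L₀ⁿ)_{≥ 0}`. The key identity is `B V₀ = V₀ (∂ⁿ + ω_n(∂⁻¹))`, or,
equivalently, `B Φ(·; k) = c(k) Φ(·; k)` with `c(k) = ℘⁽ʲ⁾(k) / (j+1)! - aⱼ / (j+1)`. For fixed `x`,
`B Φ - c Φ` and `Φ` pick up the same factor when `k` is shifted by a period, so that the quotient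
`(B Φ - c Φ) / Φ` is an elliptic function of `k`. Outside of the lattice it has at most a simple
pole, at the zero `k = -x` of `Φ`. Near `k = -1/λ = 0`, where `Φ = v̂₀ e^{λx}` is the symbol of `V₀`
applied to `e^{λx}` and `c = λⁿ + ω_n(λ)`, it vanishes, because
`B V₀ - V₀ (∂ⁿ + ω_n(∂⁻¹)) = -(L₀ⁿ)_{< 0} V₀ - V₀ ω_n(∂⁻¹)` has negative order. An elliptic function
with at most one simple pole is constant, so the quotient is zero.

As `C(t)` has constant coefficients and `∂C/∂tₙ = ω_n(∂⁻¹) C`, the key identity yields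
`∂(V₀ C)/∂tₙ = V₀ ω_n(∂⁻¹) C = B V₀ C - V₀ C ∂ⁿ`, the Sato-Wilson equation; the remaining claims
about `V = V₀ C` and `ψ = V e^ξ` are formal consequences of it.
-/

noncomputable section FormalOperators

open Finset hiding mem_antidiagonal
open Finset.HasAntidiagonal (mem_antidiagonal)
open scoped PseudoDiffOp

/-! ### Algebra of pseudo-differential operators -/

section IteratedDerivation

variable {A : Type*} [CommRing A] [Differential A]

local notation "𝒟" => @Differential.deriv A _ _

theorem iterate_deriv_finsum {ι : Type*} {f : ι → A} (hf : f.HasFiniteSupport) (n : ℕ) :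
    (⇑𝒟)^[n] (∑ᶠ i, f i) = ∑ᶠ i, (⇑𝒟)^[n] (f i) := by
  induction n with
  | zero => rfl
  | succ n ih =>
    simp only [Function.iterate_succ_apply', ih]
    exact map_finsum _ (hf.subset fun i hi hfi => hi (by
      simp only [hfi, Function.iterate_fixed (map_zero 𝒟)]))

theorem iterate_deriv_zsmul (n : ℕ) (c : ℤ) (f : A) : (⇑𝒟)^[n] (c • f) = c • (⇑𝒟)^[n] f :=
  (Function.Commute.iterate_left (g := fun f : A => c • f) (fun f => map_zsmul 𝒟 c f) n) f

theorem iterate_deriv_mul (n : ℕ) (f g : A) :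
    (⇑𝒟)^[n] (f * g) =
      ∑ ij ∈ antidiagonal n, n.choose ij.1 • ((⇑𝒟)^[ij.1] f * (⇑𝒟)^[ij.2] g) := by
  induction n with
  | zero => simp
  | succ n ih =>
    rw [sum_antidiagonal_choose_succ_nsmul fun i j => (⇑𝒟)^[i] f * (⇑𝒟)^[j] g,
      Function.iterate_succ_apply', ih, map_sum, ← sum_add_distrib]
    refine sum_congr rfl fun ij hij => ?_
    have choose_symm : n.choose ij.1 = n.choose ij.2 :=
      Nat.choose_symm_of_eq_add (mem_antidiagonal.mp hij).symm
    rw [map_nsmul, Derivation.leibniz, smul_add, smul_eq_mul, smul_eq_mul, ← choose_symm,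
      Function.iterate_succ_apply', Function.iterate_succ_apply', mul_comm ((⇑𝒟)^[ij.2] g) (𝒟 _)]

theorem sum_antidiagonal_antidiagonal_assoc {M : Type*} [AddCommMonoid M] (n : ℕ)
    (f : ℕ → ℕ → ℕ → M) :
    ∑ ij ∈ antidiagonal n, ∑ kl ∈ antidiagonal ij.1, f kl.1 kl.2 ij.2 =
      ∑ ij ∈ antidiagonal n, ∑ kl ∈ antidiagonal ij.2, f ij.1 kl.1 kl.2 := by
  rw [sum_sigma', sum_sigma']
  refine sum_nbij' (fun p => ⟨(p.2.1, p.2.2 + p.1.2), p.2.2, p.1.2⟩)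
    (fun p => ⟨(p.1.1 + p.2.1, p.2.2), p.1.1, p.2.1⟩) ?_ ?_ ?_ ?_ fun _ _ => rfl <;>
  grind [mem_antidiagonal]

/-- The coefficient identity behind the associativity of `∂ᵃ g ∂ᵇ h`. -/
theorem leibniz_vandermonde (a b : ℤ) (n : ℕ) (g h : A) :
    ∑ rs ∈ antidiagonal n,
        (Ring.choose a rs.1 * Ring.choose b rs.2) • (⇑𝒟)^[rs.1] (g * (⇑𝒟)^[rs.2] h) =
      ∑ rs ∈ antidiagonal n, (Ring.choose a rs.1 * Ring.choose (a + b - rs.1) rs.2) •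
        ((⇑𝒟)^[rs.1] g * (⇑𝒟)^[rs.2] h) := by
  have expand : ∀ rs ∈ antidiagonal n,
      (Ring.choose a rs.1 * Ring.choose b rs.2) • (⇑𝒟)^[rs.1] (g * (⇑𝒟)^[rs.2] h) =
      ∑ uv ∈ antidiagonal rs.1, (Ring.choose a (uv.1 + uv.2) * Ring.choose b rs.2 *
        ((uv.1 + uv.2).choose uv.1 : ℕ)) • ((⇑𝒟)^[uv.1] g * (⇑𝒟)^[uv.2 + rs.2] h) := by
    intro rs _
    rw [iterate_deriv_mul, smul_sum]
    refine sum_congr rfl fun uv huv => ?_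
    rw [mem_antidiagonal.mp huv, ← natCast_zsmul, smul_smul, Function.iterate_add_apply]
  rw [sum_congr rfl expand, sum_antidiagonal_antidiagonal_assoc n fun u v s =>
    (Ring.choose a (u + v) * Ring.choose b s * ((u + v).choose u : ℕ)) •
      ((⇑𝒟)^[u] g * (⇑𝒟)^[v + s] h)]
  refine sum_congr rfl fun rs _ => ?_
  have vandermonde : Ring.choose (a + b - rs.1) rs.2 = ∑ vs ∈ antidiagonal rs.2,
      Ring.choose (a - rs.1) vs.1 * Ring.choose b vs.2 := by
    rw [← Ring.add_choose_eq _ (Commute.all _ _)]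
    congr 1
    ring
  rw [vandermonde, mul_sum, sum_smul]
  refine sum_congr rfl fun vs hvs => ?_
  have choose_mul := Ring.choose_smul_choose a (Nat.le_add_right rs.1 vs.1)
  rw [nsmul_eq_mul, Nat.add_sub_cancel_left] at choose_mul
  rw [mem_antidiagonal.mp hvs]
  congr 1
  linear_combination Ring.choose b vs.2 * choose_mul

end IteratedDerivation

theorem finsum_eq_finsum_antidiagonal {M : Type*} [AddCommMonoid M] {f : ℕ × ℕ → M}
    (hf : f.HasFiniteSupport) : ∑ᶠ rs, f rs = ∑ᶠ n, ∑ rs ∈ antidiagonal n, f rs := by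
  have sum_fiber (n : ℕ) :
      ∑ rs ∈ antidiagonal n, f rs = ∑ rs ∈ hf.toFinset with rs.1 + rs.2 = n, f rs := by
    refine (sum_subset (fun rs hrs => ?_) fun rs hrs hrs' => ?_).symm
    · exact mem_antidiagonal.mpr (mem_filter.mp hrs).2
    · simp only [mem_filter, mem_antidiagonal.mp hrs, and_true] at hrs'
      simpa using mt hf.mem_toFinset.mpr hrs'
  have support_subset : (Function.support fun n => ∑ rs ∈ antidiagonal n, f rs) ⊆
      hf.toFinset.image fun rs => rs.1 + rs.2 := by
    intro n hn
    obtain ⟨rs, hrs, hne⟩ := exists_ne_zero_of_sum_ne_zero hn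
    exact mem_coe.mpr (mem_image.mpr ⟨rs, hf.mem_toFinset.mpr hne, mem_antidiagonal.mp hrs⟩)
  rw [finsum_eq_sum_of_support_subset _ support_subset, finsum_eq_sum f hf,
    sum_congr rfl fun n _ => sum_fiber n]
  exact (sum_fiberwise_of_maps_to (fun rs hrs => mem_image_of_mem _ hrs) f).symm

theorem finsum_finsum_eq_finsum_finsum_antidiagonal {α β γ M : Type*} [AddCommMonoid M]
    {f : γ × ℕ × ℕ → M} (hf : f.HasFiniteSupport) (e : α × β ≃ γ × ℕ × ℕ) :
    ∑ᶠ (a) (b), f (e (a, b)) = ∑ᶠ (c) (n), ∑ rs ∈ antidiagonal n, f (c, rs) := by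
  rw [← finsum_curry (fun ab => f (e ab)) (hf.preimage e.injective.injOn), finsum_comp_equiv e,
    finsum_curry f hf]
  exact finsum_congr fun c => finsum_eq_finsum_antidiagonal
    (hf.preimage (Prod.mk_right_injective c).injOn)

theorem hasFiniteSupport_of_order_le {M : Type*} [Zero M] {a b c k : ℤ}
    {f : (ℤ × ℤ) × ℕ × ℕ → M}
    (hf : ∀ n m i j, a < n ∨ b < m ∨ c < k - n - m + (i + j : ℕ) → f ((n, m), i, j) = 0) :
    f.HasFiniteSupport := by
  refine (((Set.finite_Icc (k - c - b) a).prod (Set.finite_Icc (k - c - a) b)).prod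
    ((Set.finite_Iic (c - k + a + b).toNat).prod
      (Set.finite_Iic (c - k + a + b).toNat))).subset ?_
  rintro ⟨⟨n, m⟩, i, j⟩ hne
  have := mt (hf n m i j) hne
  simp only [Set.mem_prod, Set.mem_Icc, Set.mem_Iic]
  omega

section Associativity

variable {A : Type*} [CommRing A] [Differential A] {p q s : ℤ → A} {N M S : ℤ}

local notation "𝒟" => @Differential.deriv A _ _

theorem leibnizCoeff_leibnizCoeff_left (hp : ∀ n, N < n → p n = 0) (hq : ∀ n, M < n → q n = 0)
    (hs : ∀ n, S < n → s n = 0) (k : ℤ) :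
    leibnizCoeff (leibnizCoeff p q) s k =
      ∑ᶠ (nm : ℤ × ℤ) (l : ℕ), ∑ ij ∈ antidiagonal l,
        (Ring.choose nm.1 ij.1 * Ring.choose (nm.1 + nm.2 - ij.1) ij.2) •
          (p nm.1 * ((⇑𝒟)^[ij.1] (q nm.2) *
            (⇑𝒟)^[ij.2] (s (k - nm.1 - nm.2 + (ij.1 + ij.2 : ℕ))))) := by
  let term : (ℤ × ℤ) × ℕ × ℕ → A := fun ⟨⟨n, m⟩, i, j⟩ =>
    (Ring.choose n i * Ring.choose (n + m - i) j) •
      (p n * ((⇑𝒟)^[i] (q m) * (⇑𝒟)^[j] (s (k - n - m + (i + j : ℕ)))))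
  have term_support : term.HasFiniteSupport := by
    refine hasFiniteSupport_of_order_le (a := N) (b := M) (c := S) (k := k) ?_
    rintro n m i j (h | h | h)
    · simp [term, hp n h]
    · simp [term, hq m h, Function.iterate_fixed (map_zero 𝒟)]
    · simp only [term, hs _ h, Function.iterate_fixed (map_zero 𝒟), mul_zero, smul_zero]
  let e : (ℤ × ℕ) × ℤ × ℕ ≃ (ℤ × ℤ) × ℕ × ℕ :=
    { toFun := fun ⟨⟨l, j⟩, n, i⟩ => ((n, l - n + i), i, j)
      invFun := fun ⟨⟨n, m⟩, i, j⟩ => ((n + m - i, j), n, i)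
      left_inv := fun ⟨⟨l, j⟩, n, i⟩ => Prod.ext (Prod.ext (by dsimp only; ring) rfl) rfl
      right_inv := fun ⟨⟨n, m⟩, i, j⟩ => Prod.ext (Prod.ext rfl (by dsimp only; ring)) rfl }
  rw [← finsum_finsum_eq_finsum_finsum_antidiagonal term_support e]
  refine finsum_congr fun ⟨l, j⟩ => ?_
  have support_finite := leibniz_support_finite hp hq l
  rw [leibnizCoeff, finsum_mul' _ _ support_finite, smul_finsum' _
    (support_finite.subset (Function.support_mul_subset_left _ _))]
  refine finsum_congr fun ⟨n, i⟩ => ?_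
  simp only [e, term, Equiv.coe_fn_mk, smul_mul_assoc, smul_smul, mul_assoc]
  rw [mul_comm, show n + (l - n + i) - i = l by ring,
    show k - n - (l - n + i) + (i + j : ℕ) = k - l + j by push_cast; ring]

theorem leibnizCoeff_leibnizCoeff_right (hp : ∀ n, N < n → p n = 0)
    (hq : ∀ n, M < n → q n = 0) (hs : ∀ n, S < n → s n = 0) (k : ℤ) :
    leibnizCoeff p (leibnizCoeff q s) k =
      ∑ᶠ (nm : ℤ × ℤ) (l : ℕ), ∑ ij ∈ antidiagonal l,
        (Ring.choose nm.1 ij.1 * Ring.choose nm.2 ij.2) •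
          (p nm.1 * (⇑𝒟)^[ij.1] (q nm.2 *
            (⇑𝒟)^[ij.2] (s (k - nm.1 - nm.2 + (ij.1 + ij.2 : ℕ))))) := by
  let term : (ℤ × ℤ) × ℕ × ℕ → A := fun ⟨⟨n, m⟩, i, j⟩ =>
    (Ring.choose n i * Ring.choose m j) •
      (p n * (⇑𝒟)^[i] (q m * (⇑𝒟)^[j] (s (k - n - m + (i + j : ℕ)))))
  have term_support : term.HasFiniteSupport := by
    refine hasFiniteSupport_of_order_le (a := N) (b := M) (c := S) (k := k) ?_
    rintro n m i j (h | h | h)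
    · simp [term, hp n h]
    · simp [term, hq m h, Function.iterate_fixed (map_zero 𝒟)]
    · simp only [term, hs _ h, Function.iterate_fixed (map_zero 𝒟), mul_zero, smul_zero]
  rw [← finsum_finsum_eq_finsum_finsum_antidiagonal term_support
    (Equiv.prodProdProdComm ℤ ℕ ℤ ℕ)]
  refine finsum_congr fun ⟨n, i⟩ => ?_
  have support_finite := leibniz_support_finite hq hs (k - n + i)
  have support_finite' : (Function.support fun mj : ℤ × ℕ => (⇑𝒟)^[i] (Ring.choose mj.1 mj.2 •
      (q mj.1 * (⇑𝒟)^[mj.2] (s (k - n + i - mj.1 + mj.2))))).Finite := support_finite.subset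
    (Function.support_comp_subset (Function.iterate_fixed (map_zero 𝒟) i) _)
  rw [leibnizCoeff, iterate_deriv_finsum support_finite, mul_finsum' _ _ support_finite',
    smul_finsum' _ (support_finite'.subset (Function.support_mul_subset_right _ _))]
  refine finsum_congr fun ⟨m, j⟩ => ?_
  simp only [term, Equiv.prodProdProdComm_apply, iterate_deriv_zsmul, mul_smul_comm, smul_smul]
  rw [show k - n - m + (i + j : ℕ) = k - n + i - m + j by push_cast; ring]

theorem leibnizCoeff_assoc (hp : ∃ N : ℤ, ∀ n, N < n → p n = 0)
    (hq : ∃ M : ℤ, ∀ n, M < n → q n = 0) (hs : ∃ S : ℤ, ∀ n, S < n → s n = 0) :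
    leibnizCoeff (leibnizCoeff p q) s = leibnizCoeff p (leibnizCoeff q s) := by
  obtain ⟨⟨N, hp⟩, ⟨M, hq⟩, S, hs⟩ := And.intro hp (And.intro hq hs)
  ext k
  rw [leibnizCoeff_leibnizCoeff_left hp hq hs, leibnizCoeff_leibnizCoeff_right hp hq hs]
  refine finsum_congr fun nm => finsum_congr fun l => ?_
  have h := congrArg (p nm.1 * ·)
    (leibniz_vandermonde nm.1 nm.2 l (q nm.2) (s (k - nm.1 - nm.2 + l)))
  simp only [mul_sum, mul_smul_comm] at h
  convert h.symm using 4 with ij hij ij hij <;> rw [mem_antidiagonal.mp hij]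

end Associativity

namespace PseudoDiffOp

section Group

variable {A : Type*} [CommRing A]

instance : Zero (PseudoDiffOp A) := ⟨⟨fun _ => 0, 0, fun _ _ => rfl⟩⟩

instance : Add (PseudoDiffOp A) :=
  ⟨fun P Q => ⟨fun n => P.coeff n + Q.coeff n, by
    obtain ⟨N, hN⟩ := P.bdd
    obtain ⟨M, hM⟩ := Q.bdd
    exact ⟨max N M, fun n hn => by
      rw [hN n ((le_max_left N M).trans_lt hn), hM n ((le_max_right N M).trans_lt hn), add_zero]⟩⟩⟩

@[simp] theorem zero_coeff (n : ℤ) : (0 : PseudoDiffOp A).coeff n = 0 := rfl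

@[simp] theorem add_coeff (P Q : PseudoDiffOp A) (n : ℤ) :
    (P + Q).coeff n = P.coeff n + Q.coeff n := rfl

@[simp] theorem neg_coeff (P : PseudoDiffOp A) (n : ℤ) : (-P).coeff n = -P.coeff n := rfl

@[simp] theorem sub_coeff (P Q : PseudoDiffOp A) (n : ℤ) :
    (P - Q).coeff n = P.coeff n - Q.coeff n := rfl

theorem D_coeff (k n : ℤ) : (D k : PseudoDiffOp A).coeff n = if n = k then 1 else 0 := rfl

theorem one_eq_D : (1 : PseudoDiffOp A) = D 0 := rfl

theorem one_coeff (n : ℤ) : (1 : PseudoDiffOp A).coeff n = if n = 0 then 1 else 0 := rfl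

instance : AddCommGroup (PseudoDiffOp A) where
  add_assoc P Q R := by ext; simp [add_assoc]
  zero_add P := by ext; simp
  add_zero P := by ext; simp
  add_comm P Q := by ext; simp [add_comm]
  neg_add_cancel P := by ext; simp
  sub_eq_add_neg P Q := by ext; simp [sub_eq_add_neg]
  nsmul := nsmulRec
  zsmul := zsmulRec

theorem sum_coeff {ι : Type*} (s : Finset ι) (P : ι → PseudoDiffOp A) (n : ℤ) :
    (∑ i ∈ s, P i).coeff n = ∑ i ∈ s, (P i).coeff n :=
  map_sum (⟨⟨fun P => P.coeff n, rfl⟩, fun _ _ => rfl⟩ : PseudoDiffOp A →+ A) P s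

/-- `P` has order at most `N`. -/
def OrderLE (P : PseudoDiffOp A) (N : ℤ) : Prop := ∀ n, N < n → P.coeff n = 0

/-- The operator of multiplication by `a`. -/
def const (a : A) : PseudoDiffOp A where
  coeff n := if n = 0 then a else 0
  bdd := ⟨0, fun _ hn => if_neg hn.ne'⟩

theorem nonneg_add_negPart (P : PseudoDiffOp A) : P.nonneg + P.negPart = P := by
  ext k
  simp only [add_coeff, nonneg, negPart]
  split_ifs <;> first | omega | simp

end Group

section Ring

variable {A : Type*} [CommRing A] [Differential A]

local notation "𝒟" => @Differential.deriv A _ _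

theorem mul_coeff (P Q : PseudoDiffOp A) (k : ℤ) :
    (P * Q).coeff k = leibnizCoeff P.coeff Q.coeff k := rfl

theorem const_mul_coeff (a : A) (P : PseudoDiffOp A) (k : ℤ) :
    (const a * P).coeff k = a * P.coeff k := by
  rw [mul_coeff, leibnizCoeff, finsum_eq_single _ ((0 : ℤ), 0)]
  · simp [const]
  · rintro ⟨n, r⟩ h
    rcases eq_or_ne n 0 with rfl | hn
    · rw [Ring.choose_zero_pos ℤ (Nat.pos_of_ne_zero fun hr => h (Prod.ext rfl hr)), zero_smul]
    · simp [const, hn]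

/-- `P` has constant coefficients. -/
def IsConst (P : PseudoDiffOp A) : Prop := ∀ n, 𝒟 (P.coeff n) = 0

theorem isConst_D (m : ℤ) : (D m : PseudoDiffOp A).IsConst := fun n => by
  rw [D_coeff]
  split_ifs <;> simp

theorem IsConst.mul_coeff {Q : PseudoDiffOp A} (hQ : Q.IsConst) (P : PseudoDiffOp A) (k : ℤ) :
    (P * Q).coeff k = ∑ᶠ n, P.coeff n * Q.coeff (k - n) := by
  obtain ⟨⟨N, hP⟩, M, hM⟩ := And.intro P.bdd Q.bdd
  rw [PseudoDiffOp.mul_coeff, leibnizCoeff, finsum_curry _ (leibniz_support_finite hP hM k)]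
  refine finsum_congr fun n => ?_
  rw [finsum_eq_single _ 0]
  · simp
  · rintro (_ | r) hr
    · exact absurd rfl hr
    · simp [hQ _, Function.iterate_fixed (map_zero 𝒟)]

theorem IsConst.mul_coeff_neg {P Q : PseudoDiffOp A} (hQ : Q.IsConst)
    (hP₀ : P.OrderLE 0) (hQ₀ : Q.OrderLE 0) (n : ℕ) :
    (P * Q).coeff (-n) = ∑ ab ∈ antidiagonal n, P.coeff (-ab.1) * Q.coeff (-ab.2) := by
  have injOn : Set.InjOn (fun ab : ℕ × ℕ => -(ab.1 : ℤ)) (antidiagonal n) := by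
    rintro ⟨a, b⟩ hab ⟨c, d⟩ hcd h
    simp only [mem_coe, mem_antidiagonal, neg_inj, Nat.cast_inj, Prod.mk.injEq] at *
    omega
  rw [hQ.mul_coeff, finsum_eq_sum_of_support_subset (s :=
    (antidiagonal n).image fun ab => -(ab.1 : ℤ)), sum_image injOn]
  · refine sum_congr rfl fun ab hab => ?_
    have := mem_antidiagonal.mp hab
    rw [show -(n : ℤ) - -(ab.1 : ℤ) = -ab.2 by omega]
  · intro m h
    have hm : m ≤ 0 := not_lt.mp fun hm => left_ne_zero_of_mul h (hP₀ m hm)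
    have hnm : -n ≤ m := not_lt.mp fun hnm => right_ne_zero_of_mul h (hQ₀ _ (by omega))
    refine mem_coe.mpr (mem_image.mpr ⟨((-m).toNat, (n + m).toNat), ?_, by dsimp only; omega⟩)
    rw [mem_antidiagonal]
    omega

theorem IsConst.mul {P Q : PseudoDiffOp A} (hP : P.IsConst) (hQ : Q.IsConst) :
    (P * Q).IsConst := fun k => by
  rw [hQ.mul_coeff]
  refine finsum_induction (𝒟 · = 0) (map_zero 𝒟) (fun a b ha hb => ?_) fun n => ?_
  · rw [map_add, ha, hb, add_zero]
  · rw [Derivation.leibniz, hP, hQ, smul_zero, smul_zero, add_zero]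

theorem mul_D_coeff (P : PseudoDiffOp A) (m k : ℤ) : (P * D m).coeff k = P.coeff (k - m) := by
  rw [(isConst_D m).mul_coeff, finsum_eq_single _ (k - m)]
  · simp [D_coeff]
  · intro n hn
    rw [D_coeff, if_neg (by omega), mul_zero]

theorem IsConst.D_mul {P : PseudoDiffOp A} (hP : P.IsConst) (m : ℤ) : D m * P = P * D m := by
  ext k
  rw [hP.mul_coeff, mul_D_coeff, finsum_eq_single _ m]
  · simp [D_coeff]
  · intro n hn
    rw [D_coeff, if_neg hn, zero_mul]

protected theorem mul_add (P Q R : PseudoDiffOp A) : P * (Q + R) = P * Q + P * R := by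
  obtain ⟨N, hP⟩ := P.bdd
  obtain ⟨M, hQ⟩ := Q.bdd
  obtain ⟨S, hR⟩ := R.bdd
  ext k
  simp only [add_coeff, mul_coeff, leibnizCoeff]
  rw [← finsum_add_distrib (leibniz_support_finite hP hQ k) (leibniz_support_finite hP hR k)]
  exact finsum_congr fun nr => by rw [iterate_map_add, mul_add, smul_add]

protected theorem add_mul (P Q R : PseudoDiffOp A) : (P + Q) * R = P * R + Q * R := by
  obtain ⟨N, hP⟩ := P.bdd
  obtain ⟨M, hQ⟩ := Q.bdd
  obtain ⟨S, hR⟩ := R.bdd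
  ext k
  simp only [add_coeff, mul_coeff, leibnizCoeff]
  rw [← finsum_add_distrib (leibniz_support_finite hP hR k) (leibniz_support_finite hQ hR k)]
  exact finsum_congr fun nr => by rw [add_mul, smul_add]

-- Scoped, because its power must not compete with the instance `Pow (PseudoDiffOp A) ℕ` above.
scoped instance : Ring (PseudoDiffOp A) where
  mul_assoc P Q R := PseudoDiffOp.ext (leibnizCoeff_assoc P.bdd Q.bdd R.bdd)
  one_mul P := by
    ext k
    exact (const_mul_coeff 1 P k).trans (one_mul _)
  mul_one P := by
    ext k
    rw [one_eq_D, mul_D_coeff, sub_zero]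
  left_distrib := PseudoDiffOp.mul_add
  right_distrib := PseudoDiffOp.add_mul
  zero_mul P := by simpa using PseudoDiffOp.add_mul 0 0 P
  mul_zero P := by simpa using PseudoDiffOp.mul_add P 0 0
  zsmul := zsmulRec
  neg_add_cancel := neg_add_cancel
  sub_eq_add_neg := sub_eq_add_neg
  npow n P := P ^ n
  npow_zero _ := rfl
  npow_succ _ _ := rfl

theorem D_mul_D (m n : ℤ) : (D m * D n : PseudoDiffOp A) = D (m + n) := by
  ext k
  rw [mul_D_coeff, D_coeff, D_coeff]
  exact if_congr (by omega) rfl rfl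

theorem D_one_mul_coeff (P : PseudoDiffOp A) (k : ℤ) :
    (D 1 * P).coeff k = P.coeff (k - 1) + 𝒟 (P.coeff k) := by
  have support_subset : (Function.support fun nr : ℤ × ℕ => Ring.choose nr.1 nr.2 •
      ((D 1 : PseudoDiffOp A).coeff nr.1 * (⇑𝒟)^[nr.2] (P.coeff (k - nr.1 + nr.2)))) ⊆
      (({(1, 0), (1, 1)} : Finset (ℤ × ℕ)) : Set (ℤ × ℕ)) := by
    rintro ⟨n, r⟩ h
    have hn : n = 1 := by
      by_contra hn
      simp [D_coeff, hn] at h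
    have hr : r < 2 := by
      by_contra hr
      have choose_eq_zero : Ring.choose (1 : ℤ) r = 0 := by
        simpa [Nat.choose_eq_zero_of_lt (not_lt.mp hr)] using Ring.choose_natCast (R := ℤ) 1 r
      simp [hn, choose_eq_zero] at h
    interval_cases r <;> simp [hn]
  rw [mul_coeff, leibnizCoeff, finsum_eq_sum_of_support_subset _ support_subset,
    sum_pair (by simp)]
  simp [D_coeff]

theorem D_one_pow (n : ℕ) : (D 1 : PseudoDiffOp A) ^ n = D n := by
  induction n with
  | zero => rfl
  | succ n ih => rw [pow_succ, ih, D_mul_D, Nat.cast_succ]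

theorem IsInverse.conj_pow {P Q : PseudoDiffOp A} (h : IsInverse P Q) (R : PseudoDiffOp A)
    (n : ℕ) : (P * R * Q) ^ n * P = P * R ^ n := by
  refine ((SemiconjBy.pow_right ?_ n).eq).symm
  rw [SemiconjBy, mul_assoc (P * R), h.2, mul_one]

end Ring

section Order

variable {A : Type*} [CommRing A] {P Q : PseudoDiffOp A} {N M : ℤ}

theorem OrderLE.mono (hP : P.OrderLE N) (h : N ≤ M) : P.OrderLE M :=
  fun n hn => hP n (h.trans_lt hn)

theorem OrderLE.sub (hP : P.OrderLE N) (hQ : Q.OrderLE N) : (P - Q).OrderLE N :=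
  fun n hn => by rw [sub_coeff, hP n hn, hQ n hn, sub_zero]

theorem OrderLE.add (hP : P.OrderLE N) (hQ : Q.OrderLE N) : (P + Q).OrderLE N :=
  fun n hn => by rw [add_coeff, hP n hn, hQ n hn, add_zero]

theorem orderLE_D (k : ℤ) : (D k : PseudoDiffOp A).OrderLE k := fun _ hn => if_neg hn.ne'

theorem orderLE_one : (1 : PseudoDiffOp A).OrderLE 0 := orderLE_D 0

theorem orderLE_negPart (P : PseudoDiffOp A) : P.negPart.OrderLE (-1) :=
  fun _ hn => if_neg (by omega)

theorem isMonicOrderZero_iff : P.IsMonicOrderZero ↔ (P - 1).OrderLE (-1) := by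
  constructor
  · rintro ⟨h₀, hpos⟩ n hn
    rcases (show 0 ≤ n by omega).eq_or_lt with rfl | hn
    · simp [one_coeff, h₀]
    · simp [one_coeff, hpos n hn, hn.ne']
  · intro h
    have coeff_eq (n : ℤ) (hn : -1 < n) : P.coeff n = (1 : PseudoDiffOp A).coeff n :=
      sub_eq_zero.mp (h n hn)
    exact ⟨coeff_eq 0 (by omega), fun n hn => by
      rw [coeff_eq n (by omega), one_coeff, if_neg hn.ne']⟩

theorem isMonicOrderZero_monic (w : ℕ → A) : (monic w).IsMonicOrderZero :=
  ⟨rfl, fun _ hn => (if_neg hn.ne').trans (if_neg hn.not_gt)⟩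

theorem IsMonicOrderZero.orderLE (hP : P.IsMonicOrderZero) : P.OrderLE 0 := hP.2

theorem eq_of_forall_orderLE_sub (h : ∀ m : ℕ, (P - Q).OrderLE (-m)) : P = Q := by
  ext n
  exact sub_eq_zero.mp (h ((-n).toNat + 1) n (by omega))

theorem IsLaxForm.orderLE (hP : P.IsLaxForm) : P.OrderLE 1 := hP.2.2

theorem IsLaxForm.nonneg_eq_D (hP : P.IsLaxForm) : P.nonneg = D 1 := by
  ext n
  simp only [nonneg, D_coeff]
  split_ifs with h₀ h₁ h₁
  · rw [h₁, hP.1]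
  · rcases (show n = 0 ∨ 1 < n by omega) with rfl | hn
    exacts [hP.2.1, hP.2.2 n hn]
  · omega
  · rfl

variable [Differential A]

theorem OrderLE.mul (hP : P.OrderLE N) (hQ : Q.OrderLE M) : (P * Q).OrderLE (N + M) :=
  fun k hk => finsum_eq_zero_of_forall_eq_zero fun nr =>
    leibniz_term_eq_zero hP hQ k nr (by omega)

theorem OrderLE.pow (hP : P.OrderLE N) (n : ℕ) : (P ^ n).OrderLE (n * N) := by
  induction n with
  | zero => exact orderLE_one.mono (by simp)
  | succ n ih =>
    rw [pow_succ]
    exact (ih.mul hP).mono (by push_cast; linarith)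

theorem nonneg_eq_sum {n : ℕ} (hP : P.OrderLE n) :
    P.nonneg = ∑ i ∈ range (n + 1), const (P.coeff i) * D i := by
  ext k
  simp only [sum_coeff, const_mul_coeff, D_coeff, nonneg]
  split_ifs with hk
  · lift k to ℕ using hk
    simp only [Nat.cast_inj, mul_ite, mul_one, mul_zero, sum_ite_eq, mem_range]
    split_ifs with h
    · rfl
    · exact hP _ (by omega)
  · refine (sum_eq_zero fun i _ => ?_).symm
    rw [if_neg (by omega), mul_zero]

theorem IsMonicOrderZero.mul (hP : P.IsMonicOrderZero) (hQ : Q.IsMonicOrderZero) :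
    (P * Q).IsMonicOrderZero := by
  have hPQ : P * Q - 1 = (P - 1) * Q + (Q - 1) := by noncomm_ring
  rw [isMonicOrderZero_iff] at hP ⊢
  rw [hPQ]
  exact (hP.mul hQ.orderLE).add (isMonicOrderZero_iff.mp hQ)

end Order

section Inverse

variable {A : Type*} [CommRing A] [Differential A] {P Q R : PseudoDiffOp A}

theorem OrderLE.sum_range_pow_coeff (hR : R.OrderLE (-1)) {n : ℤ} {a b : ℕ} (ha : -n < a)
    (hb : -n < b) : (∑ i ∈ range a, R ^ i).coeff n = (∑ i ∈ range b, R ^ i).coeff n := by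
  wlog hab : a ≤ b generalizing a b
  · exact (this hb ha (le_of_not_ge hab)).symm
  rw [← sum_range_add_sum_Ico _ hab, add_coeff, left_eq_add, sum_coeff]
  refine sum_eq_zero fun i hi => hR.pow i n ?_
  have := (mem_Ico.mp hi).1
  omega

/-- The series `1 + R + R² + ⋯`, for `R` of negative order. The coefficient of `∂ⁿ` only receives
contributions from `Rⁱ` with `i ≤ -n`. -/
def geomSeries (R : PseudoDiffOp A) : PseudoDiffOp A where
  coeff n := (∑ i ∈ range ((-n).toNat + 1), R ^ i).coeff n
  bdd := ⟨0, fun n hn => by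
    rw [Int.toNat_of_nonpos (by omega), zero_add, sum_range_one, pow_zero, orderLE_one n hn]⟩

theorem orderLE_geomSeries (R : PseudoDiffOp A) : (geomSeries R).OrderLE 0 := fun n hn => by
  have := orderLE_one (A := A) n hn
  simpa [geomSeries, Int.toNat_of_nonpos (show -n ≤ 0 by omega)]

theorem OrderLE.geomSeries_sub_sum (hR : R.OrderLE (-1)) (m : ℕ) :
    (geomSeries R - ∑ i ∈ range m, R ^ i).OrderLE (-m) := fun n hn => by
  rw [sub_coeff, sub_eq_zero]
  exact hR.sum_range_pow_coeff (by omega) (by omega)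

theorem OrderLE.isInverse_geomSeries (hR : R.OrderLE (-1)) :
    IsInverse (1 - R) (geomSeries R) := by
  have hR₁ : (1 - R).OrderLE 0 := orderLE_one.sub (hR.mono (by omega))
  have hpow (m : ℕ) : (R ^ m).OrderLE (-m) := (hR.pow m).mono (by omega)
  constructor <;> refine eq_of_forall_orderLE_sub fun m => ?_
  · have split : (1 - R) * geomSeries R - 1 =
        (1 - R) * (geomSeries R - ∑ i ∈ range m, R ^ i) - R ^ m := by
      rw [mul_sub, mul_neg_geom_sum]
      abel
    rw [split]
    exact ((hR₁.mul (hR.geomSeries_sub_sum m)).mono (by omega)).sub (hpow m)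
  · have split : geomSeries R * (1 - R) - 1 =
        (geomSeries R - ∑ i ∈ range m, R ^ i) * (1 - R) - R ^ m := by
      rw [sub_mul, geom_sum_mul_neg]
      abel
    rw [split]
    exact (((hR.geomSeries_sub_sum m).mul hR₁).mono (by omega)).sub (hpow m)

theorem IsMonicOrderZero.isInverse_geomSeries (hP : P.IsMonicOrderZero) :
    IsInverse P (geomSeries (1 - P)) := by
  have h : (1 - P).OrderLE (-1) := fun n hn => by
    rw [← neg_sub, neg_coeff, isMonicOrderZero_iff.mp hP n hn, neg_zero]
  simpa using h.isInverse_geomSeries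

theorem IsMonicOrderZero.isInverse_inv (hP : P.IsMonicOrderZero) : IsInverse P P⁻¹ := by
  have h : ∃ Q, IsInverse P Q := ⟨_, hP.isInverse_geomSeries⟩
  rw [show P⁻¹ = h.choose from dif_pos h]
  exact h.choose_spec

theorem IsMonicOrderZero.inv_eq (hP : P.IsMonicOrderZero) (hQ : P * Q = 1) : P⁻¹ = Q :=
  left_inv_eq_right_inv hP.isInverse_inv.2 hQ

theorem IsMonicOrderZero.orderLE_inv (hP : P.IsMonicOrderZero) : P⁻¹.OrderLE 0 := by
  rw [hP.inv_eq hP.isInverse_geomSeries.1]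
  exact orderLE_geomSeries _

theorem IsMonicOrderZero.isLaxForm (hP : P.IsMonicOrderZero) : (P * D 1 * P⁻¹).IsLaxForm := by
  have commutator : (P * D 1 - D 1 * P).OrderLE (-1) := by
    intro n hn
    rw [sub_coeff, mul_D_coeff, D_one_mul_coeff]
    rcases (show 0 ≤ n by omega).eq_or_lt with rfl | hn
    · simp [hP.1]
    · simp [hP.2 n hn]
  have sub_D : P * D 1 * P⁻¹ - D 1 = (P * D 1 - D 1 * P) * P⁻¹ := by
    rw [sub_mul, mul_assoc (D 1), hP.isInverse_inv.1, mul_one]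
  have coeff_eq (n : ℤ) (hn : -1 < n) : (P * D 1 * P⁻¹).coeff n = (D 1 : PseudoDiffOp A).coeff n :=
    sub_eq_zero.mp (by
      rw [← sub_coeff, sub_D]
      exact commutator.mul hP.orderLE_inv n hn)
  exact ⟨coeff_eq 1 (by omega), coeff_eq 0 (by omega), fun n hn =>
    (coeff_eq n (by omega)).trans (if_neg hn.ne')⟩

end Inverse

end PseudoDiffOp

/-! ### Dressing with constant coefficients -/

namespace FormalWave

variable {A : Type*} [CommRing A]

/-- The operator with the same coefficients, so that `F = F.toOp e^ξ`. -/
def toOp (F : FormalWave A) : PseudoDiffOp A := ⟨F.coeff, F.bdd⟩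

theorem toOp_injective : Function.Injective (toOp (A := A)) := fun _ _ h =>
  FormalWave.ext (congrArg PseudoDiffOp.coeff h)

variable [Differential A]

theorem toOp_smul (P : PseudoDiffOp A) (F : FormalWave A) : (P • F).toOp = P * F.toOp := rfl

theorem toOp_smul_expXi (P : PseudoDiffOp A) : (P • (expXi : FormalWave A)).toOp = P :=
  mul_one P

theorem toOp_mulLambda (F : FormalWave A) : F.mulLambda.toOp = F.toOp * PseudoDiffOp.D 1 :=
  PseudoDiffOp.ext (funext fun k => (PseudoDiffOp.mul_D_coeff F.toOp 1 k).symm)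

theorem mul_smul (P Q : PseudoDiffOp A) (F : FormalWave A) : (P * Q) • F = P • (Q • F) :=
  toOp_injective (mul_assoc P Q F.toOp)

end FormalWave

namespace HolFun

variable {U : TopologicalSpace.Opens ℂ}

/-- Evaluation at a point of `U`. -/
def evalHom (x : U) : HolFun U →+* ℂ := (Pi.evalRingHom (fun _ : U => ℂ) x).comp (HolFun U).val

theorem evalHom_apply (x : U) (f : HolFun U) : evalHom x f = f.1 x := rfl

theorem deriv_algebraMap_eq_zero (c : ℂ) :
    Differential.deriv (algebraMap ℂ (HolFun U) c) = 0 := by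
  refine Subtype.ext (funext fun x => ?_)
  have : ext0 (algebraMap ℂ (HolFun U) c).1 =ᶠ[nhds (x : ℂ)] fun _ => c := by
    filter_upwards [U.isOpen.mem_nhds x.2] with y hy
    exact ext0_coe (algebraMap ℂ (HolFun U) c).1 ⟨y, hy⟩
  rw [deriv_apply, this.deriv_eq, deriv_const]
  rfl

end HolFun

theorem add_single_mem_entireTimes {t : ℕ → ℂ} (ht : t ∈ entireTimes) (j : ℕ) (s : ℂ) :
    t + Pi.single j s ∈ entireTimes := by
  intro r
  have h : Summable fun i => ‖(Pi.single j s : ℕ → ℂ) i‖ * |r| ^ i :=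
    summable_of_ne_finset_zero (s := {j}) fun i hi => by
      rw [Pi.single_eq_of_ne (by simpa using hi), norm_zero, zero_mul]
  refine Summable.of_norm_bounded ((ht |r|).add h) fun i => ?_
  rw [norm_mul, norm_norm, norm_pow, Real.norm_eq_abs, ← add_mul]
  exact mul_le_mul_of_nonneg_right (norm_add_le _ _) (by positivity)

namespace PseudoDiffOp

variable {U : TopologicalSpace.Opens ℂ}

theorem hasOpTimeDerivAt_mul {V : PseudoDiffOp (HolFun U)} (hV : V.IsMonicOrderZero)
    {C : (ℕ → ℂ) → PseudoDiffOp (HolFun U)} (hC : ∀ t, (C t).OrderLE 0)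
    (hC_const : ∀ t, (C t).IsConst) {Q : PseudoDiffOp (HolFun U)} (hQ : Q.OrderLE 0)
    (hQ_const : Q.IsConst) {j : ℕ} {t : ℕ → ℂ} (h : HasOpTimeDerivAt C Q j t) :
    HasOpTimeDerivAt (fun t => V * C t) (V * Q) j t := by
  intro m x
  rcases lt_or_ge 0 m with hm | hm
  · have coeff_eq_zero (s : ℂ) : (V * C (t + Pi.single j s)).coeff m = 0 :=
      hV.orderLE.mul (hC _) m hm
    simp only [coeff_eq_zero, (hV.orderLE.mul hQ) m hm]
    exact hasDerivAt_const _ _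
  · obtain ⟨n, rfl⟩ : ∃ n : ℕ, m = -n := ⟨(-m).toNat, by omega⟩
    simp only [(hC_const _).mul_coeff_neg hV.orderLE (hC _), hQ_const.mul_coeff_neg hV.orderLE hQ,
      ← HolFun.evalHom_apply, map_sum, map_mul]
    exact HasDerivAt.fun_sum fun ab _ => (h (-ab.2) x).const_mul _

/-- The dressing data behind a wave operator `V C(t)`: a monic operator `V`, a time factor `C(t)`
with constant coefficients and constant operators `Ω j` correcting `∂ʲ⁺²`, where `j` stands for
the time `t_{j+2}`, such that `(Lʲ⁺²)_{≥ 0} V = V (∂ʲ⁺² + Ω j)` for `L = V ∂ V⁻¹` and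
`∂C/∂t_{j+2} = Ω j C`. -/
structure IsDressing (V : PseudoDiffOp (HolFun U)) (C : (ℕ → ℂ) → PseudoDiffOp (HolFun U))
    (Ω : ℕ → PseudoDiffOp (HolFun U)) : Prop where
  monic : V.IsMonicOrderZero
  monic_time : ∀ t, (C t).IsMonicOrderZero
  isConst_time : ∀ t, (C t).IsConst
  orderLE_symbol : ∀ j, (Ω j).OrderLE 0
  isConst_symbol : ∀ j, (Ω j).IsConst
  nonneg_mul : ∀ j : ℕ,
    ((V * D 1 * V⁻¹) ^ (j + 2)).nonneg * V = V * (D ((j : ℤ) + 2) + Ω j)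
  time_deriv : ∀ t ∈ entireTimes, ∀ j, HasOpTimeDerivAt C (Ω j * C t) j t

namespace IsDressing

variable {V : PseudoDiffOp (HolFun U)} {C : (ℕ → ℂ) → PseudoDiffOp (HolFun U)}
  {Ω : ℕ → PseudoDiffOp (HolFun U)} (h : IsDressing V C Ω) (t : ℕ → ℂ)
include h

theorem isInverse_inv : IsInverse (V * C t) (V * C t)⁻¹ :=
  (h.monic.mul (h.monic_time t)).isInverse_inv

theorem lax_mul : V * D 1 * V⁻¹ * (V * C t) = V * C t * D 1 := by
  rw [mul_assoc (V * D 1), ← mul_assoc V⁻¹, h.monic.isInverse_inv.2, one_mul, mul_assoc,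
    (h.isConst_time t).D_mul, ← mul_assoc]

theorem lax_eq_conj : V * D 1 * V⁻¹ = V * C t * D 1 * (V * C t)⁻¹ := by
  rw [← h.lax_mul, mul_assoc _ (V * C t), (h.isInverse_inv t).1, mul_one]

theorem lax_pow_mul (n : ℕ) : (V * D 1 * V⁻¹) ^ n * (V * C t) = V * C t * D n := by
  rw [h.lax_eq_conj t, (h.isInverse_inv t).conj_pow, D_one_pow]

theorem nonneg_lax_pow_mul (j : ℕ) : ((V * D 1 * V⁻¹) ^ (j + 2)).nonneg * (V * C t) =
    V * (Ω j * C t) + V * C t * D ((j : ℤ) + 2) := by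
  rw [← mul_assoc, h.nonneg_mul, mul_assoc, add_mul, (h.isConst_time t).D_mul, mul_add,
    mul_assoc V, add_comm]

theorem hasOpTimeDerivAt {t : ℕ → ℂ} (ht : t ∈ entireTimes) (j : ℕ) :
    HasOpTimeDerivAt (fun t => V * C t) (V * (Ω j * C t)) j t :=
  hasOpTimeDerivAt_mul h.monic (fun t => (h.monic_time t).orderLE) h.isConst_time
    ((h.orderLE_symbol j).mul (h.monic_time t).orderLE)
    ((h.isConst_symbol j).mul (h.isConst_time t)) (h.time_deriv t ht j)

theorem sato_wilson {t : ℕ → ℂ} (ht : t ∈ entireTimes) (j : ℕ) :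
    HasOpTimeDerivAt (fun t => V * C t)
      (((V * D 1 * V⁻¹) ^ (j + 2)).nonneg * (V * C t) - V * C t * D ((j : ℤ) + 2)) j t := by
  rw [h.nonneg_lax_pow_mul, add_sub_cancel_right]
  exact h.hasOpTimeDerivAt ht j

theorem sato_wilson_eq_neg (j : ℕ) :
    ((V * D 1 * V⁻¹) ^ (j + 2)).nonneg * (V * C t) - V * C t * D ((j : ℤ) + 2) =
      -((V * C t * D ((j : ℤ) + 2) * (V * C t)⁻¹).negPart * (V * C t)) := by
  have pow_mul : (V * D 1 * V⁻¹) ^ (j + 2) * (V * C t) = V * C t * D ((j : ℤ) + 2) := by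
    simpa using h.lax_pow_mul t (j + 2)
  rw [← pow_mul, mul_assoc _ (V * C t) (V * C t)⁻¹, (h.isInverse_inv t).1, mul_one, ← sub_mul,
    ← neg_mul]
  congr 1
  nth_rewrite 2 [← nonneg_add_negPart ((V * D 1 * V⁻¹) ^ (j + 2))]
  abel

theorem isWaveFunction :
    IsWaveFunction (V * D 1 * V⁻¹) fun t => V • (C t • FormalWave.expXi) := by
  simp only [← FormalWave.mul_smul]
  have coeff_eq (P : PseudoDiffOp (HolFun U)) (n : ℤ) :
      (P • (FormalWave.expXi : FormalWave (HolFun U))).coeff n = P.coeff n :=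
    congrArg (fun Q => Q.coeff n) (FormalWave.toOp_smul_expXi P)
  refine ⟨fun t _ => ?_, fun t _ n hn => ?_, fun t _ => ?_, fun t _ => ?_, fun t ht j m x => ?_⟩
  · rw [coeff_eq, (h.monic.mul (h.monic_time t)).1]
  · rw [coeff_eq, (h.monic.mul (h.monic_time t)).2 n hn]
  · apply FormalWave.toOp_injective
    rw [FormalWave.toOp_smul, FormalWave.toOp_mulLambda, FormalWave.toOp_smul_expXi, h.lax_mul]
  · rw [pow_one, h.monic.isLaxForm.nonneg_eq_D]
  · simp only [← FormalWave.mul_smul, coeff_eq]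
    refine ⟨_, h.hasOpTimeDerivAt ht j m x, ?_⟩
    rw [h.nonneg_lax_pow_mul, add_coeff, mul_D_coeff]
    rfl

theorem isWaveOperator :
    IsWaveOperator (V * D 1 * V⁻¹) (fun t => V • (C t • FormalWave.expXi)) fun t => V * C t where
  monic t _ := h.monic.mul (h.monic_time t)
  wave t _ := (FormalWave.mul_smul V (C t) _).symm
  inverse t _ := h.isInverse_inv t
  dressing t _ := h.lax_eq_conj t
  sato_wilson t ht j := h.sato_wilson ht j
  sato_wilson_neg t ht j := by
    rw [← h.sato_wilson_eq_neg]
    exact h.sato_wilson ht j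

end IsDressing

end PseudoDiffOp

end FormalOperators

noncomputable section LameFunction

open Filter Topology TopologicalSpace Finset
open scoped PseudoDiffOp Nat

/-! ### The Weierstrass functions `σ` and `ζ` -/

namespace Lame

/-- The genus two Weierstrass factor, a convergence factor for the zeros of `σ`. -/
def weierstrassFactor (w : ℂ) : ℂ := (1 - w) * Complex.exp (w + w ^ 2 / 2)

theorem hasDerivAt_weierstrassFactor (w : ℂ) :
    HasDerivAt weierstrassFactor (-w ^ 2 * Complex.exp (w + w ^ 2 / 2)) w := by
  have hexponent : HasDerivAt (fun u : ℂ => u + u ^ 2 / 2) (1 + w) w :=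
    ((hasDerivAt_id w).add (((hasDerivAt_id w).pow 2).div_const 2)).congr_deriv (by simp)
  refine (((hasDerivAt_const w (1 : ℂ)).sub (hasDerivAt_id w)).mul hexponent.cexp).congr_deriv ?_
  simp only [Pi.sub_apply, id]
  ring

theorem differentiable_weierstrassFactor : Differentiable ℂ weierstrassFactor := fun w =>
  (hasDerivAt_weierstrassFactor w).differentiableAt

theorem weierstrassFactor_ne_zero {w : ℂ} (hw : w ≠ 1) : weierstrassFactor w ≠ 0 :=
  mul_ne_zero (sub_ne_zero.mpr hw.symm) (Complex.exp_ne_zero _)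

theorem logDeriv_weierstrassFactor (w : ℂ) :
    logDeriv weierstrassFactor w = -w ^ 2 / (1 - w) := by
  rw [logDeriv_apply, (hasDerivAt_weierstrassFactor w).deriv, weierstrassFactor,
    mul_div_mul_right _ _ (Complex.exp_ne_zero _)]

theorem norm_weierstrassFactor_sub_one_le {w : ℂ} (hw : ‖w‖ ≤ 1) :
    ‖weierstrassFactor w - 1‖ ≤ Real.exp 2 * ‖w‖ ^ 3 := by
  have hbound : ∀ u ∈ Metric.closedBall (0 : ℂ) ‖w‖,
      ‖-u ^ 2 * Complex.exp (u + u ^ 2 / 2)‖ ≤ Real.exp 2 * ‖w‖ ^ 2 := by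
    intro u hu
    have huw : ‖u‖ ≤ ‖w‖ := by simpa using hu
    have hsq : ‖u‖ ^ 2 ≤ 1 := pow_le_one₀ (norm_nonneg _) (huw.trans hw)
    have hre : (u + u ^ 2 / 2).re ≤ 2 := by
      refine (Complex.re_le_norm _).trans ((norm_add_le _ _).trans ?_)
      rw [norm_div, norm_pow, Complex.norm_ofNat]
      linarith
    rw [norm_mul, norm_neg, norm_pow, Complex.norm_exp, mul_comm]
    gcongr
  have h := (convex_closedBall (0 : ℂ) ‖w‖).norm_image_sub_le_of_norm_hasDerivWithin_le
    (fun u _ => (hasDerivAt_weierstrassFactor u).hasDerivWithinAt) hbound (x := 0) (y := w)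
    (by simp) (by simp)
  calc ‖weierstrassFactor w - 1‖ = ‖weierstrassFactor w - weierstrassFactor 0‖ := by
        simp [weierstrassFactor]
    _ ≤ Real.exp 2 * ‖w‖ ^ 2 * ‖w - 0‖ := h
    _ = Real.exp 2 * ‖w‖ ^ 3 := by rw [sub_zero]; ring

variable (L : PeriodPair)

/-- The entire function `σ(z) / z`. -/
def sigmaProd (z : ℂ) : ℂ := ∏' l : {l : L.lattice // l ≠ 0}, weierstrassFactor (z / l)

theorem sigma_eq_mul_sigmaProd (z : ℂ) : L.sigma z = z * sigmaProd L z := by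
  simp only [PeriodPair.sigma, sigmaProd, weierstrassFactor, div_pow, div_div, mul_comm]

theorem summable_norm_inv_lattice_pow_three (c : ℝ) :
    Summable fun l : {l : L.lattice // l ≠ 0} => c * ‖(l : ℂ)‖⁻¹ ^ 3 :=
  ((ZLattice.summable_norm_pow_inv L.lattice 3 (by simp)).comp_injective
    Subtype.val_injective).mul_left _

theorem finite_lattice_norm_lt (r : ℝ) :
    {l : {l : L.lattice // l ≠ 0} | ‖(l : ℂ)‖ < r}.Finite := by
  refine Set.Finite.of_finite_image (f := Subtype.val)
    ((isCompact_iff_finite.mp (isCompact_closedBall (0 : L.lattice) r)).subset ?_)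
    Subtype.val_injective.injOn
  rintro _ ⟨l, hl : ‖(l : ℂ)‖ < r, rfl⟩
  simpa using hl.le

theorem eventually_norm_weierstrassFactor_div_sub_one_le (r : ℝ) :
    ∀ᶠ l : {l : L.lattice // l ≠ 0} in cofinite, ∀ z ∈ Metric.ball (0 : ℂ) r,
      ‖weierstrassFactor (z / l) - 1‖ ≤ Real.exp 2 * r ^ 3 * ‖(l : ℂ)‖⁻¹ ^ 3 := by
  filter_upwards [(finite_lattice_norm_lt L r).compl_mem_cofinite] with l hl z hz
  have hzr : ‖z‖ ≤ r := by simpa using (Metric.mem_ball.mp hz).le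
  have hrl : r ≤ ‖(l : ℂ)‖ := by simpa using hl
  have hpos : 0 < ‖(l : ℂ)‖ := norm_pos_iff.mpr (by simpa using l.2)
  have hdiv : ‖z / l‖ ≤ 1 := by
    rw [norm_div, div_le_one hpos]
    exact hzr.trans hrl
  refine (norm_weierstrassFactor_sub_one_le hdiv).trans ?_
  rw [norm_div, div_eq_mul_inv, mul_pow, mul_assoc]
  gcongr

theorem differentiable_weierstrassFactor_div (l : ℂ) :
    Differentiable ℂ fun z => weierstrassFactor (z / l) :=
  differentiable_weierstrassFactor.comp (differentiable_id.div_const l)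

theorem hasProdLocallyUniformlyOn_sigmaProd (r : ℝ) :
    HasProdLocallyUniformlyOn
      (fun (l : {l : L.lattice // l ≠ 0}) (z : ℂ) => weierstrassFactor (z / l))
      (sigmaProd L) (Metric.ball 0 r) := by
  have h := (summable_norm_inv_lattice_pow_three L _).hasProdLocallyUniformlyOn_one_add
    (f := fun (l : {l : L.lattice // l ≠ 0}) (z : ℂ) => weierstrassFactor (z / l) - 1)
    Metric.isOpen_ball (eventually_norm_weierstrassFactor_div_sub_one_le L r)
    (fun l => ((differentiable_weierstrassFactor_div l).continuous.sub
      continuous_const).continuousOn)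
  simp only [add_sub_cancel] at h
  exact h

theorem differentiable_sigmaProd : Differentiable ℂ (sigmaProd L) := by
  intro z
  have h : DifferentiableOn ℂ (sigmaProd L) (Metric.ball 0 (‖z‖ + 1)) :=
    (hasProdLocallyUniformlyOn_iff_tendstoLocallyUniformlyOn.mp
      (hasProdLocallyUniformlyOn_sigmaProd L _)).differentiableOn
      (.of_forall fun _ => DifferentiableOn.fun_finsetProd fun l _ =>
        (differentiable_weierstrassFactor_div l).differentiableOn) Metric.isOpen_ball
  exact h.differentiableAt (Metric.isOpen_ball.mem_nhds (by simp))

theorem differentiable_sigma : Differentiable ℂ L.sigma := by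
  rw [funext (sigma_eq_mul_sigmaProd L)]
  exact differentiable_id.mul (differentiable_sigmaProd L)

variable {L} in
theorem weierstrassFactor_div_ne_zero {z : ℂ} (hz : z ∉ (L.lattice \ {0} : Set ℂ))
    (l : {l : L.lattice // l ≠ 0}) : weierstrassFactor (z / l) ≠ 0 := by
  have hl : (l : ℂ) ≠ 0 := by simpa using l.2
  refine weierstrassFactor_ne_zero fun h => hz ?_
  rw [(div_eq_one_iff_eq hl).mp h]
  exact ⟨l.1.2, hl⟩

theorem sigmaProd_ne_zero {z : ℂ} (hz : z ∉ (L.lattice \ {0} : Set ℂ)) : sigmaProd L z ≠ 0 := by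
  have hsum : Summable fun l : {l : L.lattice // l ≠ 0} => ‖weierstrassFactor (z / l) - 1‖ := by
    refine Summable.of_norm_bounded_eventually
      (summable_norm_inv_lattice_pow_three L (Real.exp 2 * (‖z‖ + 1) ^ 3)) ?_
    filter_upwards [eventually_norm_weierstrassFactor_div_sub_one_le L (‖z‖ + 1)] with l hl
    rw [norm_norm]
    exact hl z (by simp)
  have h := tprod_one_add_ne_zero_of_summable
    (f := fun l : {l : L.lattice // l ≠ 0} => weierstrassFactor (z / l) - 1)
    (fun l => by rw [add_sub_cancel]; exact weierstrassFactor_div_ne_zero hz l) hsum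
  simp only [add_sub_cancel] at h
  exact h

theorem sigma_ne_zero {z : ℂ} (hz : z ∉ L.lattice) : L.sigma z ≠ 0 := by
  rw [sigma_eq_mul_sigmaProd]
  exact mul_ne_zero (fun h => hz (h ▸ zero_mem _)) (sigmaProd_ne_zero L fun h => hz h.1)

theorem sigma_eq_zero {z : ℂ} (hz : z ∈ L.lattice) : L.sigma z = 0 := by
  rw [sigma_eq_mul_sigmaProd]
  by_cases h0 : z = 0
  · rw [h0, zero_mul]
  · rw [sigmaProd, tprod_of_exists_eq_zero, mul_zero]
    refine ⟨⟨⟨z, hz⟩, fun h => h0 (congrArg Subtype.val h)⟩, ?_⟩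
    simp [weierstrassFactor, h0]

/-- The terms of the partial fraction expansion of `ζ(z) - 1/z`. The lattice point `0` is assigned
the term `0`, so that the sum runs over the whole lattice. -/
def zetaTerm (l z : ℂ) : ℂ := if l = 0 then 0 else 1 / (z - l) + 1 / l + z / l ^ 2

/-- The function `ζ(z) - 1/z`, continued to `z = 0`. -/
def zetaExcept (z : ℂ) : ℂ := ∑' l : L.lattice, zetaTerm l z

@[simp]
theorem zetaTerm_zero (z : ℂ) : zetaTerm 0 z = 0 := if_pos rfl

theorem zetaTerm_of_ne_zero {l : ℂ} (hl : l ≠ 0) (z : ℂ) :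
    zetaTerm l z = 1 / (z - l) + 1 / l + z / l ^ 2 := if_neg hl

theorem norm_zetaTerm_le {r : ℝ} {z l : ℂ} (hr : 0 < r) (hz : ‖z‖ < r) (hl : 2 * r ≤ ‖l‖) :
    ‖zetaTerm l z‖ ≤ 2 * r ^ 2 * ‖l‖⁻¹ ^ 3 := by
  have hpos : 0 < ‖l‖ := by linarith
  have hl0 : l ≠ 0 := norm_pos_iff.mp hpos
  have hhalf : ‖l‖ / 2 ≤ ‖z - l‖ := by
    rw [norm_sub_rev]
    exact .trans (by linarith) (norm_sub_norm_le l z)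
  have hzl : z - l ≠ 0 := norm_pos_iff.mp (by linarith)
  have hfrac : zetaTerm l z = z ^ 2 / (l ^ 2 * (z - l)) := by
    rw [zetaTerm_of_ne_zero hl0]
    field_simp
    ring
  rw [hfrac, norm_div, norm_mul, norm_pow, norm_pow]
  calc ‖z‖ ^ 2 / (‖l‖ ^ 2 * ‖z - l‖) ≤ r ^ 2 / (‖l‖ ^ 2 * (‖l‖ / 2)) := by gcongr
    _ = 2 * r ^ 2 * ‖l‖⁻¹ ^ 3 := by field_simp

theorem hasSumLocallyUniformly_zetaExcept :
    HasSumLocallyUniformly (fun (l : L.lattice) (z : ℂ) => zetaTerm l z) (zetaExcept L) := by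
  refine L.hasSumLocallyUniformly_aux (u := fun r l => 2 * r ^ 2 * ‖(l : ℂ)‖⁻¹ ^ 3) _
    (fun r _ => (ZLattice.summable_norm_pow_inv L.lattice 3 (by simp)).mul_left _) fun r hr =>
    eventually_atTop.mpr ⟨2 * r, ?_⟩
  rintro _ hR z hz l rfl
  exact norm_zetaTerm_le hr hz hR

theorem hasDerivAt_zetaTerm {l z : ℂ} (hz : z ≠ l) :
    HasDerivAt (zetaTerm l) (-(if l = 0 then 0 else 1 / (z - l) ^ 2 - 1 / l ^ 2)) z := by
  rcases eq_or_ne l 0 with rfl | hl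
  · simpa [funext zetaTerm_zero] using hasDerivAt_const z (0 : ℂ)
  have hinv : HasDerivAt (fun u : ℂ => (u - l)⁻¹) (-1 / (z - l) ^ 2) z :=
    ((hasDerivAt_id z).sub_const l).fun_inv (sub_ne_zero.mpr hz)
  have hlin : HasDerivAt (fun u : ℂ => u / l ^ 2) (1 / l ^ 2) z :=
    (hasDerivAt_id z).div_const (l ^ 2)
  rw [if_neg hl, funext (zetaTerm_of_ne_zero hl)]
  simp only [one_div] at hinv hlin ⊢
  exact ((hinv.add_const l⁻¹).fun_add hlin).congr_deriv (by ring)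

theorem differentiableOn_zetaTerm (l : L.lattice) :
    DifferentiableOn ℂ (zetaTerm l) (L.lattice \ {0} : Set ℂ)ᶜ := by
  intro z hz
  rcases eq_or_ne (l : ℂ) 0 with hl | hl
  · rw [hl, funext zetaTerm_zero]
    exact differentiableWithinAt_const 0
  · refine (hasDerivAt_zetaTerm ?_).differentiableAt.differentiableWithinAt
    rintro rfl
    exact hz ⟨l.2, hl⟩

theorem differentiableOn_zetaExcept :
    DifferentiableOn ℂ (zetaExcept L) (L.lattice \ {0} : Set ℂ)ᶜ :=
  (hasSumLocallyUniformly_zetaExcept L).hasSumLocallyUniformlyOn.differentiableOn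
    (.of_forall fun _ => .fun_sum fun i _ => differentiableOn_zetaTerm L i)
    L.isOpen_compl_lattice_sdiff

theorem hasSum_deriv_zetaTerm {z : ℂ} (hz : z ∉ (L.lattice \ {0} : Set ℂ)) :
    HasSum (fun l : L.lattice => deriv (zetaTerm l) z) (deriv (zetaExcept L) z) := by
  have h := ((hasSumLocallyUniformly_zetaExcept L).tendstoLocallyUniformlyOn
    (s := (L.lattice \ {0})ᶜ)).deriv (.of_forall fun _ => .fun_sum fun i _ =>
      differentiableOn_zetaTerm L i) L.isOpen_compl_lattice_sdiff
  rw [HasSum]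
  convert! h.tendsto_at hz using 1
  ext1 s
  exact (deriv_fun_sum fun i _ => (differentiableOn_zetaTerm L i).differentiableAt
    (L.isOpen_compl_lattice_sdiff.mem_nhds hz)).symm

theorem hasDerivAt_zetaExcept {z : ℂ} (hz : z ∉ (L.lattice \ {0} : Set ℂ)) :
    HasDerivAt (zetaExcept L) (-L.weierstrassPExcept 0 z) z := by
  have hterm : ∀ l : L.lattice, deriv (zetaTerm l) z =
      -(if (l : ℂ) = 0 then 0 else (1 / (z - l) ^ 2 - 1 / (l : ℂ) ^ 2)) := fun l => by
    rcases eq_or_ne (l : ℂ) 0 with hl | hl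
    · simp [hl, funext zetaTerm_zero]
    · refine (hasDerivAt_zetaTerm ?_).deriv
      rintro rfl
      exact hz ⟨l.2, hl⟩
  have hsum := hasSum_deriv_zetaTerm L hz
  simp only [hterm] at hsum
  rw [← hsum.unique (L.hasSum_weierstrassPExcept 0 z).neg]
  exact ((differentiableOn_zetaExcept L).differentiableAt
    (L.isOpen_compl_lattice_sdiff.mem_nhds hz)).hasDerivAt

theorem logDeriv_weierstrassFactor_div {l z : ℂ} (hl : l ≠ 0) (hz : z ≠ l) :
    logDeriv (fun u => weierstrassFactor (u / l)) z = zetaTerm l z := by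
  have hzl : z - l ≠ 0 := sub_ne_zero.mpr hz
  have hlz : l - z ≠ 0 := sub_ne_zero.mpr hz.symm
  have hsub : 1 - z / l = (l - z) / l := by field_simp
  have hdiv : HasDerivAt (fun u => u / l) (1 / l) z := (hasDerivAt_id z).div_const l
  have hcomp := logDeriv_comp (differentiable_weierstrassFactor _) hdiv.differentiableAt
  rw [Function.comp_def] at hcomp
  rw [hcomp, logDeriv_weierstrassFactor, hdiv.deriv, zetaTerm_of_ne_zero hl, hsub]
  field_simp
  ring

theorem logDeriv_sigmaProd {z : ℂ} (hz : z ∉ (L.lattice \ {0} : Set ℂ)) :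
    logDeriv (sigmaProd L) z = zetaExcept L z := by
  have hterm : ∀ l : {l : L.lattice // l ≠ 0},
      logDeriv (fun u => weierstrassFactor (u / l)) z = zetaTerm l z := fun l => by
    have hl : (l : ℂ) ≠ 0 := by simpa using l.2
    exact logDeriv_weierstrassFactor_div hl fun h => hz (h ▸ ⟨l.1.2, hl⟩)
  have hsum : HasSum (fun l : {l : L.lattice // l ≠ 0} =>
      logDeriv (fun u => weierstrassFactor (u / l)) z) (zetaExcept L z) := by
    simp only [hterm]
    refine (hasSum_subtype_iff_of_support_subset (s := {l : L.lattice | l ≠ 0}) ?_).mpr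
      ((hasSumLocallyUniformly_zetaExcept L).hasSum (x := z))
    rintro l hl rfl
    exact hl (zetaTerm_zero z)
  have h := logDeriv_tprod_eq_tsum (s := Metric.ball (0 : ℂ) (‖z‖ + 1)) Metric.isOpen_ball
    (x := z) (by simp)
    (f := fun (l : {l : L.lattice // l ≠ 0}) (z : ℂ) => weierstrassFactor (z / l))
    (weierstrassFactor_div_ne_zero hz)
    (fun l => (differentiable_weierstrassFactor_div l).differentiableOn) hsum.summable
    (hasProdLocallyUniformlyOn_sigmaProd L _).multipliableLocallyUniformlyOn
    (sigmaProd_ne_zero L hz)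
  exact h.trans hsum.tsum_eq

theorem zeta_eq {z : ℂ} (hz : z ∉ L.lattice) : L.zeta z = 1 / z + zetaExcept L z := by
  have hz' : z ∉ (L.lattice \ {0} : Set ℂ) := fun h => hz h.1
  have hsigma : L.sigma = fun z => id z * sigmaProd L z := funext (sigma_eq_mul_sigmaProd L)
  have h0 : id z ≠ 0 := fun h : z = 0 => hz (h ▸ zero_mem _)
  rw [PeriodPair.zeta, ← logDeriv_apply, hsigma, logDeriv_mul z h0
    (sigmaProd_ne_zero L hz') differentiableAt_id (differentiable_sigmaProd L z),
    logDeriv_sigmaProd L hz', logDeriv_id]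

theorem zeta_sub_inv {z : ℂ} (hz : z ∉ (L.lattice \ {0} : Set ℂ)) :
    L.zeta z - 1 / z = zetaExcept L z := by
  rcases eq_or_ne z 0 with rfl | h0
  · simp [PeriodPair.zeta, sigma_eq_zero L (zero_mem _), zetaExcept, zetaTerm]
  · rw [zeta_eq L fun h => hz ⟨h, h0⟩, add_sub_cancel_left]

theorem isPreconnected_compl_lattice : IsPreconnected (L.lattice : Set ℂ)ᶜ := by
  have h : (L.lattice : Set ℂ).Countable := Set.countable_coe_iff.mp
    (inferInstanceAs (Countable L.lattice))
  exact (h.isConnected_compl_of_one_lt_rank (by simp)).isPreconnected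

theorem isOpen_compl_lattice : IsOpen (L.lattice : Set ℂ)ᶜ := L.isClosed_lattice.isOpen_compl

theorem hasDerivAt_zeta {z : ℂ} (hz : z ∉ L.lattice) : HasDerivAt L.zeta (-L.weierstrassP z) z := by
  have h0 : z ≠ 0 := fun h => hz (h ▸ zero_mem _)
  have hzeta : L.zeta =ᶠ[𝓝 z] fun z => z⁻¹ + zetaExcept L z := by
    filter_upwards [(isOpen_compl_lattice L).mem_nhds hz] with w hw
    rw [zeta_eq L hw, one_div]
  refine (((hasDerivAt_inv h0).fun_add
    (hasDerivAt_zetaExcept L fun h => hz h.1)).congr_of_eventuallyEq hzeta).congr_deriv ?_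
  have hP := L.weierstrassPExcept_def 0 z
  simp only [ZeroMemClass.coe_zero] at hP
  rw [hP]
  simp

theorem exists_zeta_add {w : ℂ} (hw : w ∈ L.lattice) :
    ∃ η : ℂ, ∀ z ∉ L.lattice, L.zeta (z + w) = L.zeta z + η := by
  have hd : ∀ z ∉ L.lattice, HasDerivAt (fun z => L.zeta (z + w)) (-L.weierstrassP z) z := by
    intro z hz
    have h := (hasDerivAt_zeta L (mt (L.lattice.add_mem_iff_left hw).mp hz)).comp_add_const z w
    rwa [L.weierstrassP_add_coe z ⟨w, hw⟩] at h
  exact (isOpen_compl_lattice L).exists_eq_add_of_deriv_eq (isPreconnected_compl_lattice L)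
    (fun z hz => (hd z hz).differentiableAt.differentiableWithinAt)
    (fun z hz => (hasDerivAt_zeta L hz).differentiableAt.differentiableWithinAt)
    (fun z hz => by rw [(hd z hz).deriv, (hasDerivAt_zeta L hz).deriv])

theorem exists_quasiPeriod {w : ℂ} (hw : w ∈ L.lattice) : ∃ η c : ℂ, c ≠ 0 ∧
    (∀ z ∉ L.lattice, L.zeta (z + w) = L.zeta z + η) ∧
    ∀ z, L.sigma (z + w) = c * Complex.exp (η * z) * L.sigma z := by
  obtain ⟨η, hη⟩ := exists_zeta_add L hw
  have hexp : ∀ z, HasDerivAt (fun z => Complex.exp (η * z)) (Complex.exp (η * z) * η) z :=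
    fun z => by simpa using ((hasDerivAt_id z).const_mul η).cexp
  have hexp' : Differentiable ℂ fun z => Complex.exp (η * z) := fun z => (hexp z).differentiableAt
  have hlogDeriv : Set.EqOn (logDeriv fun z => L.sigma (z + w))
      (logDeriv fun z => Complex.exp (η * z) * L.sigma z) (L.lattice : Set ℂ)ᶜ := by
    intro z hz
    rw [logDeriv_mul (f := fun z => Complex.exp (η * z)) z (Complex.exp_ne_zero _)
      (sigma_ne_zero L hz) (hexp' z) (differentiable_sigma L z),
      logDeriv_apply (fun z => Complex.exp (η * z)), (hexp z).deriv,
      mul_div_cancel_left₀ _ (Complex.exp_ne_zero _), logDeriv_apply, deriv_comp_add_const,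
      add_comm η]
    exact hη z hz
  obtain ⟨c, hc, h⟩ := (logDeriv_eqOn_iff
    ((differentiable_sigma L).comp (differentiable_id.add_const w)).differentiableOn
    (hexp'.mul (differentiable_sigma L)).differentiableOn
    (isOpen_compl_lattice L) (isPreconnected_compl_lattice L)
    (fun z hz => mul_ne_zero (Complex.exp_ne_zero _) (sigma_ne_zero L hz))
    (fun z hz => sigma_ne_zero L (mt (L.lattice.add_mem_iff_left hw).mp hz))).mp hlogDeriv
  refine ⟨η, c, hc, hη, fun z => ?_⟩
  by_cases hz : z ∈ L.lattice
  · rw [sigma_eq_zero L hz, sigma_eq_zero L (add_mem hz hw), mul_zero]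
  · rw [mul_assoc]
    exact h hz

end Lame

/-! ### Elliptic functions with at most one simple pole -/

namespace Lame

/-- Periodicity of a meromorphic function with respect to the lattice. As the values of `f` at its
poles carry no information, only punctured neighbourhoods are taken into account. -/
def IsLatticePeriodic (L : PeriodPair) (f : ℂ → ℂ) : Prop :=
  ∀ w ∈ L.lattice, ∀ z, (fun u => f (u + w)) =ᶠ[𝓝[≠] z] f

theorem tendsto_add_const_nhdsNE (z w : ℂ) :
    Tendsto (fun u => u + w) (𝓝[≠] z) (𝓝[≠] (z + w)) :=
  map_add_right_nhdsNE.le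

theorem tendsto_const_sub_nhdsNE (z w : ℂ) :
    Tendsto (fun u => w - u) (𝓝[≠] z) (𝓝[≠] (w - z)) :=
  map_subLeft_nhdsNE.le

theorem tendsto_neg_nhdsNE (z : ℂ) : Tendsto (fun u => -u) (𝓝[≠] z) (𝓝[≠] (-z)) := by
  simpa using tendsto_const_sub_nhdsNE z 0

theorem meromorphic_comp_add_const {f : ℂ → ℂ} (hf : Meromorphic f) (p : ℂ) :
    Meromorphic fun u => f (u + p) := fun z =>
  (hf (z + p)).comp_analyticAt (g := fun u => u + p) (by fun_prop)

theorem meromorphic_comp_neg {f : ℂ → ℂ} (hf : Meromorphic f) : Meromorphic fun u => f (-u) :=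
  fun z => (hf (-z)).comp_analyticAt (g := fun u => -u) (by fun_prop)

theorem meromorphicOrderAt_comp_add_const (f : ℂ → ℂ) (p z : ℂ) :
    meromorphicOrderAt (fun u => f (u + p)) z = meromorphicOrderAt f (z + p) :=
  meromorphicOrderAt_comp_add_const_eq_meromorphicOrderAt

theorem meromorphicOrderAt_comp_neg (f : ℂ → ℂ) (z : ℂ) :
    meromorphicOrderAt (fun u => f (-u)) z = meromorphicOrderAt f (-z) :=
  meromorphicOrderAt_comp_of_deriv_ne_zero (g := fun u => -u) (by fun_prop) (by simp)

theorem nonneg_add_of_neg_one_le_of_pos {a b : WithTop ℤ} (ha : -1 ≤ a) (hb : 0 < b) :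
    0 ≤ a + b := by
  cases a with
  | top => simp
  | coe a =>
    cases b with
    | top => simp
    | coe b =>
      have ha : -1 ≤ a := WithTop.coe_le_coe.mp ha
      norm_cast at hb ⊢
      lia

theorem nonneg_of_one_add_pos {a : WithTop ℤ} (h : 0 < 1 + a) : 0 ≤ a := by
  cases a with
  | top => simp
  | coe a =>
    norm_cast at h ⊢
    lia

theorem le_meromorphicOrderAt_sub_const {f : ℂ → ℂ} {z : ℂ} (hf : MeromorphicAt f z) (c : ℂ)
    {m : WithTop ℤ} (hm : m ≤ 0) (h : m ≤ meromorphicOrderAt f z) :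
    m ≤ meromorphicOrderAt (fun u => f u - c) z := by
  have hsub : (fun u => f u - c) = f + fun _ => -c := funext fun u => sub_eq_add_neg _ _
  rw [hsub]
  exact (le_min h (hm.trans analyticAt_const.meromorphicOrderAt_nonneg)).trans
    (meromorphicOrderAt_add hf (MeromorphicAt.const _ _))

/-- The principal parts of `f(u)` and `f(-u)` at a simple pole in `0` cancel. -/
theorem meromorphicOrderAt_add_comp_neg_nonneg {f : ℂ → ℂ} (hf : Meromorphic f)
    (h : -1 ≤ meromorphicOrderAt f 0) : 0 ≤ meromorphicOrderAt (f + fun u => f (-u)) 0 := by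
  have hS : MeromorphicAt (f + fun u => f (-u)) 0 := (hf 0).add (meromorphic_comp_neg hf 0)
  have hid : MeromorphicAt (id : ℂ → ℂ) 0 := MeromorphicAt.id 0
  have hnonneg : 0 ≤ meromorphicOrderAt (id * f) 0 := by
    rw [meromorphicOrderAt_mul hid (hf 0), meromorphicOrderAt_id]
    grw [← h]
    decide
  obtain ⟨residue, hres⟩ := tendsto_nhds_of_meromorphicOrderAt_nonneg (hid.mul (hf 0)) hnonneg
  have hneg := tendsto_neg_nhdsNE 0
  rw [neg_zero] at hneg
  have hzero := hres.sub (hres.comp hneg)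
  rw [sub_self] at hzero
  have hpos : 0 < meromorphicOrderAt (id * (f + fun u => f (-u))) 0 := by
    rw [← tendsto_zero_iff_meromorphicOrderAt_pos (hid.mul hS)]
    refine hzero.congr fun u => ?_
    simp only [Pi.mul_apply, id, Function.comp, Pi.add_apply]
    ring
  rw [meromorphicOrderAt_mul hid hS, meromorphicOrderAt_id] at hpos
  exact nonneg_of_one_add_pos hpos

theorem eventuallyEq_zero_of_meromorphicOrderAt_eq_top {f : ℂ → ℂ} (hf : Meromorphic f) {p : ℂ}
    (h : meromorphicOrderAt f p = ⊤) (z : ℂ) : f =ᶠ[𝓝[≠] z] fun _ => 0 := by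
  refine meromorphicOrderAt_eq_top_iff.mp ?_
  by_contra hne
  exact MeromorphicOn.meromorphicOrderAt_ne_top_of_isPreconnected (fun z _ => hf z)
    isPreconnected_univ (Set.mem_univ z) (Set.mem_univ p) hne h

namespace IsLatticePeriodic

variable {L : PeriodPair} {f g : ℂ → ℂ}

theorem comp_add_const (hf : IsLatticePeriodic L f) (p : ℂ) :
    IsLatticePeriodic L fun u => f (u + p) := fun w hw z => by
  filter_upwards [(tendsto_add_const_nhdsNE z p).eventually (hf w hw (z + p))] with u hu
  rw [← hu, add_right_comm]

theorem comp_neg (hf : IsLatticePeriodic L f) : IsLatticePeriodic L fun u => f (-u) :=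
  fun w hw z => by
    filter_upwards [(tendsto_neg_nhdsNE z).eventually (hf (-w) (neg_mem hw) (-z))] with u hu
    rw [← hu, neg_add]

theorem add (hf : IsLatticePeriodic L f) (hg : IsLatticePeriodic L g) :
    IsLatticePeriodic L (f + g) := fun w hw z => (hf w hw z).add (hg w hw z)

theorem mul (hf : IsLatticePeriodic L f) (hg : IsLatticePeriodic L g) :
    IsLatticePeriodic L (f * g) := fun w hw z => (hf w hw z).mul (hg w hw z)

theorem meromorphicOrderAt_add (hf : IsLatticePeriodic L f) {w : ℂ} (hw : w ∈ L.lattice)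
    (z : ℂ) : meromorphicOrderAt f (z + w) = meromorphicOrderAt f z := by
  rw [← meromorphicOrderAt_comp_add_const, meromorphicOrderAt_congr (hf w hw z)]

theorem meromorphicOrderAt_of_mem (hf : IsLatticePeriodic L f) {w : ℂ} (hw : w ∈ L.lattice) :
    meromorphicOrderAt f w = meromorphicOrderAt f 0 := by
  simpa using hf.meromorphicOrderAt_add hw 0

theorem exists_eq_const_of_differentiable (hf : IsLatticePeriodic L f)
    (hd : Differentiable ℂ f) : ∃ c, ∀ z, f z = c := by
  refine ⟨f 0, fun z => hd.apply_eq_apply_of_bounded (IsZLattice.isCompact_range_of_periodic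
    L.lattice _ hd.continuous fun z w hw => ?_).isBounded z 0⟩
  have hshift : Tendsto (fun u => f (u + w)) (𝓝[≠] z) (𝓝 (f (z + w))) :=
    ((hd.continuous.comp (continuous_id.add continuous_const)).tendsto z).mono_left
      nhdsWithin_le_nhds
  exact tendsto_nhds_unique (hshift.congr' (hf w hw z))
    ((hd.continuous.tendsto z).mono_left nhdsWithin_le_nhds)

theorem exists_eventuallyEq_const (hf : IsLatticePeriodic L f) (hm : Meromorphic f)
    (ho : ∀ z, 0 ≤ meromorphicOrderAt f z) : ∃ c, ∀ z, f =ᶠ[𝓝[≠] z] fun _ => c := by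
  have hmOn : MeromorphicOn f Set.univ := fun z _ => hm z
  set g := toMeromorphicNFOn f Set.univ
  have hfg : ∀ z, f =ᶠ[𝓝[≠] z] g := fun z =>
    (hmOn.toMeromorphicNFOn_eq_self_on_nhdsNE (Set.mem_univ z)).symm
  have hg : Differentiable ℂ g := fun z =>
    ((meromorphicNFOn_toMeromorphicNFOn f Set.univ
      (Set.mem_univ z)).meromorphicOrderAt_nonneg_iff_analyticAt.mp
      (by rw [meromorphicOrderAt_toMeromorphicNFOn hmOn trivial]; exact ho z)).differentiableAt
  have hper : IsLatticePeriodic L g := fun w hw z => by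
    filter_upwards [hf w hw z, hfg z, (tendsto_add_const_nhdsNE z w).eventually (hfg (z + w))]
      with u hu hu' hu''
    rw [← hu'', hu, hu']
  obtain ⟨c, hc⟩ := hper.exists_eq_const_of_differentiable hg
  exact ⟨c, fun z => (hfg z).trans (Eventually.of_forall hc)⟩

theorem meromorphicOrderAt_pos_of_odd (hf : IsLatticePeriodic L f) (hm : Meromorphic f)
    (hodd : ∀ z, (fun u => f (-u)) =ᶠ[𝓝[≠] z] fun u => -f u) {h : ℂ} (hh : h + h ∈ L.lattice)
    (ho : 0 ≤ meromorphicOrderAt f h) : 0 < meromorphicOrderAt f h := by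
  rw [← tendsto_zero_iff_meromorphicOrderAt_pos (hm h)]
  obtain ⟨l, hl⟩ := tendsto_nhds_of_meromorphicOrderAt_nonneg (hm h) ho
  have hreflect : Tendsto (fun u => h + h - u) (𝓝[≠] h) (𝓝[≠] h) := by
    simpa using tendsto_const_sub_nhdsNE h (h + h)
  have hneg : Tendsto (fun u => -f u) (𝓝[≠] h) (𝓝 l) := by
    refine (hl.comp hreflect).congr' ?_
    filter_upwards [hodd h, (tendsto_neg_nhdsNE h).eventually (hf _ hh (-h))] with u hu hu'
    rw [← hu, ← hu', Function.comp_apply, sub_eq_neg_add]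
  have hl0 : l = 0 := self_eq_neg.mp (tendsto_nhds_unique hneg hl.neg)
  rwa [hl0] at hl

/-- The zero of an odd function at the half period `h` cancels the simple pole of its translate. -/
theorem meromorphicOrderAt_mul_translate_nonneg (hf : IsLatticePeriodic L f)
    (ho : ∀ z ∉ L.lattice, 0 ≤ meromorphicOrderAt f z) (ho0 : -1 ≤ meromorphicOrderAt f 0) {h : ℂ}
    (hh : h + h ∈ L.lattice) (hpos : 0 < meromorphicOrderAt f h) (z : ℂ) :
    0 ≤ meromorphicOrderAt f z + meromorphicOrderAt f (z + h) := by
  by_cases hz : z ∈ L.lattice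
  · refine nonneg_add_of_neg_one_le_of_pos (hf.meromorphicOrderAt_of_mem hz ▸ ho0) ?_
    rwa [add_comm, hf.meromorphicOrderAt_add hz]
  by_cases hzh : z + h ∈ L.lattice
  · rw [add_comm]
    refine nonneg_add_of_neg_one_le_of_pos (hf.meromorphicOrderAt_of_mem hzh ▸ ho0) ?_
    rwa [← hf.meromorphicOrderAt_add hh, show z + (h + h) = h + (z + h) by ring,
      hf.meromorphicOrderAt_add hzh]
  · exact add_nonneg (ho z hz) (ho _ hzh)

theorem eq_zero_of_odd (hf : IsLatticePeriodic L f) (hm : Meromorphic f)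
    (hodd : ∀ z, (fun u => f (-u)) =ᶠ[𝓝[≠] z] fun u => -f u)
    (ho : ∀ z ∉ L.lattice, 0 ≤ meromorphicOrderAt f z) (ho0 : -1 ≤ meromorphicOrderAt f 0)
    (z : ℂ) : f =ᶠ[𝓝[≠] z] fun _ => 0 := by
  set h := L.ω₁ / 2
  have hh : h + h ∈ L.lattice := by
    rw [add_halves]
    exact L.ω₁_mem_lattice
  have hpos₁ := hf.meromorphicOrderAt_pos_of_odd hm hodd hh (ho _ L.ω₁_div_two_notMem_lattice)
  have hpos₂ := hf.meromorphicOrderAt_pos_of_odd hm hodd (h := L.ω₂ / 2)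
    (by rw [add_halves]; exact L.ω₂_mem_lattice) (ho _ L.ω₂_div_two_notMem_lattice)
  have hsum : L.ω₂ / 2 + h ∉ L.lattice := by
    simpa [h, inv_mul_eq_div, add_comm] using
      (L.mul_ω₁_add_mul_ω₂_mem_lattice (α := 1 / 2) (β := 1 / 2)).not.mpr (by norm_num)
  set g : ℂ → ℂ := f * fun u => f (u + h)
  have hgm : Meromorphic g := fun z => (hm z).mul (meromorphic_comp_add_const hm h z)
  have horder : ∀ z, meromorphicOrderAt g z =
      meromorphicOrderAt f z + meromorphicOrderAt f (z + h) := fun z => by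
    rw [meromorphicOrderAt_mul (hm z) (meromorphic_comp_add_const hm h z),
      meromorphicOrderAt_comp_add_const]
  obtain ⟨c, hc⟩ := (hf.mul (hf.comp_add_const h)).exists_eventuallyEq_const hgm fun z =>
    (hf.meromorphicOrderAt_mul_translate_nonneg ho ho0 hh hpos₁ z).trans_eq (horder z).symm
  have hgpos : 0 < meromorphicOrderAt g (L.ω₂ / 2) := by
    rw [horder]
    exact add_pos_of_pos_of_nonneg hpos₂ (ho _ hsum)
  have hc0 : c = 0 := tendsto_nhds_unique (tendsto_const_nhds.congr' (hc _).symm)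
    (tendsto_zero_of_meromorphicOrderAt_pos hgpos)
  have htop : meromorphicOrderAt f 0 + meromorphicOrderAt f (0 + h) = ⊤ := by
    rw [← horder, meromorphicOrderAt_eq_top_iff]
    exact (hc 0).mono fun u hu => hu.trans hc0
  rcases WithTop.add_eq_top.mp htop with hp | hp <;>
    exact eventuallyEq_zero_of_meromorphicOrderAt_eq_top hm hp z

theorem exists_eventuallyEq_const_of_simple_pole_zero (hf : IsLatticePeriodic L f)
    (hm : Meromorphic f) (ho : ∀ z ∉ L.lattice, 0 ≤ meromorphicOrderAt f z)
    (ho0 : -1 ≤ meromorphicOrderAt f 0) : ∃ c, ∀ z, f =ᶠ[𝓝[≠] z] fun _ => c := by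
  have hS := hf.add hf.comp_neg
  obtain ⟨c, hc⟩ := hS.exists_eventuallyEq_const
    (fun z => (hm z).add (meromorphic_comp_neg hm z)) fun z => by
      by_cases hz : z ∈ L.lattice
      · rw [hS.meromorphicOrderAt_of_mem hz]
        exact meromorphicOrderAt_add_comp_neg_nonneg hm ho0
      · refine (le_min (ho z hz) ?_).trans
          (_root_.meromorphicOrderAt_add (hm z) (meromorphic_comp_neg hm z))
        rw [meromorphicOrderAt_comp_neg]
        exact ho _ (by simpa using hz)
  have hodd : ∀ z, (fun u => f u - c / 2) =ᶠ[𝓝[≠] z] fun _ => 0 :=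
    eq_zero_of_odd (L := L)
      (fun w hw z => (hf w hw z).sub EventuallyEq.rfl)
      (fun z => (hm z).sub (MeromorphicAt.const _ _))
      (fun z => by
        filter_upwards [hc z] with u hu
        have hu : f u + f (-u) = c := hu
        linear_combination hu)
      (fun z hz => le_meromorphicOrderAt_sub_const (hm z) _ le_rfl (ho z hz))
      (le_meromorphicOrderAt_sub_const (hm 0) _ (by decide) ho0)
  exact ⟨c / 2, fun z => (hodd z).mono fun u hu => sub_eq_zero.mp hu⟩

theorem exists_eventuallyEq_const_of_simple_pole (hf : IsLatticePeriodic L f)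
    (hm : Meromorphic f) (p : ℂ) (ho : ∀ z, z - p ∉ L.lattice → 0 ≤ meromorphicOrderAt f z)
    (hop : -1 ≤ meromorphicOrderAt f p) : ∃ c, ∀ z, f =ᶠ[𝓝[≠] z] fun _ => c := by
  obtain ⟨c, hc⟩ := (hf.comp_add_const p).exists_eventuallyEq_const_of_simple_pole_zero
    (meromorphic_comp_add_const hm p)
    (fun z hz => by
      rw [meromorphicOrderAt_comp_add_const]
      exact ho _ (by simpa using hz))
    (by rwa [meromorphicOrderAt_comp_add_const, zero_add])
  refine ⟨c, fun z => ?_⟩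
  filter_upwards [(tendsto_add_const_nhdsNE z (-p)).eventually (hc (z + -p))] with u hu
  rwa [neg_add_cancel_right] at hu

end IsLatticePeriodic

end Lame

/-! ### Taylor coefficients depending on a parameter -/

namespace Lame

/-- The `n`-th Taylor coefficient of `f` at `0`. -/
def taylorCoeff (n : ℕ) (f : ℂ → ℂ) : ℂ := iteratedDeriv n f 0 / (n.factorial : ℂ)

theorem taylorCoeff_zero (f : ℂ → ℂ) : taylorCoeff 0 f = f 0 := by
  simp [taylorCoeff]

theorem taylorCoeff_congr {f g : ℂ → ℂ} (h : f =ᶠ[𝓝 0] g) (n : ℕ) :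
    taylorCoeff n f = taylorCoeff n g := by
  rw [taylorCoeff, taylorCoeff, h.iteratedDeriv_eq]

theorem taylorCoeff_const_zero (n : ℕ) : taylorCoeff n (fun _ => 0) = 0 := by
  simp [taylorCoeff]

theorem taylorCoeff_add {f g : ℂ → ℂ} (hf : AnalyticAt ℂ f 0) (hg : AnalyticAt ℂ g 0) (n : ℕ) :
    taylorCoeff n (fun z => f z + g z) = taylorCoeff n f + taylorCoeff n g := by
  rw [taylorCoeff, iteratedDeriv_fun_add hf.contDiffAt hg.contDiffAt, add_div]
  rfl

theorem taylorCoeff_sub {f g : ℂ → ℂ} (hf : AnalyticAt ℂ f 0) (hg : AnalyticAt ℂ g 0) (n : ℕ) :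
    taylorCoeff n (fun z => f z - g z) = taylorCoeff n f - taylorCoeff n g := by
  rw [taylorCoeff, iteratedDeriv_fun_sub hf.contDiffAt hg.contDiffAt, sub_div]
  rfl

theorem taylorCoeff_const_mul (c : ℂ) (f : ℂ → ℂ) (n : ℕ) :
    taylorCoeff n (fun z => c * f z) = c * taylorCoeff n f := by
  rw [taylorCoeff, iteratedDeriv_const_mul_field, mul_div_assoc]
  rfl

theorem taylorCoeff_mul {f g : ℂ → ℂ} (hf : AnalyticAt ℂ f 0) (hg : AnalyticAt ℂ g 0) (n : ℕ) :
    taylorCoeff n (fun z => f z * g z) =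
      ∑ ij ∈ antidiagonal n, taylorCoeff ij.1 f * taylorCoeff ij.2 g := by
  rw [taylorCoeff, iteratedDeriv_fun_mul hf.contDiffAt hg.contDiffAt,
    Finset.Nat.sum_antidiagonal_eq_sum_range_succ (fun i j => taylorCoeff i f * taylorCoeff j g),
    sum_div]
  refine sum_congr rfl fun i hi => ?_
  rw [taylorCoeff, taylorCoeff, Nat.cast_choose ℂ (Nat.lt_succ_iff.mp (mem_range.mp hi))]
  field_simp [Nat.factorial_ne_zero]

theorem taylorCoeff_pow (m n : ℕ) : taylorCoeff n (fun z => z ^ m) = if n = m then 1 else 0 := by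
  rw [taylorCoeff, iteratedDeriv_pow]
  rcases lt_trichotomy n m with h | rfl | h
  · simp [h.ne, Nat.sub_ne_zero_of_lt h]
  · simp [Nat.descFactorial_self, Nat.factorial_ne_zero]
  · simp [h.ne', Nat.descFactorial_of_lt h]

theorem taylorCoeff_pow_mul {f : ℂ → ℂ} (hf : AnalyticAt ℂ f 0) (m n : ℕ) :
    taylorCoeff n (fun z => z ^ m * f z) = if n < m then 0 else taylorCoeff (n - m) f := by
  rw [taylorCoeff_mul (f := fun z => z ^ m) (by fun_prop) hf]
  simp only [taylorCoeff_pow, ite_mul, one_mul, zero_mul,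
    Finset.Nat.sum_antidiagonal_eq_sum_range_succ_mk, sum_ite_eq', mem_range, Nat.lt_succ_iff]
  split_ifs <;> first | rfl | omega

theorem exists_eq_pow_mul_of_taylorCoeff_eq_zero {f : ℂ → ℂ} (hf : AnalyticAt ℂ f 0) {n : ℕ}
    (h : ∀ m < n, taylorCoeff m f = 0) :
    ∃ g, AnalyticAt ℂ g 0 ∧ ∀ᶠ z in 𝓝 0, f z = z ^ n * g z := by
  have horder : (n : ℕ∞) ≤ analyticOrderAt f 0 :=
    (natCast_le_analyticOrderAt_iff_iteratedDeriv_eq_zero hf).mpr fun i hi =>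
      (div_eq_zero_iff.mp (h i hi)).resolve_right (Nat.cast_ne_zero.mpr (Nat.factorial_ne_zero i))
  simpa using (natCast_le_analyticOrderAt hf).mp horder

/-- Analyticity of a function `F(x, z)` of two complex variables at `(x, z)`. -/
def JointAnalyticAt (F : ℂ → ℂ → ℂ) (x z : ℂ) : Prop :=
  AnalyticAt ℂ (fun p : ℂ × ℂ => F p.1 p.2) (x, z)

/-- The partial derivative `∂F/∂x` of `F(x, z)`. -/
def derivFst (F : ℂ → ℂ → ℂ) (x z : ℂ) : ℂ := deriv (fun y => F y z) x

/-- The partial derivative `∂F/∂z` of `F(x, z)`. -/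
def derivSnd (F : ℂ → ℂ → ℂ) (x z : ℂ) : ℂ := deriv (F x) z

theorem iteratedDeriv_eq_derivSnd (F : ℂ → ℂ → ℂ) (n : ℕ) (x z : ℂ) :
    iteratedDeriv n (F x) z = (derivSnd^[n] F) x z := by
  induction n generalizing z with
  | zero => simp
  | succ n ih =>
    rw [iteratedDeriv_succ, Function.iterate_succ_apply', derivSnd]
    exact congrArg (deriv · z) (funext ih)

theorem iteratedDeriv_eq_derivFst (F : ℂ → ℂ → ℂ) (n : ℕ) (x z : ℂ) :
    iteratedDeriv n (fun y => F y z) x = (derivFst^[n] F) x z := by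
  induction n generalizing x with
  | zero => simp
  | succ n ih =>
    rw [iteratedDeriv_succ, Function.iterate_succ_apply', derivFst]
    exact congrArg (deriv · x) (funext ih)

namespace JointAnalyticAt

variable {F G : ℂ → ℂ → ℂ} {x z : ℂ}

theorem eventually (hF : JointAnalyticAt F x z) :
    ∀ᶠ p : ℂ × ℂ in 𝓝 (x, z), JointAnalyticAt F p.1 p.2 :=
  AnalyticAt.eventually_analyticAt hF

theorem analyticAt_right (hF : JointAnalyticAt F x z) : AnalyticAt ℂ (F x) z :=
  AnalyticAt.comp_of_eq (g := fun p : ℂ × ℂ => F p.1 p.2) (f := fun w : ℂ => (x, w)) hF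
    (by fun_prop) rfl

theorem analyticAt_left (hF : JointAnalyticAt F x z) : AnalyticAt ℂ (fun y => F y z) x :=
  AnalyticAt.comp_of_eq (g := fun p : ℂ × ℂ => F p.1 p.2) (f := fun y : ℂ => (y, z)) hF
    (by fun_prop) rfl

theorem of_left {f : ℂ → ℂ} (hf : AnalyticAt ℂ f x) : JointAnalyticAt (fun x _ => f x) x z :=
  AnalyticAt.comp_of_eq (g := f) (f := fun p : ℂ × ℂ => p.1) hf analyticAt_fst rfl

theorem of_right {f : ℂ → ℂ} (hf : AnalyticAt ℂ f z) : JointAnalyticAt (fun _ z => f z) x z :=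
  AnalyticAt.comp_of_eq (g := f) (f := fun p : ℂ × ℂ => p.2) hf analyticAt_snd rfl

theorem add (hF : JointAnalyticAt F x z) (hG : JointAnalyticAt G x z) :
    JointAnalyticAt (fun x z => F x z + G x z) x z :=
  AnalyticAt.add hF hG

theorem sub (hF : JointAnalyticAt F x z) (hG : JointAnalyticAt G x z) :
    JointAnalyticAt (fun x z => F x z - G x z) x z :=
  AnalyticAt.sub hF hG

theorem mul (hF : JointAnalyticAt F x z) (hG : JointAnalyticAt G x z) :
    JointAnalyticAt (fun x z => F x z * G x z) x z :=
  AnalyticAt.mul hF hG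

theorem derivFst_eq_fderiv (hF : JointAnalyticAt F x z) :
    derivFst F x z = fderiv ℂ (fun p : ℂ × ℂ => F p.1 p.2) (x, z) (1, 0) :=
  ((AnalyticAt.differentiableAt hF).hasFDerivAt.comp_hasDerivAt (f := fun y => (y, z)) x
    ((hasDerivAt_id x).prodMk (hasDerivAt_const x z))).deriv

theorem derivSnd_eq_fderiv (hF : JointAnalyticAt F x z) :
    derivSnd F x z = fderiv ℂ (fun p : ℂ × ℂ => F p.1 p.2) (x, z) (0, 1) :=
  ((AnalyticAt.differentiableAt hF).hasFDerivAt.comp_hasDerivAt (f := fun w => (x, w)) z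
    ((hasDerivAt_const z x).prodMk (hasDerivAt_id z))).deriv

theorem eventuallyEq_derivFst (hF : JointAnalyticAt F x z) :
    (fun q => fderiv ℂ (fun p : ℂ × ℂ => F p.1 p.2) q (1, 0)) =ᶠ[𝓝 (x, z)]
      fun p => derivFst F p.1 p.2 :=
  hF.eventually.mono fun _ hp => hp.derivFst_eq_fderiv.symm

theorem eventuallyEq_derivSnd (hF : JointAnalyticAt F x z) :
    (fun q => fderiv ℂ (fun p : ℂ × ℂ => F p.1 p.2) q (0, 1)) =ᶠ[𝓝 (x, z)]
      fun p => derivSnd F p.1 p.2 :=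
  hF.eventually.mono fun _ hp => hp.derivSnd_eq_fderiv.symm

theorem analyticAt_fderiv_apply (hF : JointAnalyticAt F x z) (v : ℂ × ℂ) :
    AnalyticAt ℂ (fun q => fderiv ℂ (fun p : ℂ × ℂ => F p.1 p.2) q v) (x, z) :=
  ((ContinuousLinearMap.apply ℂ ℂ v).analyticAt _).comp (AnalyticAt.fderiv hF)

protected theorem derivFst (hF : JointAnalyticAt F x z) : JointAnalyticAt (derivFst F) x z :=
  (hF.analyticAt_fderiv_apply (1, 0)).congr hF.eventuallyEq_derivFst

protected theorem derivSnd (hF : JointAnalyticAt F x z) : JointAnalyticAt (derivSnd F) x z :=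
  (hF.analyticAt_fderiv_apply (0, 1)).congr hF.eventuallyEq_derivSnd

theorem derivFst_iterate (hF : JointAnalyticAt F x z) (n : ℕ) :
    JointAnalyticAt (derivFst^[n] F) x z := by
  induction n with
  | zero => exact hF
  | succ n ih =>
    rw [Function.iterate_succ_apply']
    exact ih.derivFst

theorem derivSnd_iterate (hF : JointAnalyticAt F x z) (n : ℕ) :
    JointAnalyticAt (derivSnd^[n] F) x z := by
  induction n with
  | zero => exact hF
  | succ n ih =>
    rw [Function.iterate_succ_apply']
    exact ih.derivSnd

theorem derivFst_derivSnd (hF : JointAnalyticAt F x z) :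
    derivFst (derivSnd F) x z = derivSnd (derivFst F) x z := by
  set f := fun p : ℂ × ℂ => F p.1 p.2
  have hasFDerivAt_fderiv : HasFDerivAt (fderiv ℂ f) (fderiv ℂ (fderiv ℂ f) (x, z)) (x, z) :=
    (AnalyticAt.fderiv hF).differentiableAt.hasFDerivAt
  have fderiv_apply (v w : ℂ × ℂ) : fderiv ℂ (fun q => fderiv ℂ f q v) (x, z) w =
      fderiv ℂ (fderiv ℂ f) (x, z) w v := by
    rw [(hasFDerivAt_fderiv.clm_apply (hasFDerivAt_const v (x, z))).fderiv]
    simp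
  rw [hF.derivSnd.derivFst_eq_fderiv, hF.derivFst.derivSnd_eq_fderiv,
    ← hF.eventuallyEq_derivSnd.fderiv_eq, ← hF.eventuallyEq_derivFst.fderiv_eq, fderiv_apply,
    fderiv_apply]
  exact (ContDiffAt.isSymmSndFDerivAt (n := 2) (AnalyticAt.contDiffAt hF) (by simp)).eq _ _

theorem derivFst_derivSnd_iterate (hF : JointAnalyticAt F x z) (n : ℕ) :
    derivFst (derivSnd^[n] F) x z = (derivSnd^[n] (derivFst F)) x z := by
  induction n generalizing z with
  | zero => rfl
  | succ n ih =>
    rw [Function.iterate_succ_apply', Function.iterate_succ_apply',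
      (hF.derivSnd_iterate n).derivFst_derivSnd]
    exact EventuallyEq.deriv_eq (hF.eventually.curry_nhds.self_of_nhds.mono fun _ hw => ih hw)

theorem hasDerivAt_taylorCoeff (hF : JointAnalyticAt F x 0) (n : ℕ) :
    HasDerivAt (fun y => taylorCoeff n (F y)) (taylorCoeff n (derivFst F x)) x := by
  have h : HasDerivAt (fun y => (derivSnd^[n] F) y 0) ((derivSnd^[n] (derivFst F)) x 0) x := by
    rw [← hF.derivFst_derivSnd_iterate n]
    exact (hF.derivSnd_iterate n).analyticAt_left.differentiableAt.hasDerivAt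
  simp only [← iteratedDeriv_eq_derivSnd] at h
  exact h.div_const _

end JointAnalyticAt

end Lame

/-! ### Operators with an analytic symbol -/

namespace HolFun

variable {U : Opens ℂ}

theorem ofFun_apply {g : ℂ → ℂ} (hg : DifferentiableOn ℂ g U) (x : U) : (ofFun U g).1 x = g x := by
  rw [ofFun, dif_pos hg]

theorem deriv_ofFun_apply {g : ℂ → ℂ} (hg : DifferentiableOn ℂ g U) (x : U) :
    (Differential.deriv (ofFun U g)).1 x = deriv g x := by
  refine EventuallyEq.deriv_eq ?_
  filter_upwards [U.isOpen.mem_nhds x.2] with y hy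
  exact (ext0_coe _ ⟨y, hy⟩).trans (ofFun_apply hg ⟨y, hy⟩)

theorem ext {f g : HolFun U} (h : ∀ x : U, f.1 x = g.1 x) : f = g := Subtype.ext (funext h)

end HolFun

namespace Lame

/-- Functions `F(x, z)` that are jointly analytic at all `(x, 0)` with `x ∈ U`: the symbols, with
`z = 1 / λ` standing for `∂⁻¹`, of the operators `opOfSymbol U F` of order `≤ 0`. -/
def IsAnalyticSymbol (U : Opens ℂ) (F : ℂ → ℂ → ℂ) : Prop := ∀ x ∈ U, JointAnalyticAt F x 0

/-- The operator `∑ₙ cₙ(x) ∂⁻ⁿ` with symbol `F(x, z) = ∑ₙ cₙ(x) zⁿ`. -/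
def opOfSymbol (U : Opens ℂ) (F : ℂ → ℂ → ℂ) : PseudoDiffOp (HolFun U) where
  coeff m := if m ≤ 0 then HolFun.ofFun U fun x => taylorCoeff (-m).toNat (F x) else 0
  bdd := ⟨0, fun _ hn => if_neg (by omega)⟩

/-- The symbol `z ∂F/∂x + F = e^{-x/z} z ∂(e^{x/z} F)/∂x` of `∂ W ∂⁻¹`, where `W` has symbol `F`. -/
def conjSymbol (F : ℂ → ℂ → ℂ) (x z : ℂ) : ℂ := z * derivFst F x z + F x z

protected theorem JointAnalyticAt.conjSymbol {F : ℂ → ℂ → ℂ} {x z : ℂ}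
    (hF : JointAnalyticAt F x z) : JointAnalyticAt (conjSymbol F) x z :=
  ((JointAnalyticAt.of_right analyticAt_id).mul hF.derivFst).add hF

theorem JointAnalyticAt.conjSymbol_iterate {F : ℂ → ℂ → ℂ} {x z : ℂ} (hF : JointAnalyticAt F x z)
    (n : ℕ) : JointAnalyticAt (conjSymbol^[n] F) x z := by
  induction n with
  | zero => exact hF
  | succ n ih =>
    rw [Function.iterate_succ_apply']
    exact ih.conjSymbol

namespace IsAnalyticSymbol

variable {U : Opens ℂ} {F G : ℂ → ℂ → ℂ}

theorem differentiableOn_taylorCoeff (hF : IsAnalyticSymbol U F) (n : ℕ) :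
    DifferentiableOn ℂ (fun x => taylorCoeff n (F x)) U := fun x hx =>
  ((hF x hx).hasDerivAt_taylorCoeff n).differentiableAt.differentiableWithinAt

theorem of_right {q : ℂ → ℂ} (hq : AnalyticAt ℂ q 0) : IsAnalyticSymbol U fun _ z => q z :=
  fun _ _ => JointAnalyticAt.of_right hq

theorem add (hF : IsAnalyticSymbol U F) (hG : IsAnalyticSymbol U G) :
    IsAnalyticSymbol U fun x z => F x z + G x z := fun x hx => (hF x hx).add (hG x hx)

theorem sub (hF : IsAnalyticSymbol U F) (hG : IsAnalyticSymbol U G) :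
    IsAnalyticSymbol U fun x z => F x z - G x z := fun x hx => (hF x hx).sub (hG x hx)

theorem mul (hF : IsAnalyticSymbol U F) (hG : IsAnalyticSymbol U G) :
    IsAnalyticSymbol U fun x z => F x z * G x z := fun x hx => (hF x hx).mul (hG x hx)

theorem sum {ι : Type*} {s : Finset ι} {F : ι → ℂ → ℂ → ℂ}
    (hF : ∀ i ∈ s, IsAnalyticSymbol U (F i)) :
    IsAnalyticSymbol U fun x z => ∑ i ∈ s, F i x z :=
  fun x hx => Finset.analyticAt_fun_sum s fun i hi => hF i hi x hx

theorem ext0_mul (b : HolFun U) (hF : IsAnalyticSymbol U F) :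
    IsAnalyticSymbol U fun x z => HolFun.ext0 b.1 x * F x z := fun x hx =>
  (JointAnalyticAt.of_left ((HolFun.differentiableOn_ext0 b).analyticAt
    (U.isOpen.mem_nhds hx))).mul (hF x hx)

theorem pow_mul (hF : IsAnalyticSymbol U F) (m : ℕ) : IsAnalyticSymbol U fun x z => z ^ m * F x z :=
  (of_right (analyticAt_id.pow m)).mul hF

protected theorem conjSymbol (hF : IsAnalyticSymbol U F) : IsAnalyticSymbol U (conjSymbol F) :=
  fun x hx => (hF x hx).conjSymbol

theorem conjSymbol_iterate (hF : IsAnalyticSymbol U F) (i : ℕ) :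
    IsAnalyticSymbol U (conjSymbol^[i] F) := fun x hx => (hF x hx).conjSymbol_iterate i

end IsAnalyticSymbol

section OpOfSymbol

variable {U : Opens ℂ} {F G : ℂ → ℂ → ℂ}

theorem orderLE_opOfSymbol (F : ℂ → ℂ → ℂ) : (opOfSymbol U F).OrderLE 0 := fun _ hm =>
  if_neg hm.not_ge

theorem opOfSymbol_coeff_neg (F : ℂ → ℂ → ℂ) (n : ℕ) :
    (opOfSymbol U F).coeff (-n) = HolFun.ofFun U fun x => taylorCoeff n (F x) := by
  simp [opOfSymbol]

theorem opOfSymbol_coeff_neg_apply (hF : IsAnalyticSymbol U F) (n : ℕ) (x : U) :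
    ((opOfSymbol U F).coeff (-n)).1 x = taylorCoeff n (F x) := by
  rw [opOfSymbol_coeff_neg, HolFun.ofFun_apply (hF.differentiableOn_taylorCoeff n)]

theorem deriv_opOfSymbol_coeff_neg_apply (hF : IsAnalyticSymbol U F) (n : ℕ) (x : U) :
    (Differential.deriv ((opOfSymbol U F).coeff (-n))).1 x = taylorCoeff n (derivFst F x) := by
  rw [opOfSymbol_coeff_neg, HolFun.deriv_ofFun_apply (hF.differentiableOn_taylorCoeff n)]
  exact ((hF x x.2).hasDerivAt_taylorCoeff n).deriv

theorem eq_opOfSymbol (hF : IsAnalyticSymbol U F) {P : PseudoDiffOp (HolFun U)} (hP : P.OrderLE 0)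
    (h : ∀ (n : ℕ) (x : U), (P.coeff (-n)).1 x = taylorCoeff n (F x)) : P = opOfSymbol U F := by
  ext1
  funext m
  rcases lt_or_ge 0 m with hm | hm
  · rw [hP m hm, orderLE_opOfSymbol F m hm]
  · obtain ⟨n, rfl⟩ := Int.exists_eq_neg_ofNat hm
    exact HolFun.ext fun x => by rw [h, opOfSymbol_coeff_neg_apply hF]

theorem opOfSymbol_eq_zero (hF : IsAnalyticSymbol U F) (h : ∀ x ∈ U, ∀ᶠ z in 𝓝 0, F x z = 0) :
    opOfSymbol U F = 0 :=
  (eq_opOfSymbol hF (fun _ _ => rfl) fun n x => by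
    rw [taylorCoeff_congr (h x x.2), taylorCoeff_const_zero]
    rfl).symm

theorem opOfSymbol_add (hF : IsAnalyticSymbol U F) (hG : IsAnalyticSymbol U G) :
    opOfSymbol U (fun x z => F x z + G x z) = opOfSymbol U F + opOfSymbol U G := by
  refine (eq_opOfSymbol (hF.add hG) ((orderLE_opOfSymbol F).add (orderLE_opOfSymbol G))
    fun n x => ?_).symm
  rw [taylorCoeff_add (hF x x.2).analyticAt_right (hG x x.2).analyticAt_right,
    ← opOfSymbol_coeff_neg_apply hF, ← opOfSymbol_coeff_neg_apply hG]
  rfl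

theorem opOfSymbol_sub (hF : IsAnalyticSymbol U F) (hG : IsAnalyticSymbol U G) :
    opOfSymbol U (fun x z => F x z - G x z) = opOfSymbol U F - opOfSymbol U G := by
  refine (eq_opOfSymbol (hF.sub hG) ((orderLE_opOfSymbol F).sub (orderLE_opOfSymbol G))
    fun n x => ?_).symm
  rw [taylorCoeff_sub (hF x x.2).analyticAt_right (hG x x.2).analyticAt_right,
    ← opOfSymbol_coeff_neg_apply hF, ← opOfSymbol_coeff_neg_apply hG]
  rfl

theorem opOfSymbol_sum {ι : Type*} (s : Finset ι) {F : ι → ℂ → ℂ → ℂ}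
    (hF : ∀ i ∈ s, IsAnalyticSymbol U (F i)) :
    opOfSymbol U (fun x z => ∑ i ∈ s, F i x z) = ∑ i ∈ s, opOfSymbol U (F i) := by
  classical
  induction s using Finset.induction_on with
  | empty =>
    simp only [sum_empty]
    exact opOfSymbol_eq_zero (fun x _ => analyticAt_const) fun x _ => .of_forall fun _ => rfl
  | insert i s hi ih =>
    have hs : ∀ j ∈ s, IsAnalyticSymbol U (F j) := fun j hj => hF j (mem_insert_of_mem hj)
    simp only [sum_insert hi]
    rw [opOfSymbol_add (hF i (mem_insert_self i s)) (.sum hs), ih hs]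

theorem opOfSymbol_ext0_mul (b : HolFun U) (hF : IsAnalyticSymbol U F) :
    opOfSymbol U (fun x z => HolFun.ext0 b.1 x * F x z) =
      PseudoDiffOp.const b * opOfSymbol U F := by
  refine (eq_opOfSymbol (hF.ext0_mul b) (fun m hm => ?_) fun n x => ?_).symm
  · rw [PseudoDiffOp.const_mul_coeff, orderLE_opOfSymbol _ m hm, mul_zero]
  · rw [PseudoDiffOp.const_mul_coeff, taylorCoeff_const_mul, ← opOfSymbol_coeff_neg_apply hF,
      HolFun.ext0_coe]
    rfl

theorem opOfSymbol_pow_mul (hF : IsAnalyticSymbol U F) (m : ℕ) :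
    opOfSymbol U (fun x z => z ^ m * F x z) = opOfSymbol U F * PseudoDiffOp.D (-m) := by
  refine (eq_opOfSymbol (hF.pow_mul m) (fun k hk => ?_) fun n x => ?_).symm
  · rw [PseudoDiffOp.mul_D_coeff, orderLE_opOfSymbol _ _ (by omega)]
  · rw [PseudoDiffOp.mul_D_coeff, taylorCoeff_pow_mul (hF x x.2).analyticAt_right]
    split_ifs with h
    · rw [orderLE_opOfSymbol _ _ (by omega)]
      rfl
    · rw [← opOfSymbol_coeff_neg_apply hF, show (-n - -m : ℤ) = -(n - m : ℕ) by omega]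

theorem isConst_opOfSymbol {q : ℂ → ℂ} (hq : AnalyticAt ℂ q 0) :
    (opOfSymbol U fun _ z => q z).IsConst := by
  intro m
  rcases lt_or_ge 0 m with hm | hm
  · rw [orderLE_opOfSymbol _ m hm, map_zero]
  · obtain ⟨n, rfl⟩ := Int.exists_eq_neg_ofNat hm
    refine HolFun.ext fun x => ?_
    rw [deriv_opOfSymbol_coeff_neg_apply (.of_right hq),
      show derivFst (fun _ => q) x = fun _ => 0 from funext fun z => deriv_const (x : ℂ) (q z),
      taylorCoeff_const_zero]
    rfl

theorem opOfSymbol_mul_right {q : ℂ → ℂ} (hF : IsAnalyticSymbol U F) (hq : AnalyticAt ℂ q 0) :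
    opOfSymbol U (fun x z => F x z * q z) = opOfSymbol U F * opOfSymbol U fun _ z => q z := by
  have hq' : IsAnalyticSymbol U fun _ z => q z := .of_right hq
  refine (eq_opOfSymbol (hF.mul hq') ((orderLE_opOfSymbol F).mul (orderLE_opOfSymbol _))
    fun n x => ?_).symm
  rw [(isConst_opOfSymbol hq).mul_coeff_neg (orderLE_opOfSymbol F) (orderLE_opOfSymbol _),
    taylorCoeff_mul (hF x x.2).analyticAt_right hq, ← HolFun.evalHom_apply, map_sum]
  refine sum_congr rfl fun ij _ => ?_
  rw [map_mul, HolFun.evalHom_apply, HolFun.evalHom_apply, opOfSymbol_coeff_neg_apply hF,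
    opOfSymbol_coeff_neg_apply hq']

theorem taylorCoeff_conjSymbol {x : ℂ} (hF : JointAnalyticAt F x 0) (n : ℕ) :
    taylorCoeff n (conjSymbol F x) =
      (if n < 1 then 0 else taylorCoeff (n - 1) (derivFst F x)) + taylorCoeff n (F x) := by
  have hF' := hF.derivFst.analyticAt_right
  rw [← taylorCoeff_pow_mul hF', ← taylorCoeff_add (by fun_prop) hF.analyticAt_right]
  simp only [pow_one]
  rfl

theorem D_one_mul_opOfSymbol (hF : IsAnalyticSymbol U F) :
    PseudoDiffOp.D 1 * opOfSymbol U F = opOfSymbol U (conjSymbol F) * PseudoDiffOp.D 1 := by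
  ext1
  funext k
  rw [PseudoDiffOp.D_one_mul_coeff, PseudoDiffOp.mul_D_coeff]
  rcases lt_or_ge 1 k with hk | hk
  · rw [orderLE_opOfSymbol _ _ (by omega), orderLE_opOfSymbol _ _ (by omega),
      orderLE_opOfSymbol _ _ (by omega), map_zero, add_zero]
  obtain ⟨n, rfl⟩ : ∃ n : ℕ, k = 1 - n := ⟨(1 - k).toNat, by omega⟩
  refine HolFun.ext fun x => ?_
  rw [sub_sub_cancel_left, opOfSymbol_coeff_neg_apply hF.conjSymbol,
    taylorCoeff_conjSymbol (hF x x.2), add_comm, ← HolFun.evalHom_apply,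
    map_add, HolFun.evalHom_apply, HolFun.evalHom_apply, opOfSymbol_coeff_neg_apply hF]
  rcases n with _ | n
  · rw [orderLE_opOfSymbol _ _ (by simp), map_zero]
    simp
  · rw [show (1 - (n + 1 : ℕ) : ℤ) = -n by push_cast; ring, deriv_opOfSymbol_coeff_neg_apply hF]
    simp

theorem D_mul_opOfSymbol (hF : IsAnalyticSymbol U F) (i : ℕ) :
    PseudoDiffOp.D i * opOfSymbol U F = opOfSymbol U (conjSymbol^[i] F) * PseudoDiffOp.D i := by
  induction i with
  | zero => rw [Nat.cast_zero, ← PseudoDiffOp.one_eq_D, one_mul, mul_one]; rfl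
  | succ i ih =>
    rw [← PseudoDiffOp.D_one_pow, pow_succ', mul_assoc, PseudoDiffOp.D_one_pow, ih, ← mul_assoc,
      D_one_mul_opOfSymbol (hF.conjSymbol_iterate i), mul_assoc, Function.iterate_succ_apply']

/-- The symbol of `(B W - W (∂ⁿ + Q)) ∂⁻ⁿ`, where `B = ∑_{i ≤ n} bᵢ ∂ⁱ`, `W` has symbol `F`, and `Q`
has symbol `q`. -/
def defectSymbol (b : ℕ → ℂ → ℂ) (F : ℂ → ℂ → ℂ) (q : ℂ → ℂ) (n : ℕ) (x z : ℂ) : ℂ :=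
  (∑ i ∈ range (n + 1), b i x * (z ^ (n - i) * (conjSymbol^[i] F) x z)) -
    (F x z + z ^ n * (F x z * q z))

section Defect

variable {q : ℂ → ℂ}

theorem IsAnalyticSymbol.defectSymbol_summand (b : HolFun U) (hF : IsAnalyticSymbol U F) (m i : ℕ) :
    IsAnalyticSymbol U fun x z => HolFun.ext0 b.1 x * (z ^ m * (conjSymbol^[i] F) x z) :=
  ((hF.conjSymbol_iterate i).pow_mul m).ext0_mul b

theorem IsAnalyticSymbol.defectSymbol (b : ℕ → HolFun U) (hF : IsAnalyticSymbol U F)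
    (hq : AnalyticAt ℂ q 0) (n : ℕ) :
    IsAnalyticSymbol U (defectSymbol (fun i => HolFun.ext0 (b i).1) F q n) :=
  (IsAnalyticSymbol.sum fun _ _ => hF.defectSymbol_summand _ _ _).sub
    (hF.add ((hF.mul (.of_right hq)).pow_mul n))

theorem opOfSymbol_defectSymbol (b : ℕ → HolFun U) (hF : IsAnalyticSymbol U F)
    (hq : AnalyticAt ℂ q 0) (n : ℕ) :
    opOfSymbol U (defectSymbol (fun i => HolFun.ext0 (b i).1) F q n) =
      ∑ i ∈ range (n + 1), PseudoDiffOp.const (b i) *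
        (opOfSymbol U (conjSymbol^[i] F) * PseudoDiffOp.D (-(n - i : ℕ))) -
      (opOfSymbol U F + opOfSymbol U F * (opOfSymbol U fun _ z => q z) * PseudoDiffOp.D (-n)) := by
  have hFq := hF.mul (.of_right hq)
  have hT (i : ℕ) (_ : i ∈ range (n + 1)) := hF.defectSymbol_summand (b i) (n - i) i
  refine (opOfSymbol_sub (.sum hT) (hF.add (hFq.pow_mul n))).trans ?_
  rw [opOfSymbol_sum _ hT, opOfSymbol_add hF (hFq.pow_mul n), opOfSymbol_pow_mul hFq,
    opOfSymbol_mul_right hF hq]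
  congr 1
  refine sum_congr rfl fun i _ => ?_
  rw [opOfSymbol_ext0_mul _ ((hF.conjSymbol_iterate i).pow_mul _),
    opOfSymbol_pow_mul (hF.conjSymbol_iterate i)]

theorem nonneg_mul_opOfSymbol_sub {B : PseudoDiffOp (HolFun U)} {n : ℕ} (hB : B.OrderLE n)
    (hF : IsAnalyticSymbol U F) (hq : AnalyticAt ℂ q 0) :
    B.nonneg * opOfSymbol U F -
        opOfSymbol U F * (PseudoDiffOp.D n + opOfSymbol U fun _ z => q z) =
      opOfSymbol U (defectSymbol (fun i => HolFun.ext0 (B.coeff i).1) F q n) *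
        PseudoDiffOp.D n := by
  have hD : (PseudoDiffOp.D (-n) * PseudoDiffOp.D n : PseudoDiffOp (HolFun U)) = 1 := by
    rw [PseudoDiffOp.D_mul_D, neg_add_cancel, PseudoDiffOp.one_eq_D]
  rw [opOfSymbol_defectSymbol (fun i => B.coeff i) hF hq, PseudoDiffOp.nonneg_eq_sum hB, sub_mul,
    sum_mul, sum_mul, add_mul, mul_add, mul_assoc _ _ (PseudoDiffOp.D n), hD, mul_one]
  congr 1
  refine sum_congr rfl fun i hi => ?_
  have hi : i ≤ n := Nat.lt_succ_iff.mp (mem_range.mp hi)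
  rw [mul_assoc, D_mul_opOfSymbol hF, mul_assoc, mul_assoc, PseudoDiffOp.D_mul_D,
    show -((n - i : ℕ) : ℤ) + n = i by omega]

end Defect

end OpOfSymbol

end Lame

/-! ### Expansions of the Lamé function and of the time coefficients -/

namespace Lame

theorem hasSum_taylorCoeff {f : ℂ → ℂ} {r : ℝ} (hf : DifferentiableOn ℂ f (Metric.ball 0 r)) {z : ℂ}
    (hz : ‖z‖ < r) : HasSum (fun n => taylorCoeff n f * z ^ n) (f z) := by
  refine (Complex.hasSum_taylorSeries_on_ball hf (mem_ball_zero_iff.mpr hz)).congr_fun fun n => ?_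
  rw [taylorCoeff, sub_zero, smul_eq_mul, smul_eq_mul, div_eq_inv_mul]
  ring

theorem taylorCoeff_iteratedDeriv (f : ℂ → ℂ) (i j : ℕ) :
    taylorCoeff i (iteratedDeriv j f) = (i + j)! / i ! * taylorCoeff (i + j) f := by
  have hfactorial : ((i + j)! : ℂ) ≠ 0 := Nat.cast_ne_zero.mpr (Nat.factorial_ne_zero _)
  simp only [taylorCoeff, iteratedDeriv_eq_iterate, ← Function.iterate_add_apply]
  field_simp

theorem analyticAt_iteratedDeriv {f : ℂ → ℂ} {z : ℂ} (hf : AnalyticAt ℂ f z) (n : ℕ) :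
    AnalyticAt ℂ (iteratedDeriv n f) z := by
  rw [iteratedDeriv_eq_iterate]
  exact hf.iterated_deriv n

theorem iteratedDeriv_one_div_sq (n : ℕ) (z : ℂ) :
    iteratedDeriv n (fun u => 1 / u ^ 2) z = (-1) ^ n * (n + 1)! / z ^ (n + 2) := by
  have hderiv : (fun u : ℂ => 1 / u ^ 2) = -deriv Inv.inv := by
    funext u
    simp
  rw [hderiv, iteratedDeriv_neg, ← iteratedDeriv_succ', iteratedDeriv_eq_iterate, iter_deriv_inv,
    show (-1 - (n + 1 : ℕ) : ℤ) = -(n + 2 : ℕ) by push_cast; ring, zpow_neg, zpow_natCast, pow_succ]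
  ring

theorem pow_mul_iteratedDeriv_mul_exp {U : Opens ℂ} {F : ℂ → ℂ → ℂ} {z : ℂ} (hz : z ≠ 0)
    (hF : ∀ x ∈ U, JointAnalyticAt F x z) (i : ℕ) {x : ℂ} (hx : x ∈ U) :
    z ^ i * iteratedDeriv i (fun y => F y z * Complex.exp (y / z)) x =
      (conjSymbol^[i] F) x z * Complex.exp (x / z) := by
  induction i generalizing F with
  | zero => simp
  | succ i ih =>
    have hderiv : deriv (fun y => F y z * Complex.exp (y / z)) =ᶠ[𝓝 x]
        fun y => z⁻¹ * (conjSymbol F y z * Complex.exp (y / z)) := by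
      filter_upwards [U.isOpen.mem_nhds hx] with y hy
      have hFy : HasDerivAt (fun y => F y z) (derivFst F y z) y :=
        (hF y hy).analyticAt_left.differentiableAt.hasDerivAt
      have hexp : HasDerivAt (fun y => Complex.exp (y / z)) (Complex.exp (y / z) * (1 / z)) y :=
        ((hasDerivAt_id y).div_const z).cexp
      rw [(hFy.fun_mul hexp).deriv, conjSymbol]
      field_simp
    rw [iteratedDeriv_succ', hderiv.iteratedDeriv_eq, iteratedDeriv_const_mul_field, pow_succ,
      mul_assoc, mul_inv_cancel_left₀ hz, ih fun x hx => (hF x hx).conjSymbol,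
      Function.iterate_succ_apply]

variable (L : PeriodPair)

section LameSymbol

theorem analyticAt_sigma (z : ℂ) : AnalyticAt ℂ L.sigma z := (differentiable_sigma L).analyticAt z

theorem sigmaProd_neg (z : ℂ) : sigmaProd L (-z) = sigmaProd L z := by
  rw [sigmaProd, sigmaProd, ← (Equiv.subtypeEquiv (Equiv.neg L.lattice) fun l => by
    simp : {l : L.lattice // l ≠ 0} ≃ {l : L.lattice // l ≠ 0}).tprod_eq]
  refine tprod_congr fun l => ?_
  simp

theorem sigma_neg (z : ℂ) : L.sigma (-z) = -L.sigma z := by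
  rw [sigma_eq_mul_sigmaProd, sigma_eq_mul_sigmaProd, sigmaProd_neg, neg_mul]

theorem zeta_neg (z : ℂ) : L.zeta (-z) = -L.zeta z := by
  have hderiv : deriv L.sigma (-z) = deriv L.sigma z := by
    have := congrArg (fun f => deriv f z) (funext (sigma_neg L))
    simpa only [deriv_comp_neg, deriv.fun_neg, neg_inj] using this
  rw [PeriodPair.zeta, PeriodPair.zeta, hderiv, sigma_neg, div_neg]

theorem analyticAt_zetaExcept {z : ℂ} (hz : z ∉ (L.lattice \ {0} : Set ℂ)) :
    AnalyticAt ℂ (zetaExcept L) z :=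
  (differentiableOn_zetaExcept L).analyticAt (L.isOpen_compl_lattice_sdiff.mem_nhds hz)

theorem analyticAt_zeta {z : ℂ} (hz : z ∉ L.lattice) : AnalyticAt ℂ L.zeta z :=
  DifferentiableOn.analyticAt
    (fun _ hw => (hasDerivAt_zeta L hw).differentiableAt.differentiableWithinAt)
    ((isOpen_compl_lattice L).mem_nhds hz)

theorem analyticAt_sigma_div_mul_exp {a b : ℂ × ℂ → ℂ} {p : ℂ × ℂ} (ha : AnalyticAt ℂ a p)
    (hb : AnalyticAt ℂ b p) (hp : p.1 ∉ L.lattice) :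
    AnalyticAt ℂ (fun q => L.sigma (a q) / L.sigma q.1 * Complex.exp (b q)) p := by
  have hnum : AnalyticAt ℂ (fun q => L.sigma (a q)) p :=
    (analyticAt_sigma L (a p)).comp_of_eq ha rfl
  have hden : AnalyticAt ℂ (fun q : ℂ × ℂ => L.sigma q.1) p :=
    (analyticAt_sigma L p.1).comp_of_eq analyticAt_fst rfl
  exact (hnum.div hden (sigma_ne_zero L hp)).mul hb.cexp

theorem jointAnalyticAt_lamePhi {x k : ℂ} (hx : x ∉ L.lattice) (hk : k ∉ L.lattice) :
    JointAnalyticAt L.lamePhi x k := by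
  have hzeta : AnalyticAt ℂ (fun p : ℂ × ℂ => L.zeta p.2) (x, k) :=
    (analyticAt_zeta L hk).comp_of_eq analyticAt_snd rfl
  exact analyticAt_sigma_div_mul_exp L (analyticAt_fst.add analyticAt_snd)
    (hzeta.neg.mul analyticAt_fst) hx

theorem jointAnalyticAt_vHat0 {x z : ℂ} (hx : x ∉ L.lattice) (hz : z ∉ (L.lattice \ {0} : Set ℂ)) :
    JointAnalyticAt L.vHat0 x z := by
  have hzeta : AnalyticAt ℂ (fun p : ℂ × ℂ => zetaExcept L p.2) (x, z) :=
    (analyticAt_zetaExcept L hz).comp_of_eq analyticAt_snd rfl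
  refine (analyticAt_sigma_div_mul_exp L (analyticAt_fst.sub analyticAt_snd)
    (hzeta.mul analyticAt_fst) hx).congr ?_
  have hnear : ∀ᶠ p : ℂ × ℂ in 𝓝 (x, z), p.2 ∉ (L.lattice \ {0} : Set ℂ) :=
    (continuous_snd.tendsto (x, z)).eventually (L.isOpen_compl_lattice_sdiff.mem_nhds hz)
  filter_upwards [hnear] with p hp
  simp only [PeriodPair.vHat0, zeta_sub_inv L hp, Pi.sub_apply, Pi.mul_apply]

theorem isAnalyticSymbol_vHat0 : IsAnalyticSymbol L.domain L.vHat0 := fun _ hx =>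
  jointAnalyticAt_vHat0 L hx fun h => h.2 rfl

theorem vHat0_zero {x : ℂ} (hx : x ∉ L.lattice) : L.vHat0 x 0 = 1 := by
  rw [PeriodPair.vHat0, zeta_sub_inv L fun h => h.2 rfl, zetaExcept]
  simp [sigma_ne_zero L hx, zetaTerm]

theorem lamePhi_neg (x z : ℂ) : L.lamePhi x (-z) = L.vHat0 x z * Complex.exp (x / z) := by
  rw [PeriodPair.lamePhi, PeriodPair.vHat0, mul_assoc, ← Complex.exp_add, zeta_neg, sub_eq_add_neg]
  congr 2
  ring

theorem isMonicOrderZero_opV0 : L.opV0.IsMonicOrderZero := PseudoDiffOp.isMonicOrderZero_monic _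

theorem opV0_eq_opOfSymbol : L.opV0 = opOfSymbol L.domain L.vHat0 := by
  refine eq_opOfSymbol (isAnalyticSymbol_vHat0 L) (isMonicOrderZero_opV0 L).orderLE fun n x => ?_
  rcases n with _ | n
  · rw [taylorCoeff_zero, vHat0_zero L x.2]
    simp [PeriodPair.opV0, PseudoDiffOp.monic]
  · have hcoeff : L.opV0.coeff (-(n + 1 : ℕ)) = HolFun.ofFun L.domain (L.v0 (n + 1)) := by
      simp only [PeriodPair.opV0, PseudoDiffOp.monic]
      rw [if_neg (by omega), if_pos (by omega), neg_neg, Int.toNat_natCast]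
    rw [hcoeff]
    exact HolFun.ofFun_apply ((isAnalyticSymbol_vHat0 L).differentiableOn_taylorCoeff (n + 1)) x

theorem pow_mul_iteratedDeriv_lamePhi {x z : ℂ} (hx : x ∉ L.lattice) (hz : z ∉ L.lattice) (i : ℕ) :
    z ^ i * iteratedDeriv i (fun y => L.lamePhi y (-z)) x =
      (conjSymbol^[i] L.vHat0) x z * Complex.exp (x / z) := by
  simp only [lamePhi_neg]
  exact pow_mul_iteratedDeriv_mul_exp (U := L.domain) (ne_of_mem_of_not_mem (zero_mem _) hz).symm
    (fun y hy => jointAnalyticAt_vHat0 L hy fun h => hz h.1) i hx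

end LameSymbol

section TimeCoefficients

theorem exists_norm_lt_iff_forall_lattice :
    ∃ R : ℝ, 0 < R ∧ ∀ z : ℂ, ‖z‖ < R ↔ ∀ l ∈ L.lattice, l ≠ 0 → ‖z‖ < ‖l‖ := by
  have hclosed : IsClosed (L.lattice \ {0} : Set ℂ) :=
    isOpen_compl_iff.mp L.isOpen_compl_lattice_sdiff
  have hnonempty : (L.lattice \ {0} : Set ℂ).Nonempty :=
    ⟨L.ω₁, L.ω₁_mem_lattice, fun h => L.ω₁_div_two_notMem_lattice (by
      rw [Set.mem_singleton_iff.mp h, zero_div]; exact zero_mem _)⟩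
  obtain ⟨l, hl, hmin⟩ := hclosed.exists_infDist_eq_dist hnonempty 0
  refine ⟨‖l‖, norm_pos_iff.mpr hl.2, fun z => ⟨fun hz m hm hm0 => hz.trans_le ?_,
    fun hz => hz l hl.1 hl.2⟩⟩
  simpa only [hmin, dist_zero_left] using
    Metric.infDist_le_dist_of_mem (x := (0 : ℂ)) (show m ∈ (L.lattice \ {0} : Set ℂ) from ⟨hm, hm0⟩)

/-- The smallest absolute value of a nonzero period, i.e. the radius of convergence in `z` of
`vHat0` and `omega`. -/
def minPeriod : ℝ := (exists_norm_lt_iff_forall_lattice L).choose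

theorem minPeriod_pos : 0 < minPeriod L := (exists_norm_lt_iff_forall_lattice L).choose_spec.1

theorem norm_lt_minPeriod_iff {z : ℂ} :
    ‖z‖ < minPeriod L ↔ ∀ l ∈ L.lattice, l ≠ 0 → ‖z‖ < ‖l‖ :=
  (exists_norm_lt_iff_forall_lattice L).choose_spec.2 z

theorem notMem_of_norm_lt_minPeriod {z : ℂ} (hz : ‖z‖ < minPeriod L) :
    z ∉ (L.lattice \ {0} : Set ℂ) :=
  fun h => lt_irrefl _ ((norm_lt_minPeriod_iff L).mp hz z h.1 h.2)

theorem analyticAt_weierstrassPExcept_zero {z : ℂ} (hz : z ∉ (L.lattice \ {0} : Set ℂ)) :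
    AnalyticAt ℂ (L.weierstrassPExcept 0) z :=
  (L.differentiableOn_weierstrassPExcept 0).analyticAt (L.isOpen_compl_lattice_sdiff.mem_nhds hz)

theorem differentiableOn_iteratedDeriv_weierstrassPExcept (j : ℕ) :
    DifferentiableOn ℂ (iteratedDeriv j (L.weierstrassPExcept 0)) (Metric.ball 0 (minPeriod L)) :=
  fun _ hz => (analyticAt_iteratedDeriv (analyticAt_weierstrassPExcept_zero L
    (notMem_of_norm_lt_minPeriod L (mem_ball_zero_iff.mp hz)))
      j).differentiableAt.differentiableWithinAt

theorem laurentCoeff_div_succ (j : ℕ) :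
    L.laurentCoeff j / (j + 1) = iteratedDeriv j (L.weierstrassPExcept 0) 0 / (j + 1)! := by
  rw [PeriodPair.laurentCoeff, Nat.factorial_succ, Nat.cast_mul, Nat.cast_succ, div_div, mul_comm]

theorem omega_eq {z : ℂ} (hz : ‖z‖ < minPeriod L) (j : ℕ) :
    L.omega j z = iteratedDeriv j (L.weierstrassPExcept 0) (-z) / (j + 1)! -
        L.laurentCoeff j / (j + 1) := by
  have hfactorial : ∀ n : ℕ, (n ! : ℂ) ≠ 0 := fun n =>
    Nat.cast_ne_zero.mpr (Nat.factorial_ne_zero n)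
  have hsum := (hasSum_nat_add_iff' 1).mpr (hasSum_taylorCoeff
    (differentiableOn_iteratedDeriv_weierstrassPExcept L j) (z := -z) (by rwa [norm_neg]))
  rw [laurentCoeff_div_succ, ← sub_div]
  have hquot := (hsum.div_const ((j + 1)! : ℂ)).tsum_eq
  rw [Finset.sum_range_one, taylorCoeff_zero, pow_zero, mul_one] at hquot
  rw [← hquot]
  refine tsum_congr fun i => ?_
  rw [taylorCoeff_iteratedDeriv, neg_pow z, taylorCoeff, PeriodPair.laurentCoeff]
  field_simp [hfactorial]

theorem omega_zero (j : ℕ) : L.omega j 0 = 0 := by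
  simp [PeriodPair.omega]

theorem analyticAt_omega (j : ℕ) {z : ℂ} (hz : ‖z‖ < minPeriod L) : AnalyticAt ℂ (L.omega j) z := by
  have hneg : AnalyticAt ℂ (fun z => iteratedDeriv j (L.weierstrassPExcept 0) (-z)) z :=
    (analyticAt_iteratedDeriv (analyticAt_weierstrassPExcept_zero L
      (notMem_of_norm_lt_minPeriod L (by rwa [norm_neg]))) j).comp_of_eq analyticAt_id.neg rfl
  refine ((hneg.div analyticAt_const (Nat.cast_ne_zero.mpr (Nat.factorial_ne_zero (j + 1)))).sub
    (analyticAt_const (v := L.laurentCoeff j / ((j : ℂ) + 1)))).congr ?_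
  filter_upwards [continuous_norm.tendsto z |>.eventually_lt_const hz] with w hw
  exact (omega_eq L hw j).symm

theorem timeCoeff_neg (j : ℕ) {z : ℂ} (hz0 : z ≠ 0) (hz : ‖z‖ < minPeriod L) :
    L.timeCoeff (-z) j = (z ^ (j + 2))⁻¹ + L.omega j z := by
  have hP : L.weierstrassP = fun u => L.weierstrassPExcept 0 u + 1 / u ^ 2 := by
    funext u
    simpa using (L.weierstrassPExcept_add 0 u).symm
  have hPExcept : ContDiffAt ℂ j (L.weierstrassPExcept 0) (-z) :=
    (analyticAt_weierstrassPExcept_zero L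
      (notMem_of_norm_lt_minPeriod L (by rwa [norm_neg]))).contDiffAt
  have hinv : ContDiffAt ℂ j (fun u : ℂ => 1 / u ^ 2) (-z) :=
    contDiffAt_const.div (contDiffAt_id.pow 2) (pow_ne_zero 2 (neg_ne_zero.mpr hz0))
  have hfactorial : ((j + 1)! : ℂ) ≠ 0 := Nat.cast_ne_zero.mpr (Nat.factorial_ne_zero _)
  have hsign : (-1 : ℂ) ^ j * (j + 1)! / (-z) ^ (j + 2) = (j + 1)! / z ^ (j + 2) := by
    rw [neg_pow z, pow_add (-1), neg_one_sq, mul_one,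
      mul_div_mul_left _ _ (pow_ne_zero _ (neg_ne_zero.mpr one_ne_zero))]
  rw [PeriodPair.timeCoeff, omega_eq L hz, hP, iteratedDeriv_fun_add hPExcept hinv,
    iteratedDeriv_one_div_sq, hsign]
  field_simp
  ring

end TimeCoefficients

end Lame

/-! ### The residual as an elliptic function of the spectral parameter -/

namespace Lame

theorem IsLatticePeriodic.meromorphicAt_of_mem {L : PeriodPair} {f : ℂ → ℂ}
    (hf : IsLatticePeriodic L f) {w : ℂ} (hw : w ∈ L.lattice) (h0 : MeromorphicAt f 0) :
    MeromorphicAt f w :=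
  (MeromorphicAt.comp_analyticAt (g := fun u => u + -w) (by rwa [add_neg_cancel])
    (by fun_prop)).congr (hf (-w) (neg_mem hw) w)

section LameQuotient

variable (L : PeriodPair)

theorem eventually_notMem_lattice (z : ℂ) : ∀ᶠ u in 𝓝[≠] z, u ∉ L.lattice := by
  filter_upwards [nhdsWithin_le_nhds (L.compl_lattice_sdiff_singleton_mem_nhds z),
    self_mem_nhdsWithin] with u hu hne h
  exact hu ⟨h, hne⟩

theorem timeCoeff_add {w : ℂ} (hw : w ∈ L.lattice) (k : ℂ) (j : ℕ) :
    L.timeCoeff (k + w) j = L.timeCoeff k j := by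
  have hperiod : (fun z => L.weierstrassP (z + w)) = L.weierstrassP :=
    funext fun z => L.weierstrassP_add_coe z ⟨w, hw⟩
  rw [PeriodPair.timeCoeff, PeriodPair.timeCoeff,
    ← congrFun (iteratedDeriv_comp_add_const j L.weierstrassP w) k, hperiod]

theorem analyticAt_timeCoeff {k : ℂ} (hk : k ∉ L.lattice) (j : ℕ) :
    AnalyticAt ℂ (fun k => L.timeCoeff k j) k := by
  have hP : AnalyticAt ℂ L.weierstrassP k :=
    L.differentiableOn_weierstrassP.analyticAt ((isOpen_compl_lattice L).mem_nhds hk)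
  exact (analyticAt_iteratedDeriv hP j).div_const.sub analyticAt_const

theorem exists_lamePhi_add {w : ℂ} (hw : w ∈ L.lattice) {k : ℂ} (hk : k ∉ L.lattice) :
    ∃ c ≠ 0, ∀ y, L.lamePhi y (k + w) = c * L.lamePhi y k := by
  obtain ⟨η, c, hc, hζ, hσ⟩ := exists_quasiPeriod L hw
  refine ⟨c * Complex.exp (η * k), mul_ne_zero hc (Complex.exp_ne_zero _), fun y => ?_⟩
  have hexp : Complex.exp (η * (y + k)) * Complex.exp (-(L.zeta k + η) * y) =
      Complex.exp (η * k) * Complex.exp (-L.zeta k * y) := by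
    rw [← Complex.exp_add, ← Complex.exp_add]
    congr 1
    ring
  rw [PeriodPair.lamePhi, PeriodPair.lamePhi, ← add_assoc, hσ, hζ k hk]
  linear_combination (c * L.sigma (y + k) / L.sigma y) * hexp

variable {L} {x : ℂ}

theorem analyticAt_lamePhi {k : ℂ} (hx : x ∉ L.lattice) (hk : k ∉ L.lattice) :
    AnalyticAt ℂ (L.lamePhi x) k := (jointAnalyticAt_lamePhi L hx hk).analyticAt_right

theorem lamePhi_ne_zero {k : ℂ} (hx : x ∉ L.lattice) (hk : x + k ∉ L.lattice) :
    L.lamePhi x k ≠ 0 :=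
  mul_ne_zero (div_ne_zero (sigma_ne_zero L hk) (sigma_ne_zero L hx)) (Complex.exp_ne_zero _)

theorem eventually_lamePhi_ne_zero (hx : x ∉ L.lattice) (z : ℂ) :
    ∀ᶠ k in 𝓝[≠] z, L.lamePhi x k ≠ 0 := by
  filter_upwards [(tendsto_add_const_nhdsNE z x).eventually (eventually_notMem_lattice L (z + x))]
    with k hk
  exact lamePhi_ne_zero hx (by rwa [add_comm])

theorem meromorphicOrderAt_lamePhi (hx : x ∉ L.lattice) :
    meromorphicOrderAt (L.lamePhi x) (-x) = 1 := by
  have hnx : -x ∉ L.lattice := by simpa using hx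
  refine (meromorphicOrderAt_eq_int_iff (analyticAt_lamePhi hx hnx).meromorphicAt).mpr
    ⟨fun k => sigmaProd L (x + k) / L.sigma x * Complex.exp (-L.zeta k * x), ?_, ?_,
      Eventually.of_forall fun k => ?_⟩
  · have hprod : AnalyticAt ℂ (fun k => sigmaProd L (x + k)) (-x) :=
      ((differentiable_sigmaProd L).analyticAt 0).comp_of_eq (by fun_prop) (by simp)
    have hzeta := analyticAt_zeta L hnx
    fun_prop
  · simp only [add_neg_cancel]
    exact mul_ne_zero (div_ne_zero (sigmaProd_ne_zero L fun h => h.2 rfl) (sigma_ne_zero L hx))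
      (Complex.exp_ne_zero _)
  · rw [PeriodPair.lamePhi, sigma_eq_mul_sigmaProd, sub_neg_eq_add, zpow_one, smul_eq_mul]
    ring

end LameQuotient

section Residual

variable {L : PeriodPair} {b : ℕ → ℂ → ℂ} {j : ℕ} {x : ℂ}

/-- `(∑_{i ≤ j+2} bᵢ ∂ⁱ) Φ(x; k) - (℘⁽ʲ⁾(k)/(j+1)! - aⱼ/(j+1)) Φ(x; k)`: the failure of `Φ` to solve
the linear problem at time `t_{j+2}` for the differential operator with coefficients `b`. -/
def residual (L : PeriodPair) (b : ℕ → ℂ → ℂ) (j : ℕ) (x k : ℂ) : ℂ :=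
  (∑ i ∈ range (j + 2 + 1), b i x * iteratedDeriv i (fun y => L.lamePhi y k) x) -
    L.timeCoeff k j * L.lamePhi x k

theorem analyticAt_residual {k : ℂ} (hx : x ∉ L.lattice) (hk : k ∉ L.lattice) :
    AnalyticAt ℂ (residual L b j x) k := by
  refine (Finset.analyticAt_fun_sum _ fun i _ => analyticAt_const.mul ?_).sub
    ((analyticAt_timeCoeff L hk j).mul (analyticAt_lamePhi hx hk))
  simp only [iteratedDeriv_eq_derivFst]
  exact ((jointAnalyticAt_lamePhi L hx hk).derivFst_iterate i).analyticAt_right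

theorem isLatticePeriodic_residual_div_lamePhi :
    IsLatticePeriodic L fun k => residual L b j x k / L.lamePhi x k := fun w hw z => by
  filter_upwards [eventually_notMem_lattice L z] with k hk
  obtain ⟨c, hc, hPhi⟩ := exists_lamePhi_add L hw hk
  have hresidual : residual L b j x (k + w) = c * residual L b j x k := by
    simp only [residual, hPhi, timeCoeff_add L hw, iteratedDeriv_const_mul_field, mul_sub, mul_sum,
      mul_left_comm c]
  rw [hresidual, hPhi, mul_div_mul_left _ _ hc]

theorem pow_mul_residual_neg (hx : x ∉ L.lattice) {z : ℂ} (hz0 : z ≠ 0) (hz : ‖z‖ < minPeriod L) :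
    z ^ (j + 2) * residual L b j x (-z) =
      Complex.exp (x / z) * defectSymbol b L.vHat0 (L.omega j) (j + 2) x z := by
  have hzL : z ∉ L.lattice := fun h => notMem_of_norm_lt_minPeriod L hz ⟨h, hz0⟩
  have hterm : ∀ i ∈ range (j + 2 + 1), z ^ (j + 2) * (b i x *
      iteratedDeriv i (fun y => L.lamePhi y (-z)) x) = Complex.exp (x / z) *
        (b i x * (z ^ (j + 2 - i) * (conjSymbol^[i] L.vHat0) x z)) := by
    intro i hi
    have hpow : z ^ (j + 2) = z ^ (j + 2 - i) * z ^ i := by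
      rw [← pow_add, Nat.sub_add_cancel (Nat.lt_succ_iff.mp (mem_range.mp hi))]
    rw [hpow]
    linear_combination (z ^ (j + 2 - i) * b i x) * pow_mul_iteratedDeriv_lamePhi L hx hzL i
  rw [residual, defectSymbol, mul_sub, mul_sum, mul_sub, mul_sum, sum_congr rfl hterm,
    lamePhi_neg, timeCoeff_neg L j hz0 hz]
  field_simp

theorem JointAnalyticAt.analyticAt_defectSymbol {q : ℂ → ℂ} {F : ℂ → ℂ → ℂ} {n : ℕ} {z : ℂ}
    (hF : JointAnalyticAt F x z) (hq : AnalyticAt ℂ q z) :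
    AnalyticAt ℂ (defectSymbol b F q n x) z := by
  have hFx := hF.analyticAt_right
  refine (Finset.analyticAt_fun_sum _ fun i _ => ?_).sub (by fun_prop)
  have := (hF.conjSymbol_iterate i).analyticAt_right
  fun_prop

theorem exists_residual_div_lamePhi_eventuallyEq (hx : x ∉ L.lattice)
    (hdefect : ∀ m < j + 3, taylorCoeff m (defectSymbol b L.vHat0 (L.omega j) (j + 2) x) = 0) :
    ∃ g, AnalyticAt ℂ g 0 ∧ g 0 = 0 ∧
      (fun k => residual L b j x k / L.lamePhi x k) =ᶠ[𝓝[≠] 0] g := by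
  have hvHat0 : JointAnalyticAt L.vHat0 x 0 := isAnalyticSymbol_vHat0 L x hx
  have hne : L.vHat0 x 0 ≠ 0 := vHat0_zero L hx ▸ one_ne_zero
  obtain ⟨g, hg, hgdefect⟩ := exists_eq_pow_mul_of_taylorCoeff_eq_zero
    (hvHat0.analyticAt_defectSymbol (analyticAt_omega L j (by simpa using minPeriod_pos L))) hdefect
  have hquot : AnalyticAt ℂ (fun z => z * g z / L.vHat0 x z) 0 :=
    (analyticAt_id.mul hg).div hvHat0.analyticAt_right hne
  refine ⟨fun k => (fun z => z * g z / L.vHat0 x z) (-k), hquot.comp_of_eq (by fun_prop) (by simp),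
    by simp, ?_⟩
  suffices hreflected : ∀ᶠ z in 𝓝[≠] (0 : ℂ), residual L b j x (-z) / L.lamePhi x (-z) =
      z * g z / L.vHat0 x z by
    have hneg := tendsto_neg_nhdsNE 0
    rw [neg_zero] at hneg
    filter_upwards [hneg.eventually hreflected] with k hk
    rwa [neg_neg] at hk
  filter_upwards [nhdsWithin_le_nhds hgdefect, self_mem_nhdsWithin,
    nhdsWithin_le_nhds (hvHat0.analyticAt_right.continuousAt.eventually_ne hne),
    nhdsWithin_le_nhds (Metric.ball_mem_nhds (0 : ℂ) (minPeriod_pos L))] with z hz hz0 hvz hzR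
  have hresidual := pow_mul_residual_neg (b := b) (j := j) hx hz0 (mem_ball_zero_iff.mp hzR)
  rw [lamePhi_neg, div_eq_div_iff (mul_ne_zero hvz (Complex.exp_ne_zero _)) hvz]
  apply mul_left_cancel₀ (pow_ne_zero (j + 2) hz0)
  rw [← mul_assoc, hresidual, hz]
  ring

theorem neg_one_le_meromorphicOrderAt_residual_div_lamePhi (hx : x ∉ L.lattice) :
    -1 ≤ meromorphicOrderAt (fun k => residual L b j x k / L.lamePhi x k) (-x) := by
  have hnx : -x ∉ L.lattice := by simpa using hx
  simp only [div_eq_mul_inv]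
  rw [show (fun k => residual L b j x k * (L.lamePhi x k)⁻¹) =
    residual L b j x * (L.lamePhi x)⁻¹ from rfl,
    meromorphicOrderAt_mul (analyticAt_residual hx hnx).meromorphicAt
      (analyticAt_lamePhi hx hnx).meromorphicAt.inv, meromorphicOrderAt_inv,
    meromorphicOrderAt_lamePhi hx]
  exact le_add_of_nonneg_left (analyticAt_residual hx hnx).meromorphicOrderAt_nonneg

theorem residual_div_lamePhi_eventuallyEq_zero (hx : x ∉ L.lattice)
    (hdefect : ∀ m < j + 3, taylorCoeff m (defectSymbol b L.vHat0 (L.omega j) (j + 2) x) = 0)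
    (k : ℂ) : (fun k => residual L b j x k / L.lamePhi x k) =ᶠ[𝓝[≠] k] fun _ => 0 := by
  obtain ⟨g, hg, hg0, hquot⟩ := exists_residual_div_lamePhi_eventuallyEq hx hdefect
  have hperiodic : IsLatticePeriodic L fun k => residual L b j x k / L.lamePhi x k :=
    isLatticePeriodic_residual_div_lamePhi
  have hmeromorphic : Meromorphic fun k => residual L b j x k / L.lamePhi x k := fun z => by
    by_cases hz : z ∈ L.lattice
    · exact hperiodic.meromorphicAt_of_mem hz (hg.meromorphicAt.congr hquot.symm)
    · exact (analyticAt_residual hx hz).meromorphicAt.div (analyticAt_lamePhi hx hz).meromorphicAt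
  obtain ⟨c, hc⟩ := hperiodic.exists_eventuallyEq_const_of_simple_pole hmeromorphic (-x)
    (fun z hz => by
      by_cases hzL : z ∈ L.lattice
      · rw [hperiodic.meromorphicOrderAt_of_mem hzL, meromorphicOrderAt_congr hquot]
        exact hg.meromorphicOrderAt_nonneg
      · exact ((analyticAt_residual hx hzL).div (analyticAt_lamePhi hx hzL)
          (lamePhi_ne_zero hx (by rwa [sub_neg_eq_add, add_comm] at hz))).meromorphicOrderAt_nonneg)
    (neg_one_le_meromorphicOrderAt_residual_div_lamePhi hx)
  have hlim : Tendsto g (𝓝[≠] 0) (𝓝 (g 0)) :=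
    hg.continuousAt.tendsto.mono_left nhdsWithin_le_nhds
  have hc0 : c = 0 :=
    (tendsto_nhds_unique (tendsto_const_nhds.congr' ((hc 0).symm.trans hquot)) hlim).trans hg0
  exact hc0 ▸ hc k

theorem residual_eq_zero (hx : x ∉ L.lattice)
    (hdefect : ∀ m < j + 3, taylorCoeff m (defectSymbol b L.vHat0 (L.omega j) (j + 2) x) = 0)
    {k : ℂ} (hk : k ∉ L.lattice) : residual L b j x k = 0 := by
  have hzero : residual L b j x =ᶠ[𝓝[≠] k] fun _ => 0 := by
    filter_upwards [residual_div_lamePhi_eventuallyEq_zero hx hdefect k,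
      eventually_lamePhi_ne_zero hx k] with u hu hne
    exact (div_eq_zero_iff.mp hu).resolve_right hne
  exact tendsto_nhds_unique ((analyticAt_residual hx hk).continuousAt.tendsto.mono_left
    nhdsWithin_le_nhds) (tendsto_const_nhds.congr' hzero.symm)

end Residual

end Lame

/-! ### The eigenfunction `Ψ` -/

namespace Lame

theorem applyNonneg_eq_sum {U : Opens ℂ} {P : PseudoDiffOp (HolFun U)} {n : ℕ} (hP : P.OrderLE n)
    (f : ℂ → ℂ) (x : U) :
    P.applyNonneg f x = ∑ i ∈ range (n + 1), (P.coeff i).1 x * iteratedDeriv i f x := by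
  have hcoeff (i : ℕ) : P.nonneg.coeff i = P.coeff i :=
    if_pos (e := (0 : HolFun U)) (Int.natCast_nonneg i)
  simp only [PseudoDiffOp.applyNonneg, hcoeff]
  refine finsum_eq_sum_of_support_subset _ (Function.support_subset_iff'.mpr fun i hi => ?_)
  have hni : (n : ℤ) < i := by
    simp only [coe_range, Set.mem_Iio, not_lt] at hi
    omega
  rw [hP i hni]
  exact zero_mul _

variable (L : PeriodPair)

theorem orderLE_opL0 : L.opL0.OrderLE 1 := (isMonicOrderZero_opV0 L).isLaxForm.orderLE

theorem orderLE_opL0_pow (n : ℕ) : (L.opL0 ^ n).OrderLE n := by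
  simpa using (orderLE_opL0 L).pow n

section Intertwining

/-- The operator `ω_{j+2}(∂⁻¹)`. -/
def opOmega (j : ℕ) : PseudoDiffOp (HolFun L.domain) := opOfSymbol L.domain fun _ z => L.omega j z

/-- The coefficients of `(L₀ⁿ)_{≥ 0}`, extended by zero to the lattice points. -/
def laxCoeff (n i : ℕ) : ℂ → ℂ := HolFun.ext0 ((L.opL0 ^ n).coeff i).1

theorem analyticAt_omega_zero (j : ℕ) : AnalyticAt ℂ (L.omega j) 0 :=
  analyticAt_omega L j (by simpa using minPeriod_pos L)

theorem orderLE_opOmega (j : ℕ) : (opOmega L j).OrderLE (-1) := by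
  intro m hm
  rcases lt_or_ge 0 m with hpos | hnonpos
  · exact orderLE_opOfSymbol _ m hpos
  · obtain rfl : m = -(0 : ℕ) := by omega
    refine HolFun.ext fun x => ?_
    rw [opOmega, opOfSymbol_coeff_neg_apply (.of_right (analyticAt_omega_zero L j)),
      taylorCoeff_zero, omega_zero]
    rfl

theorem opL0_pow_mul_opV0 (n : ℕ) : L.opL0 ^ n * L.opV0 = L.opV0 * PseudoDiffOp.D n := by
  rw [PeriodPair.opL0, (isMonicOrderZero_opV0 L).isInverse_inv.conj_pow, PseudoDiffOp.D_one_pow]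

theorem nonneg_mul_opV0_sub (j : ℕ) :
    (L.opL0 ^ (j + 2)).nonneg * L.opV0 -
        L.opV0 * (PseudoDiffOp.D ((j + 2 : ℕ) : ℤ) + opOmega L j) =
      opOfSymbol L.domain (defectSymbol (laxCoeff L (j + 2)) L.vHat0 (L.omega j) (j + 2)) *
        PseudoDiffOp.D ((j + 2 : ℕ) : ℤ) := by
  rw [opV0_eq_opOfSymbol]
  exact nonneg_mul_opOfSymbol_sub (orderLE_opL0_pow L (j + 2)) (isAnalyticSymbol_vHat0 L)
    (analyticAt_omega_zero L j)

theorem isAnalyticSymbol_defectSymbol_laxCoeff (j : ℕ) :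
    IsAnalyticSymbol L.domain
      (defectSymbol (laxCoeff L (j + 2)) L.vHat0 (L.omega j) (j + 2)) :=
  .defectSymbol (fun i => (L.opL0 ^ (j + 2)).coeff i) (isAnalyticSymbol_vHat0 L)
    (analyticAt_omega_zero L j) (j + 2)

theorem orderLE_nonneg_mul_opV0_sub (j : ℕ) :
    ((L.opL0 ^ (j + 2)).nonneg * L.opV0 -
      L.opV0 * (PseudoDiffOp.D ((j + 2 : ℕ) : ℤ) + opOmega L j)).OrderLE (-1) := by
  have hV : L.opV0.OrderLE 0 := (isMonicOrderZero_opV0 L).orderLE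
  have hsum : ((L.opL0 ^ (j + 2)).negPart * L.opV0 + L.opV0 * opOmega L j).OrderLE (-1) :=
    ((PseudoDiffOp.orderLE_negPart _).mul hV).add (hV.mul (orderLE_opOmega L j))
  intro m hm
  rw [eq_sub_of_add_eq (PseudoDiffOp.nonneg_add_negPart (L.opL0 ^ (j + 2))), sub_mul,
    opL0_pow_mul_opV0, mul_add, sub_sub, add_left_comm, sub_add_cancel_left,
    PseudoDiffOp.neg_coeff, hsum m hm, neg_zero]

theorem taylorCoeff_defectSymbol_laxCoeff (j : ℕ) {x : ℂ} (hx : x ∈ L.domain) {m : ℕ}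
    (hm : m < j + 3) :
    taylorCoeff m (defectSymbol (laxCoeff L (j + 2)) L.vHat0 (L.omega j) (j + 2) x) = 0 := by
  have hcoeff := orderLE_nonneg_mul_opV0_sub L j ((j + 2 : ℕ) - m) (by omega)
  rw [nonneg_mul_opV0_sub, PseudoDiffOp.mul_D_coeff, sub_sub_cancel_left] at hcoeff
  rw [← opOfSymbol_coeff_neg_apply (isAnalyticSymbol_defectSymbol_laxCoeff L j) m ⟨x, hx⟩, hcoeff]
  rfl

theorem residual_laxCoeff (j : ℕ) {x : ℂ} (hx : x ∈ L.domain) {k : ℂ} (hk : k ∉ L.lattice) :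
    residual L (laxCoeff L (j + 2)) j x k = 0 :=
  residual_eq_zero hx (fun _ hm => taylorCoeff_defectSymbol_laxCoeff L j hx hm) hk

theorem nonneg_mul_opV0 (j : ℕ) :
    (L.opL0 ^ (j + 2)).nonneg * L.opV0 =
      L.opV0 * (PseudoDiffOp.D ((j : ℤ) + 2) + opOmega L j) := by
  refine sub_eq_zero.mp ((nonneg_mul_opV0_sub L j).trans ?_)
  rw [opOfSymbol_eq_zero (isAnalyticSymbol_defectSymbol_laxCoeff L j) fun x hx => ?_, zero_mul]
  filter_upwards [Metric.ball_mem_nhds (0 : ℂ) (minPeriod_pos L)] with z hz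
  have hz : ‖z‖ < minPeriod L := mem_ball_zero_iff.mp hz
  rcases eq_or_ne z 0 with rfl | hz0
  · rw [← taylorCoeff_zero (defectSymbol _ _ _ _ x)]
    exact taylorCoeff_defectSymbol_laxCoeff L j hx (by omega)
  · have hzL : -z ∉ L.lattice := fun h =>
      notMem_of_norm_lt_minPeriod L hz ⟨neg_mem_iff.mp h, hz0⟩
    have h := pow_mul_residual_neg (b := laxCoeff L (j + 2)) (j := j) hx hz0 hz
    rw [residual_laxCoeff L j hx hzL, mul_zero] at h
    exact (mul_eq_zero.mp h.symm).resolve_left (Complex.exp_ne_zero _)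

end Intertwining

section Eigenfunction

theorem applyNonneg_opL0_pow (n : ℕ) (f : ℂ → ℂ) (x : L.domain) :
    (L.opL0 ^ n).applyNonneg f x = ∑ i ∈ range (n + 1), laxCoeff L n i x * iteratedDeriv i f x := by
  simp only [applyNonneg_eq_sum (orderLE_opL0_pow L n), laxCoeff, HolFun.ext0_coe]

theorem applyNonneg_opL0_one (f : ℂ → ℂ) (x : L.domain) :
    (L.opL0 ^ 1).applyNonneg f x = deriv f x := by
  have hLax : L.opL0.IsLaxForm := (isMonicOrderZero_opV0 L).isLaxForm
  rw [applyNonneg_eq_sum (orderLE_opL0_pow L 1), pow_one, sum_range_succ, sum_range_one,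
    Nat.cast_zero, Nat.cast_one, hLax.1, hLax.2.1]
  simp

theorem applyNonneg_wavePsi (j : ℕ) (x : L.domain) (t : ℕ → ℂ) {k : ℂ} (hk : k ∉ L.lattice) :
    (L.opL0 ^ (j + 2)).applyNonneg (fun y => L.wavePsi y t k) x =
      L.timeCoeff k j * L.wavePsi x t k := by
  have hresidual := residual_laxCoeff L j x.2 hk
  rw [residual, sub_eq_zero] at hresidual
  simp only [applyNonneg_opL0_pow, PeriodPair.wavePsi, mul_comm (L.lamePhi _ _),
    iteratedDeriv_const_mul_field]
  rw [mul_left_comm, ← hresidual, mul_sum]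
  exact sum_congr rfl fun i _ => mul_left_comm _ _ _

theorem differentiableOn_wavePsi (t : ℕ → ℂ) {k : ℂ} (hk : k ∉ L.lattice) :
    DifferentiableOn ℂ (fun y => L.wavePsi y t k) L.domain := fun _ hx =>
  ((jointAnalyticAt_lamePhi L hx hk).analyticAt_left.differentiableAt.mul_const
    _).differentiableWithinAt

theorem tsum_mul_add_single {a t : ℕ → ℂ} (h : Summable fun i => a i * t i) (j : ℕ) (s : ℂ) :
    ∑' i, a i * (t + Pi.single j s : ℕ → ℂ) i = (∑' i, a i * t i) + a j * s := by
  have hsingle : HasSum (fun i => a i * (Pi.single j s : ℕ → ℂ) i) (a j * s) := by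
    simpa using hasSum_single (f := fun i => a i * (Pi.single j s : ℕ → ℂ) i) j fun i hi => by
      simp [Pi.single_eq_of_ne hi]
  simpa only [Pi.add_apply, mul_add] using (h.hasSum.add hsingle).tsum_eq

theorem hasDerivAt_exp_tsum_mul_add_single {a t : ℕ → ℂ} (h : Summable fun i => a i * t i) (j : ℕ) :
    HasDerivAt (fun s : ℂ => Complex.exp (∑' i, a i * (t + Pi.single j s : ℕ → ℂ) i))
      (a j * Complex.exp (∑' i, a i * t i)) 0 := by
  simp only [tsum_mul_add_single h]
  have hlinear : HasDerivAt (fun s : ℂ => (∑' i, a i * t i) + a j * s) (a j) 0 := by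
    simpa using ((hasDerivAt_id (0 : ℂ)).const_mul (a j)).const_add (∑' i, a i * t i)
  simpa [mul_comm] using hlinear.cexp

theorem hasDerivAt_wavePsi_time (j : ℕ) (x : ℂ) {t : ℕ → ℂ} {k : ℂ}
    (ht : Summable fun j => L.timeCoeff k j * t j) :
    HasDerivAt (fun s : ℂ => L.wavePsi x (t + Pi.single j s) k)
      (L.timeCoeff k j * L.wavePsi x t k) 0 :=
  ((hasDerivAt_exp_tsum_mul_add_single ht j).const_mul (L.lamePhi x k)).congr_deriv
    (mul_left_comm _ _ _)

end Eigenfunction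

end Lame

/-! ### The operator `C(t)` and the formal wave function -/

namespace Lame

section Convergence

theorem exists_norm_iteratedDeriv_le {f : ℂ → ℂ} {U K : Set ℂ} (hf : DifferentiableOn ℂ f U)
    (hU : IsOpen U) (hK : IsCompact K) (hKU : K ⊆ U) :
    ∃ M q : ℝ, ∀ z ∈ K, ∀ j : ℕ, ‖iteratedDeriv j f z‖ ≤ j ! * (M * q ^ j) := by
  obtain ⟨δ, hδ, hδU⟩ := hK.exists_cthickening_subset_open hU hKU
  obtain ⟨M, hM⟩ := hK.cthickening.exists_bound_of_continuousOn (hf.continuousOn.mono hδU)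
  refine ⟨M, δ⁻¹, fun z hz j => ?_⟩
  have hball : Metric.closedBall z δ ⊆ Metric.cthickening δ K :=
    Metric.closedBall_subset_cthickening hz δ
  have hCauchy := Complex.norm_iteratedDeriv_le_of_forall_mem_sphere_norm_le j hδ
    (hf.diffContOnCl_ball (hball.trans hδU))
    fun w hw => hM w (hball (Metric.sphere_subset_closedBall hw))
  rwa [inv_pow, ← div_eq_mul_inv, ← mul_div_assoc]

theorem norm_div_factorial_succ_le {a : ℂ} {j : ℕ} {B : ℝ} (h : ‖a‖ ≤ j ! * B) :
    ‖a / (j + 1)!‖ ≤ B := by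
  have hpos : (0 : ℝ) < j ! := Nat.cast_pos.mpr j.factorial_pos
  have hB : 0 ≤ B := nonneg_of_mul_nonneg_right ((norm_nonneg a).trans h) hpos
  rw [norm_div, Complex.norm_natCast, div_le_iff₀ (Nat.cast_pos.mpr (j + 1).factorial_pos),
    mul_comm]
  exact h.trans (mul_le_mul_of_nonneg_right (Nat.cast_le.mpr (Nat.factorial_le j.le_succ)) hB)

theorem summable_mul_norm_of_mem_entireTimes {t : ℕ → ℂ} (ht : t ∈ entireTimes)
    (M q M' q' : ℝ) : Summable fun j => (M * q ^ j + M' * q' ^ j) * ‖t j‖ :=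
  (((ht q).mul_left M).add ((ht q').mul_left M')).congr fun j => by ring

theorem summable_mul_of_mem_entireTimes {a t : ℕ → ℂ} (ht : t ∈ entireTimes) {M q M' q' : ℝ}
    (ha : ∀ j, ‖a j‖ ≤ M * q ^ j + M' * q' ^ j) : Summable fun j => a j * t j :=
  Summable.of_norm_bounded (summable_mul_norm_of_mem_entireTimes ht M q M' q') fun j => by
    rw [norm_mul]
    exact mul_le_mul_of_nonneg_right (ha j) (norm_nonneg _)

theorem summable_pow_mul_of_mem_entireTimes {t : ℕ → ℂ} (ht : t ∈ entireTimes) (w : ℂ) :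
    Summable fun j => w ^ (j + 2) * t j :=
  summable_mul_of_mem_entireTimes ht (M := ‖w‖ ^ 2) (q := ‖w‖) (M' := 0) (q' := 0) fun j => by
    rw [norm_pow, zero_mul, add_zero, ← pow_add, add_comm]

variable (L : PeriodPair)

theorem exists_norm_laurentCoeff_div_le :
    ∃ M q : ℝ, ∀ j : ℕ, ‖L.laurentCoeff j / (j + 1)‖ ≤ M * q ^ j := by
  obtain ⟨M, q, hM⟩ := exists_norm_iteratedDeriv_le (L.differentiableOn_weierstrassPExcept 0)
    L.isOpen_compl_lattice_sdiff (isCompact_singleton (x := (0 : ℂ))) (by simp)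
  refine ⟨M, q, fun j => ?_⟩
  rw [laurentCoeff_div_succ]
  exact norm_div_factorial_succ_le (hM 0 rfl j)

theorem summable_timeCoeff {k : ℂ} (hk : k ∉ L.lattice) {t : ℕ → ℂ} (ht : t ∈ entireTimes) :
    Summable fun j => L.timeCoeff k j * t j := by
  obtain ⟨M, q, hM⟩ := exists_norm_iteratedDeriv_le L.differentiableOn_weierstrassP
    (isOpen_compl_lattice L) isCompact_singleton (Set.singleton_subset_iff.mpr hk)
  obtain ⟨M', q', hM'⟩ := exists_norm_laurentCoeff_div_le L
  exact summable_mul_of_mem_entireTimes ht fun j => (norm_sub_le _ _).trans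
    (add_le_add (norm_div_factorial_succ_le (hM k rfl j)) (hM' j))

theorem exists_norm_omega_le {ρ : ℝ} (hρ : ρ < minPeriod L) :
    ∃ M q M' q' : ℝ, ∀ z : ℂ, ‖z‖ ≤ ρ → ∀ j : ℕ, ‖L.omega j z‖ ≤ M * q ^ j + M' * q' ^ j := by
  have hball : Metric.closedBall (0 : ℂ) ρ ⊆ (L.lattice \ {0} : Set ℂ)ᶜ := fun z hz =>
    notMem_of_norm_lt_minPeriod L ((mem_closedBall_zero_iff.mp hz).trans_lt hρ)
  obtain ⟨M, q, hM⟩ := exists_norm_iteratedDeriv_le (L.differentiableOn_weierstrassPExcept 0)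
    L.isOpen_compl_lattice_sdiff (isCompact_closedBall (0 : ℂ) ρ) hball
  obtain ⟨M', q', hM'⟩ := exists_norm_laurentCoeff_div_le L
  refine ⟨M, q, M', q', fun z hz j => ?_⟩
  rw [omega_eq L (hz.trans_lt hρ)]
  exact (norm_sub_le _ _).trans
    (add_le_add (norm_div_factorial_succ_le (hM (-z) (by simpa using hz) j)) (hM' j))

theorem summable_omega {t : ℕ → ℂ} (ht : t ∈ entireTimes) {z : ℂ} (hz : ‖z‖ < minPeriod L) :
    Summable fun j => L.omega j z * t j := by
  obtain ⟨M, q, M', q', hM⟩ := exists_norm_omega_le L hz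
  exact summable_mul_of_mem_entireTimes ht (hM z le_rfl)

end Convergence

section TimeFactor

variable (L : PeriodPair) {t : ℕ → ℂ}

/-- The function `z ↦ exp (∑ⱼ ω_{j+2}(1/z) t_{j+2})`, the symbol of `C(t)`. -/
def timeFactor (t : ℕ → ℂ) (z : ℂ) : ℂ := Complex.exp (∑' j : ℕ, L.omega j z * t j)

theorem analyticAt_timeFactor (ht : t ∈ entireTimes) {z : ℂ} (hz : ‖z‖ < minPeriod L) :
    AnalyticAt ℂ (timeFactor L t) z := by
  obtain ⟨ρ, hzρ, hρ⟩ := exists_between hz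
  obtain ⟨M, q, M', q', hM⟩ := exists_norm_omega_le L hρ
  have hterm (j : ℕ) : DifferentiableOn ℂ (fun z => L.omega j z * t j) (Metric.ball 0 ρ) :=
    fun w hw => ((analyticAt_omega L j ((mem_ball_zero_iff.mp hw).trans
      hρ)).differentiableAt.mul_const _).differentiableWithinAt
  refine ((Complex.differentiableOn_tsum_of_summable_norm
    (summable_mul_norm_of_mem_entireTimes ht M q M' q') hterm Metric.isOpen_ball
    fun j w hw => ?_).analyticAt (Metric.isOpen_ball.mem_nhds (mem_ball_zero_iff.mpr hzρ))).cexp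
  rw [norm_mul]
  exact mul_le_mul_of_nonneg_right (hM w (mem_ball_zero_iff.mp hw).le j) (norm_nonneg _)

theorem analyticAt_timeFactor_zero (ht : t ∈ entireTimes) : AnalyticAt ℂ (timeFactor L t) 0 :=
  analyticAt_timeFactor L ht (by simpa using minPeriod_pos L)

theorem eventually_summable_omega (ht : t ∈ entireTimes) :
    ∀ᶠ z in 𝓝 0, Summable fun j => L.omega j z * t j := by
  filter_upwards [Metric.ball_mem_nhds (0 : ℂ) (minPeriod_pos L)] with z hz
  exact summable_omega L ht (mem_ball_zero_iff.mp hz)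

theorem jointAnalyticAt_timeFactor_add_single (ht : t ∈ entireTimes) (j : ℕ) :
    JointAnalyticAt (fun s => timeFactor L (t + Pi.single j s)) 0 0 := by
  have hω : AnalyticAt ℂ (fun p : ℂ × ℂ => L.omega j p.2 * p.1) (0, 0) :=
    JointAnalyticAt.mul (.of_right (analyticAt_omega_zero L j)) (.of_left analyticAt_id)
  refine (AnalyticAt.mul (JointAnalyticAt.of_right (analyticAt_timeFactor_zero L ht))
    hω.cexp).congr ?_
  filter_upwards [continuous_snd.tendsto ((0, 0) : ℂ × ℂ) |>.eventually
    (eventually_summable_omega L ht)] with p hp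
  simp only [timeFactor, tsum_mul_add_single hp, Complex.exp_add, Pi.mul_apply,
    Function.comp_apply]

theorem derivFst_timeFactor_add_single (ht : t ∈ entireTimes) (j : ℕ) :
    derivFst (fun s => timeFactor L (t + Pi.single j s)) 0 =ᶠ[𝓝 0]
      fun z => L.omega j z * timeFactor L t z := by
  filter_upwards [eventually_summable_omega L ht] with z hz
  exact (hasDerivAt_exp_tsum_mul_add_single hz j).deriv

theorem isMonicOrderZero_opC (t : ℕ → ℂ) : (L.opC t).IsMonicOrderZero :=
  PseudoDiffOp.isMonicOrderZero_monic _

theorem isConst_opC (t : ℕ → ℂ) : (L.opC t).IsConst := by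
  intro n
  simp only [PeriodPair.opC, PseudoDiffOp.monic]
  split_ifs
  · exact Derivation.map_one_eq_zero _
  · exact HolFun.deriv_algebraMap_eq_zero _
  · exact map_zero _

theorem opC_eq_opOfSymbol (ht : t ∈ entireTimes) :
    L.opC t = opOfSymbol L.domain fun _ z => timeFactor L t z := by
  refine eq_opOfSymbol (.of_right (analyticAt_timeFactor_zero L ht))
    (isMonicOrderZero_opC L t).orderLE fun n x => ?_
  rcases n with _ | n
  · rw [taylorCoeff_zero]
    simp [PeriodPair.opC, PseudoDiffOp.monic, timeFactor, omega_zero]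
  · have hcoeff : (L.opC t).coeff (-(n + 1 : ℕ)) =
        algebraMap ℂ (HolFun L.domain) (L.cCoeff t (n + 1)) := by
      simp only [PeriodPair.opC, PseudoDiffOp.monic]
      rw [if_neg (by omega), if_pos (by omega), neg_neg, Int.toNat_natCast]
    rw [hcoeff]
    rfl

theorem opC_coeff_neg_apply (ht : t ∈ entireTimes) (n : ℕ) (x : L.domain) :
    ((L.opC t).coeff (-n)).1 x = taylorCoeff n (timeFactor L t) := by
  rw [opC_eq_opOfSymbol L ht,
    opOfSymbol_coeff_neg_apply (.of_right (analyticAt_timeFactor_zero L ht))]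

theorem opOmega_mul_opC_coeff_neg_apply (ht : t ∈ entireTimes) (j n : ℕ) (x : L.domain) :
    ((opOmega L j * L.opC t).coeff (-n)).1 x =
      taylorCoeff n fun z => L.omega j z * timeFactor L t z := by
  have hω : IsAnalyticSymbol L.domain fun _ z => L.omega j z :=
    .of_right (analyticAt_omega_zero L j)
  have hτ := analyticAt_timeFactor_zero L ht
  rw [opOmega, opC_eq_opOfSymbol L ht, ← opOfSymbol_mul_right hω hτ,
    opOfSymbol_coeff_neg_apply (hω.mul (.of_right hτ))]

theorem hasOpTimeDerivAt_opC (ht : t ∈ entireTimes) (j : ℕ) :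
    HasOpTimeDerivAt L.opC (opOmega L j * L.opC t) j t := by
  intro m x
  rcases lt_or_ge 0 m with hm | hm
  · have hzero : (opOmega L j * L.opC t).coeff m = 0 :=
      (orderLE_opOmega L j).mul (isMonicOrderZero_opC L t).orderLE m (by omega)
    simp only [hzero, (isMonicOrderZero_opC L _).orderLE m hm]
    exact hasDerivAt_const _ _
  · obtain ⟨n, rfl⟩ : ∃ n : ℕ, m = -n := ⟨(-m).toNat, by omega⟩
    simp only [opC_coeff_neg_apply L (add_single_mem_entireTimes ht j _)]
    rw [opOmega_mul_opC_coeff_neg_apply L ht,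
      ← taylorCoeff_congr (derivFst_timeFactor_add_single L ht j)]
    exact (jointAnalyticAt_timeFactor_add_single L ht j).hasDerivAt_taylorCoeff n

theorem isDressing_opV0_opC : PseudoDiffOp.IsDressing L.opV0 L.opC (opOmega L) where
  monic := isMonicOrderZero_opV0 L
  monic_time := isMonicOrderZero_opC L
  isConst_time := isConst_opC L
  orderLE_symbol _ := orderLE_opOfSymbol _
  isConst_symbol j := isConst_opOfSymbol (analyticAt_omega_zero L j)
  nonneg_mul := nonneg_mul_opV0 L
  time_deriv _ ht j := hasOpTimeDerivAt_opC L ht j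

end TimeFactor

section Expansion

variable (L : PeriodPair) {t : ℕ → ℂ}

theorem formalPsi_coeff (t : ℕ → ℂ) (n : ℤ) :
    (L.formalPsi t).coeff n = (L.opV0 * L.opC t).coeff n := by
  rw [PeriodPair.formalPsi, ← FormalWave.mul_smul]
  exact congrArg (fun P => P.coeff n) (FormalWave.toOp_smul_expXi (L.opV0 * L.opC t))

theorem formalPsi_coeff_neg_apply (ht : t ∈ entireTimes) (n : ℕ) (x : L.domain) :
    ((L.formalPsi t).coeff (-n)).1 x =
      taylorCoeff n fun z => L.vHat0 x z * timeFactor L t z := by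
  have hτ := analyticAt_timeFactor_zero L ht
  rw [formalPsi_coeff, opV0_eq_opOfSymbol, opC_eq_opOfSymbol L ht,
    ← opOfSymbol_mul_right (isAnalyticSymbol_vHat0 L) hτ,
    opOfSymbol_coeff_neg_apply ((isAnalyticSymbol_vHat0 L).mul (.of_right hτ))]

theorem wavePsi_neg (x : ℂ) (ht : t ∈ entireTimes) {z : ℂ} (hz0 : z ≠ 0)
    (hz : ‖z‖ < minPeriod L) :
    L.wavePsi x t (-z) = L.vHat0 x z * timeFactor L t z * Complex.exp (xiPhase x t z⁻¹) := by
  have hsplit : ∑' j, L.timeCoeff (-z) j * t j =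
      (∑' j, z⁻¹ ^ (j + 2) * t j) + ∑' j, L.omega j z * t j := by
    rw [← (summable_pow_mul_of_mem_entireTimes ht z⁻¹).tsum_add (summable_omega L ht hz)]
    refine tsum_congr fun j => ?_
    rw [timeCoeff_neg L j hz0 hz, inv_pow, add_mul]
  rw [PeriodPair.wavePsi, hsplit, lamePhi_neg, timeFactor, xiPhase, Complex.exp_add,
    Complex.exp_add, div_eq_inv_mul]
  ring

theorem differentiableOn_vHat0_mul_timeFactor (ht : t ∈ entireTimes) {x : ℂ} (hx : x ∉ L.lattice) :
    DifferentiableOn ℂ (fun z => L.vHat0 x z * timeFactor L t z)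
      (Metric.ball 0 (minPeriod L)) := by
  intro z hz
  have hz : ‖z‖ < minPeriod L := mem_ball_zero_iff.mp hz
  exact ((jointAnalyticAt_vHat0 L hx (notMem_of_norm_lt_minPeriod L hz)).analyticAt_right.mul
    (analyticAt_timeFactor L ht hz)).differentiableAt.differentiableWithinAt

theorem hasSum_formalPsi (ht : t ∈ entireTimes) (x : L.domain) {lam : ℂ} (hlam : lam ≠ 0)
    (hperiod : ‖lam⁻¹‖ < minPeriod L) :
    HasSum (fun n : ℤ => ((L.formalPsi t).coeff n).1 x * lam ^ n *
      Complex.exp (xiPhase x t lam)) (L.wavePsi x t (-lam⁻¹)) := by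
  rw [wavePsi_neg L x ht (inv_ne_zero hlam) hperiod, inv_inv]
  refine HasSum.mul_right _ ?_
  have hinj : Function.Injective fun n : ℕ => -(n : ℤ) :=
    neg_injective.comp Nat.cast_injective
  refine (hinj.hasSum_iff fun n hn => ?_).mp ?_
  · have hpos : 0 < n := by
      by_contra hnonpos
      exact hn ⟨(-n).toNat, by simp only; omega⟩
    rw [formalPsi_coeff, ((isMonicOrderZero_opV0 L).mul (isMonicOrderZero_opC L t)).orderLE n hpos]
    exact zero_mul _
  · refine (hasSum_taylorCoeff (differentiableOn_vHat0_mul_timeFactor L ht x.2)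
      hperiod).congr_fun fun n => ?_
    rw [Function.comp_apply, formalPsi_coeff_neg_apply L ht, zpow_neg, zpow_natCast, inv_pow]

end Expansion

end Lame

end LameFunction

theorem mainTheorem4 (L : PeriodPair) :
    -- the operators `V₀` and `L₀` are well defined
    (∀ n, DifferentiableOn ℂ (L.v0 n) L.domain) ∧
    PseudoDiffOp.IsInverse L.opV0 L.opV0⁻¹ ∧
    L.opL0.IsLaxForm ∧
    -- `Ψ` is defined for all times for which `ξ` converges
    (∀ k ∉ L.lattice, ∀ t ∈ entireTimes, Summable fun j => L.timeCoeff k j * t j) ∧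
    -- `Ψ(x, t; k)` is an eigenfunction: `∂Ψ/∂tₙ = (L₀ⁿ)_{≥ 0} Ψ` for all `n ≥ 1`, `t₁ = x`
    (∀ k ∉ L.lattice, ∀ t : ℕ → ℂ, (Summable fun j => L.timeCoeff k j * t j) →
      DifferentiableOn ℂ (fun y => L.wavePsi y t k) L.domain ∧
      ∀ x : L.domain,
        HasDerivAt (fun y => L.wavePsi y t k)
          ((L.opL0 ^ 1).applyNonneg (fun y => L.wavePsi y t k) x) x ∧
        ∀ j : ℕ, HasDerivAt (fun s : ℂ => L.wavePsi x (t + Pi.single j s) k)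
          ((L.opL0 ^ (j + 2)).applyNonneg (fun y => L.wavePsi y t k) x) 0) ∧
    -- `Ψ(x, t; -1/λ) = V₀ C e^ξ`, the expansion converging whenever `|1/λ|` is smaller than
    -- the absolute value of every nonzero period
    (∀ t ∈ entireTimes, ∀ x : L.domain, ∀ lam : ℂ, lam ≠ 0 →
      (∀ l ∈ L.lattice, l ≠ 0 → ‖lam⁻¹‖ < ‖l‖) →
      HasSum (fun n : ℤ => ((L.formalPsi t).coeff n).1 x * lam ^ n *
        Complex.exp (xiPhase x t lam)) (L.wavePsi x t (-lam⁻¹))) ∧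
    -- it solves the auxiliary linear problem of `L₀` with eigenvalue `λ`
    IsWaveFunction L.opL0 L.formalPsi ∧
    -- `V = V₀ C` is a wave operator for `L₀`
    IsWaveOperator L.opL0 L.formalPsi (fun t => L.opV0 * L.opC t) := by
  have hV₀ : L.opV0.IsMonicOrderZero := Lame.isMonicOrderZero_opV0 L
  have hdressing : PseudoDiffOp.IsDressing L.opV0 L.opC (Lame.opOmega L) :=
    Lame.isDressing_opV0_opC L
  refine ⟨(Lame.isAnalyticSymbol_vHat0 L).differentiableOn_taylorCoeff, hV₀.isInverse_inv,
    hV₀.isLaxForm, fun k hk t ht => Lame.summable_timeCoeff L hk ht,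
    fun k hk t ht => ⟨Lame.differentiableOn_wavePsi L t hk, fun x => ⟨?_, fun j => ?_⟩⟩,
    fun t ht x lam hlam hperiod =>
      Lame.hasSum_formalPsi L ht x hlam ((Lame.norm_lt_minPeriod_iff L).mpr hperiod),
    hdressing.isWaveFunction, hdressing.isWaveOperator⟩
  · rw [Lame.applyNonneg_opL0_one]
    exact ((Lame.differentiableOn_wavePsi L t hk).differentiableAt
      (L.domain.isOpen.mem_nhds x.2)).hasDerivAt
  · rw [Lame.applyNonneg_wavePsi L j x t hk]
    exact Lame.hasDerivAt_wavePsi_time L j x ht
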